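/- Let $n\ge 2$, $1<p<\infty$, $1<s\le\infty$, $p'=\frac{p}{p-1}$, $s'=\frac{s}{s-1}$ (with $s'=1$ if $s=\infty$). Let $\Omega$ be homogeneous of degree zero on $\mathbb R^n$ with $\Omega\in L_s(S^{n-1})$, let $w$ be a weight (locally integrable, a.e. in $(0,\infty)$), and let $c_0,A\ge 0$. Write $B(x,r)$ for open balls, $w(E)=\int_E w\,dx$, $\|f\|_{L_{p,w}(E)}=(\int_E|f|^pw\,dx)^{1/p}$, $L_p(w)$ for the functions with $\|f\|_{L_{p,w}(\mathbb R^n)}<\infty$, $L_{p,w}^{loc}$ for those with $\|f\|_{L_{p,w}(B)}<\infty$ for every ball $B$, $b_B=|B|^{-1}\int_Bb$, and $\|b\|_*=\sup_B|B|^{-1}\int_B|b-b_B|$; $b\in BMO$ means that $b$ is locally integrable and $\|b\|_*<\infty$. A weight $v$ is in $A_q$, $1<q<\infty$, if $\sup_B\big(|B|^{-1}\int_Bv\big)\big(|B|^{-1}\int_Bv^{1-q'}\big)^{q-1}<\infty$, and in $A_1$ if $|B|^{-1}\int_Bv\le C\,\operatorname{ess\,inf}_Bv$ for all balls $B$. For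 $b\in BMO(\mathbb R^n)$ let $T_{\Omega,b}$ be a sublinear operator, defined on a linear space $D\supseteq L_p(w)$ of functions and with measurable functions as values, such that (a) for every $f\in D\cap L_1(\mathbb R^n)$ with compact support, and for a.e. $x\notin\operatorname{supp}f$, $$|T_{\Omega,b}f(x)|\le c_0\int_{\mathbb R^n}|b(x)-b(y)|\frac{|\Omega(x-y)|}{|x-y|^n}|f(y)|\,dy;$$ (b) the same inequality holds for every $f\in D\cap L_{p,w}^{loc}$ that is not in $L_p(w)$ (a void condition if $D=L_p(w)$); (c) $\|T_{\Omega,b}f\|_{L_{p,w}(\mathbb R^n)}\le A\|b\|_*\|f\|_{L_{p,w}(\mathbb R^n)}$ for all $f\in L_p(w)$. Then the following hold. (i) If $s'\le p$ and $w\in A_{p/s'}$, then for every ball $B(x_0,r)$ and every $f\in D\cap L_{p,w}^{loc}$, $$\|T_{\Omega,b}f\|_{L_{p,w}(B(x_0,r))}\le C\,\|b\|_*\,w(B(x_0,r))^{\frac1p}\int_{2r}^\infty\Big(1+\ln\frac tr\Big)\|f\|_{L_{p,w}(B(x_0,t))}\,w(B(x_0,t))^{-\frac1p}\,\frac{dt}{t}.$$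 (ii) If $p<s$ and $w^{1-p'}\in A_{p'/s'}$, then for every ball $B(x_0,r)$ and every $f\in D\cap L_{p,w}^{loc}$, $$\|T_{\Omega,b}f\|_{L_{p,w}(B(x_0,r))}\le C\,\|b\|_*\,\|w\|_{L_{\frac{s}{s-p}}(B(x_0,r))}^{\frac1p}\int_{2r}^\infty\Big(1+\ln\frac tr\Big)\|f\|_{L_{p,w}(B(x_0,t))}\,\|w\|_{L_{\frac{s}{s-p}}(B(x_0,t))}^{-\frac1p}\,\frac{dt}{t},$$ where $\frac{s}{s-p}=1$ if $s=\infty$. The constants $C<\infty$ depend only on $n,p,s,\Omega,w,c_0,A$, and not on $b,D,T_{\Omega,b},f,x_0,r$. -/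

import Mathlib

open MeasureTheory Metric Set
open scoped ENNReal NNReal

noncomputable section

/-- A weight on `ℝⁿ`: a locally integrable function with values in `(0, ∞)` almost everywhere. -/
def IsWeight {n : ℕ} (w : EuclideanSpace ℝ (Fin n) → ℝ) : Prop :=
  LocallyIntegrable w ∧ ∀ᵐ x, 0 < w x

/-- The measure `w(x) dx`; thus `w(E) = ∫_E w(x) dx` is `weightMeasure w E`, the norm of
`L_{p,w}(B)` is `eLpNorm f p ((weightMeasure w).restrict B)`. -/
def weightMeasure {n : ℕ} (w : EuclideanSpace ℝ (Fin n) → ℝ) :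
    Measure (EuclideanSpace ℝ (Fin n)) :=
  volume.withDensity (fun x => ENNReal.ofReal (w x))

/-- The Muckenhoupt class `A_q`, `1 ≤ q < ∞`.
For `q = 1`: `|B|⁻¹ ∫_B w ≤ C ess inf_B w` for all balls `B`.
For `q > 1`: `(|B|⁻¹ ∫_B w) (|B|⁻¹ ∫_B w^{1-q'})^{q-1} ≤ C` for all balls `B`. -/
def IsMuckenhoupt {n : ℕ} (q : ℝ) (w : EuclideanSpace ℝ (Fin n) → ℝ) : Prop :=
  IsWeight w ∧
    ((q = 1 ∧ ∃ C : ℝ≥0, ∀ (x₀ : EuclideanSpace ℝ (Fin n)) (r : ℝ), 0 < r →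
        ∀ᵐ x ∂(volume.restrict (ball x₀ r)),
          ⨍⁻ y in ball x₀ r, ENNReal.ofReal (w y) ∂volume ≤ C * ENNReal.ofReal (w x)) ∨
      (1 < q ∧ ∃ C : ℝ≥0, ∀ (x₀ : EuclideanSpace ℝ (Fin n)) (r : ℝ), 0 < r →
        (⨍⁻ y in ball x₀ r, ENNReal.ofReal (w y) ∂volume) *
          (⨍⁻ y in ball x₀ r, ENNReal.ofReal (w y ^ (1 - Real.conjExponent q)) ∂volume) ^ (q - 1)
            ≤ C))

/-- The seminorm `‖b‖_* = sup_B |B|⁻¹ ∫_B |b - b_B|`, with values in `[0, ∞]`. -/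
def bmoSeminorm {𝕜 : Type*} [RCLike 𝕜] {n : ℕ} (b : EuclideanSpace ℝ (Fin n) → 𝕜) : ℝ≥0∞ :=
  ⨆ (x₀ : EuclideanSpace ℝ (Fin n)) (r : ℝ) (_ : 0 < r),
    ⨍⁻ y in ball x₀ r, ‖b y - ⨍ z in ball x₀ r, b z ∂volume‖ₑ ∂volume

/-- The space `BMO(ℝⁿ)`. -/
def IsBMO {𝕜 : Type*} [RCLike 𝕜] {n : ℕ} (b : EuclideanSpace ℝ (Fin n) → 𝕜) : Prop :=
  LocallyIntegrable b ∧ bmoSeminorm b < ∞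

/-- `Ω` is homogeneous of degree zero and belongs to `L_s(S^{n-1})`. (Membership does not depend
on the normalization of the surface measure.) -/
def IsRoughKernel {𝕜 : Type*} [RCLike 𝕜] {n : ℕ} (s : ℝ≥0∞)
    (Ω : EuclideanSpace ℝ (Fin n) → 𝕜) : Prop :=
  (∀ (t : ℝ) (x : EuclideanSpace ℝ (Fin n)), 0 < t → Ω (t • x) = Ω x) ∧
    MemLp (fun x : sphere (0 : EuclideanSpace ℝ (Fin n)) 1 => Ω x) s
      (volume : Measure (EuclideanSpace ℝ (Fin n))).toSphere

/-- The weighted Lebesgue space `L_p(w)`. -/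
def MemLpWeight {𝕜 : Type*} [RCLike 𝕜] {n : ℕ} (p : ℝ) (w : EuclideanSpace ℝ (Fin n) → ℝ)
    (f : EuclideanSpace ℝ (Fin n) → 𝕜) : Prop :=
  MemLp f (ENNReal.ofReal p) (weightMeasure w)

/-- The local space `L_{p,w}^{loc}`: `f ∈ L_{p,w}(B)` for every ball `B`. -/
def MemLpWeightLoc {𝕜 : Type*} [RCLike 𝕜] {n : ℕ} (p : ℝ) (w : EuclideanSpace ℝ (Fin n) → ℝ)
    (f : EuclideanSpace ℝ (Fin n) → 𝕜) : Prop :=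
  ∀ (x₀ : EuclideanSpace ℝ (Fin n)) (r : ℝ), 0 < r →
    MemLp f (ENNReal.ofReal p) ((weightMeasure w).restrict (ball x₀ r))

/-- `T`, defined on the linear space `D` of functions, is sublinear, with measurable values:
`|T(f+g)| ≤ |Tf| + |Tg|` and `|T(cf)| = |c| |Tf|` almost everywhere. -/
structure IsSublinearOn {𝕜 : Type*} [RCLike 𝕜] {n : ℕ}
    (D : Submodule 𝕜 (EuclideanSpace ℝ (Fin n) → 𝕜))
    (T : (EuclideanSpace ℝ (Fin n) → 𝕜) → (EuclideanSpace ℝ (Fin n) → 𝕜)) : Prop where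
  aestronglyMeasurable : ∀ f ∈ D, AEStronglyMeasurable (T f) volume
  add_le : ∀ f ∈ D, ∀ g ∈ D, ∀ᵐ x, ‖T (f + g) x‖ ≤ ‖T f x‖ + ‖T g x‖
  smul_eq : ∀ (c : 𝕜), ∀ f ∈ D, ∀ᵐ x, ‖T (c • f) x‖ = ‖c‖ * ‖T f x‖

/-- The size condition at `f`: for almost every `x ∉ supp f`,
`|Tf(x)| ≤ c₀ ∫ |b(x) - b(y)| |Ω(x-y)| |x-y|⁻ⁿ |f(y)| dy` (no condition where the right-hand side
is infinite). -/
def SizeConditionAt {𝕜 : Type*} [RCLike 𝕜] {n : ℕ} (c₀ : ℝ≥0)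
    (Ω b : EuclideanSpace ℝ (Fin n) → 𝕜)
    (T : (EuclideanSpace ℝ (Fin n) → 𝕜) → (EuclideanSpace ℝ (Fin n) → 𝕜))
    (f : EuclideanSpace ℝ (Fin n) → 𝕜) : Prop :=
  ∀ᵐ x, x ∉ tsupport f →
    ‖T f x‖ₑ ≤ c₀ * ∫⁻ y, ‖b x - b y‖ₑ * (‖Ω (x - y)‖ₑ / ‖x - y‖ₑ ^ n) * ‖f y‖ₑ

/-- `T` is a sublinear commutator-type operator `T_{Ω,b}`, defined on a linear space `D` of
functions that contains `L_p(w)`: it satisfies the size condition with constant `c₀` and is bounded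
on `L_p(w)` with norm at most `A ‖b‖_*`.

The size condition is required for the integrable functions of compact support. If `D` contains
functions of `L_{p,w}^{loc}` outside `L_p(w)`, it is required for those too, since boundedness on
`L_p(w)` says nothing about the meaning of `T f` there. For `D = L_p(w)` that clause is void. -/
structure IsRoughCommutator {𝕜 : Type*} [RCLike 𝕜] {n : ℕ} (p : ℝ)
    (w : EuclideanSpace ℝ (Fin n) → ℝ) (c₀ A : ℝ≥0) (Ω b : EuclideanSpace ℝ (Fin n) → 𝕜)
    (D : Submodule 𝕜 (EuclideanSpace ℝ (Fin n) → 𝕜))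
    (T : (EuclideanSpace ℝ (Fin n) → 𝕜) → (EuclideanSpace ℝ (Fin n) → 𝕜)) : Prop where
  mem_domain : ∀ f, MemLpWeight p w f → f ∈ D
  sublinear : IsSublinearOn D T
  size : ∀ f ∈ D, Integrable f → HasCompactSupport f → SizeConditionAt c₀ Ω b T f
  size_loc : ∀ f ∈ D, MemLpWeightLoc p w f → ¬ MemLpWeight p w f → SizeConditionAt c₀ Ω b T f
  bounded : ∀ f, MemLpWeight p w f →
    eLpNorm (T f) (ENNReal.ofReal p) (weightMeasure w) ≤
      A * bmoSeminorm b * eLpNorm f (ENNReal.ofReal p) (weightMeasure w)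

end

/-! Split `f = f₁ + f₂`, where `f₁` is `f` cut off to `B(x₀, 2r)`. The near part is controlled by
the boundedness on `L_p(w)`, because the norm of `f` over `B(x₀, 2r)` is dominated by the first term
of the dyadic sum that discretizes the logarithmic integral. For the far part, the size condition
gives on `B(x₀, r)` a sum over radii `R = 2^(k+1) r` of the terms `R⁻ⁿ ∫_{B(x₀,R)} |b(x) - b(y)|
|Ω(x-y)| |f(y)| dy`. So everything rests on `HasCommutatorKernelBound`, an `L_p(w)` bound for one
such integral whose constant grows only linearly in `k`. That linear factor becomes `1 + ln (t/r)`
in `tsum_dyadic_le_lintegral`.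

Two arguments give the kernel bound. For `p < s` (`hasCommutatorKernelBound_of_dual`), insert the
mean of `b` over `B(x₀, r)` and integrate in `x` first. Hölder with exponent `s/p` separates `Ω`
from the rest and leaves the weight `u = w^κ`, `κ = (s/p)'`. In `y`, duality leaves the weight `v =
w^(1-p')`. These are dual weights in the sense of `A_{p'/s'}`, and the `A_{p'/s'}` inequality turns
the mass of `v` into a negative power of the `L_κ` norm of `w`.

For `w ∈ A_{p/s'}` with `s < ∞` (`hasCommutatorKernelBound_of_muckenhoupt`), `Ω` may be too rough
for Hölder in `x`. Instead apply Hölder in `y` with exponents `s`, `s'` and substitute `z = x - y`.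
Now `|Ω(z)|^s` is a fixed density, and a Schur bound asks only for the `L_{sp}(w)` size of `b(x) -
b(x-z)`, uniformly in `z` (`exists_lintegral_rpow_sub_translate_le`). For `s = ∞`, part (i) falls
under the first argument.

The input on BMO is a weighted John–Nirenberg inequality, `exists_lintegral_rpow_sub_average_le`. It
is proved directly for measures satisfying `HasAveragingBound`, without a reverse Hölder inequality:
Calderón–Zygmund stopping cubes fill at most half the volume of a cube, hence at most a fixed
fraction of its weighted mass, and this is iterated. -/

/-! ### Jensen, Schur, Minkowski and Hölder inequalities for the lower integral. -/

section Inequalities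

variable {α : Type*} [MeasurableSpace α]

/-- Jensen's inequality for the unnormalized measure `g dν`. -/
theorem lintegral_mul_rpow_le {ν : Measure α} {p : ℝ} (hp : 1 < p) {K g : α → ℝ≥0∞}
    (hK : AEMeasurable K ν) (hg : AEMeasurable g ν) :
    (∫⁻ y, K y * g y ∂ν) ^ p ≤ (∫⁻ y, g y ∂ν) ^ (p - 1) * ∫⁻ y, K y ^ p * g y ∂ν := by
  have hp0 : 0 < p := by linarith
  have hpq := Real.HolderConjugate.conjExponent hp
  set q := Real.conjExponent p
  have h := ENNReal.lintegral_mul_le_Lp_mul_Lq ν hpq (f := fun y => K y * g y ^ (1 / p))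
    (g := fun y => g y ^ (1 / q)) (hK.mul (hg.pow_const _)) (hg.pow_const _)
  have e1 : ∀ y, K y * g y ^ (1 / p) * g y ^ (1 / q) = K y * g y := by
    intro y
    rw [mul_assoc, ← ENNReal.rpow_add_of_nonneg _ _ (by positivity)
      (one_div_nonneg.2 hpq.symm.nonneg)]
    have : 1 / p + 1 / q = 1 := by simpa using hpq.inv_add_inv_eq_one
    rw [this, ENNReal.rpow_one]
  have e2 : ∀ y, (K y * g y ^ (1 / p)) ^ p = K y ^ p * g y := by
    intro y
    rw [ENNReal.mul_rpow_of_nonneg _ _ hp0.le, ← ENNReal.rpow_mul, one_div_mul_cancel hp0.ne',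
      ENNReal.rpow_one]
  have e3 : ∀ y, (g y ^ (1 / q)) ^ q = g y := by
    intro y
    rw [← ENNReal.rpow_mul, one_div_mul_cancel hpq.symm.pos.ne', ENNReal.rpow_one]
  simp only [Pi.mul_apply, e1, e2, e3] at h
  calc (∫⁻ y, K y * g y ∂ν) ^ p
      ≤ ((∫⁻ y, K y ^ p * g y ∂ν) ^ (1 / p) * (∫⁻ y, g y ∂ν) ^ (1 / q)) ^ p :=
        ENNReal.rpow_le_rpow h hp0.le
    _ = _ := by
        rw [ENNReal.mul_rpow_of_nonneg _ _ hp0.le, ← ENNReal.rpow_mul, ← ENNReal.rpow_mul,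
          one_div_mul_cancel hp0.ne', ENNReal.rpow_one, mul_comm]
        congr 2
        have := hpq.div_conj_eq_sub_one
        rw [one_div, inv_mul_eq_div, this]

/-- A Schur-type bound: if `∫ K(x,y)^p dμ(x) ≤ M` for almost every `y` where `g ≠ 0`, then
`∫ (∫ K(x,y) g(y) dy)^p dμ(x) ≤ (∫ g)^p M`. -/
theorem lintegral_lintegral_mul_rpow_le {β : Type*} [MeasurableSpace β] {μ : Measure α}
    {ν : Measure β} [SFinite μ] [SFinite ν] {p : ℝ} (hp : 1 < p) {K : α → β → ℝ≥0∞}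
    {g : β → ℝ≥0∞} (hK : AEMeasurable (Function.uncurry K) (μ.prod ν)) (hg : AEMeasurable g ν)
    {M : ℝ≥0∞} (hM : ∀ᵐ y ∂ν, ∫⁻ x, K x y ^ p ∂μ ≤ M) :
    ∫⁻ x, (∫⁻ y, K x y * g y ∂ν) ^ p ∂μ ≤ (∫⁻ y, g y ∂ν) ^ p * M := by
  have hp0 : 0 < p := by linarith
  have hKx : ∀ᵐ x ∂μ, AEMeasurable (K x) ν := by
    filter_upwards [hK.aestronglyMeasurable.prodMk_left] with x hx using hx.aemeasurable
  have hprod : AEMeasurable (fun z : α × β => K z.1 z.2 ^ p * g z.2) (μ.prod ν) :=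
    (hK.pow_const p).mul hg.comp_snd
  have hKy : ∀ᵐ y ∂ν, AEMeasurable (fun x => K x y) μ := by
    filter_upwards [hK.prod_swap.aestronglyMeasurable.prodMk_left] with y hy using hy.aemeasurable
  calc ∫⁻ x, (∫⁻ y, K x y * g y ∂ν) ^ p ∂μ
      ≤ ∫⁻ x, (∫⁻ y, g y ∂ν) ^ (p - 1) * ∫⁻ y, K x y ^ p * g y ∂ν ∂μ := by
        apply lintegral_mono_ae
        filter_upwards [hKx] with x hx using lintegral_mul_rpow_le hp hx hg
    _ = (∫⁻ y, g y ∂ν) ^ (p - 1) * ∫⁻ x, ∫⁻ y, K x y ^ p * g y ∂ν ∂μ := by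
        rw [lintegral_const_mul'' _ hprod.lintegral_prod_right']
    _ = (∫⁻ y, g y ∂ν) ^ (p - 1) * ∫⁻ y, ∫⁻ x, K x y ^ p * g y ∂μ ∂ν := by
        rw [lintegral_lintegral_swap (f := fun x y => K x y ^ p * g y) hprod]
    _ ≤ (∫⁻ y, g y ∂ν) ^ (p - 1) * ∫⁻ y, M * g y ∂ν := by
        refine mul_le_mul_right (lintegral_mono_ae ?_) _
        filter_upwards [hM, hKy] with y hy hy'
        rw [lintegral_mul_const'' _ (hy'.pow_const p)]
        gcongr
    _ = (∫⁻ y, g y ∂ν) ^ p * M := by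
        rw [lintegral_const_mul'' _ hg]
        have : (∫⁻ y, g y ∂ν) ^ p = (∫⁻ y, g y ∂ν) ^ (p - 1) * ∫⁻ y, g y ∂ν := by
          conv_lhs => rw [show p = (p - 1) + 1 by ring]
          rw [ENNReal.rpow_add_of_nonneg _ _ (by linarith) zero_le_one, ENNReal.rpow_one]
        rw [this]
        ring

/-- Minkowski's inequality for countable sums. -/
theorem lintegral_tsum_rpow_le {μ : Measure α} {p : ℝ} (hp : 1 ≤ p) {f : ℕ → α → ℝ≥0∞}
    (hf : ∀ k, AEMeasurable (f k) μ) :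
    (∫⁻ x, (∑' k, f k x) ^ p ∂μ) ^ (1 / p) ≤ ∑' k, (∫⁻ x, f k x ^ p ∂μ) ^ (1 / p) := by
  have hp0 : 0 < p := by linarith
  have hfin : ∀ N : ℕ, (∫⁻ x, (∑ k ∈ Finset.range N, f k x) ^ p ∂μ) ^ (1 / p) ≤
      ∑ k ∈ Finset.range N, (∫⁻ x, f k x ^ p ∂μ) ^ (1 / p) := by
    intro N
    induction N with
    | zero => simp [hp0]
    | succ N ih =>
      simp only [Finset.sum_range_succ]
      refine (ENNReal.lintegral_Lp_add_le (f := fun x => ∑ k ∈ Finset.range N, f k x)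
        (g := f N) ?_ (hf N) hp).trans (by gcongr)
      exact Finset.aemeasurable_fun_sum _ fun k _ => hf k
  rw [one_div, ENNReal.rpow_inv_le_iff hp0]
  have hsup : ∀ x, (∑' k, f k x) ^ p = ⨆ N : ℕ, (∑ k ∈ Finset.range N, f k x) ^ p := by
    intro x
    rw [ENNReal.tsum_eq_iSup_nat]
    exact (ENNReal.monotone_rpow_of_nonneg hp0.le).map_iSup_of_continuousAt
      ENNReal.continuous_rpow_const.continuousAt (by simp [hp0])
  simp only [hsup]
  rw [lintegral_iSup']
  · refine iSup_le fun N => ?_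
    rw [← ENNReal.rpow_inv_le_iff hp0, ← one_div]
    exact (hfin N).trans (ENNReal.sum_le_tsum _)
  · exact fun N => (Finset.aemeasurable_fun_sum _ fun k _ => hf k).pow_const p
  · refine Filter.Eventually.of_forall fun x N M hNM => ?_
    dsimp only
    gcongr

/-- Hölder's inequality in the form `(∫ g)^q (∫ v)^{-(q-1)} ≤ ∫ g^q w` when `w v^{q-1} = 1`. -/
theorem lintegral_rpow_le_weight {ν : Measure α} {q : ℝ} (hq : 1 < q) {g w v : α → ℝ≥0∞}
    (hg : AEMeasurable g ν) (hv : AEMeasurable v ν)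
    (hwv : ∀ᵐ x ∂ν, w x * v x ^ (q - 1) = 1) :
    (∫⁻ x, g x ∂ν) ^ q ≤ (∫⁻ x, v x ∂ν) ^ (q - 1) * ∫⁻ x, g x ^ q * w x ∂ν := by
  have hq0 : 0 < q := by linarith
  have key : ∀ᵐ x ∂ν, v x ≠ 0 ∧ v x ≠ ∞ := by
    filter_upwards [hwv] with x hx
    constructor
    · intro h0
      rw [h0, ENNReal.zero_rpow_of_pos (by linarith), mul_zero] at hx
      exact zero_ne_one hx
    · intro h0
      rw [h0, ENNReal.top_rpow_of_pos (by linarith)] at hx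
      by_cases hw0 : w x = 0
      · simp [hw0] at hx
      · rw [ENNReal.mul_top hw0] at hx
        exact ENNReal.top_ne_one hx
  -- Write `g = (g / v) v` and apply Jensen to the measure `v dν`; the relation between `w` and `v`
  -- says that `v^(1-q) = w`.
  have h := lintegral_mul_rpow_le (ν := ν) hq (K := fun x => g x * (v x)⁻¹) (g := v)
    (hg.mul hv.inv) hv
  have e1 : ∫⁻ x, g x * (v x)⁻¹ * v x ∂ν = ∫⁻ x, g x ∂ν := by
    apply lintegral_congr_ae
    filter_upwards [key] with x hx
    rw [mul_assoc, ENNReal.inv_mul_cancel hx.1 hx.2, mul_one]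
  have e2 : ∫⁻ x, (g x * (v x)⁻¹) ^ q * v x ∂ν = ∫⁻ x, g x ^ q * w x ∂ν := by
    apply lintegral_congr_ae
    filter_upwards [key, hwv] with x hx hx'
    rw [ENNReal.mul_rpow_of_nonneg _ _ hq0.le, mul_assoc]
    congr 1
    have h1 : (v x)⁻¹ ^ q * v x = (v x ^ (q - 1))⁻¹ := by
      rw [ENNReal.inv_rpow, ← ENNReal.rpow_neg, ← ENNReal.rpow_neg]
      nth_rewrite 2 [← ENNReal.rpow_one (v x)]
      rw [← ENNReal.rpow_add _ _ hx.1 hx.2]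
      congr 1
      ring
    rw [h1]
    exact (ENNReal.eq_inv_of_mul_eq_one_left hx').symm
  rw [e1, e2] at h
  exact h

end Inequalities

/-! ### Volumes of Euclidean balls. -/

section Balls

variable {n : ℕ}

theorem volume_ball_mul_eq (x y : EuclideanSpace ℝ (Fin n)) {c r : ℝ} (hc : 0 < c) (hr : 0 < r) :
    volume (ball x (c * r)) = ENNReal.ofReal (c ^ n) * volume (ball y r) := by
  rw [Measure.addHaar_ball_of_pos volume x (mul_pos hc hr),
    Measure.addHaar_ball_of_pos volume y hr, finrank_euclideanSpace_fin, mul_pow,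
    ENNReal.ofReal_mul (by positivity), mul_assoc]

theorem volume_ball_ne_zero (x : EuclideanSpace ℝ (Fin n)) {r : ℝ} (hr : 0 < r) :
    volume (ball x r) ≠ 0 := (measure_ball_pos _ _ hr).ne'

theorem integrableOn_ball {𝕜 : Type*} [RCLike 𝕜] {b : EuclideanSpace ℝ (Fin n) → 𝕜}
    (hb : LocallyIntegrable b) (x : EuclideanSpace ℝ (Fin n)) (r : ℝ) :
    IntegrableOn b (ball x r) :=
  (hb.integrableOn_isCompact (isCompact_closedBall x r)).mono_set ball_subset_closedBall

end Balls

/-! ### Comparison of means of a BMO function over different balls. -/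

section BMO

variable {𝕜 : Type*} [RCLike 𝕜] {n : ℕ}

theorem lintegral_ball_sub_average_le (b : EuclideanSpace ℝ (Fin n) → 𝕜)
    (x : EuclideanSpace ℝ (Fin n)) {r : ℝ} (hr : 0 < r) :
    ∫⁻ y in ball x r, ‖b y - ⨍ z in ball x r, b z‖ₑ ≤ bmoSeminorm b * volume (ball x r) := by
  have h : ⨍⁻ y in ball x r, ‖b y - ⨍ z in ball x r, b z ∂volume‖ₑ ∂volume ≤ bmoSeminorm b :=
    le_iSup₂_of_le x r (le_iSup_of_le hr le_rfl)
  rw [setLAverage_eq] at h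
  exact (ENNReal.div_le_iff (volume_ball_ne_zero x hr) measure_ball_lt_top.ne).1 h

theorem enorm_sub_mul_measure_le {b : EuclideanSpace ℝ (Fin n) → 𝕜}
    {x : EuclideanSpace ℝ (Fin n)} {r : ℝ} (hr : 0 < r) (hb : IntegrableOn b (ball x r)) (c : 𝕜) :
    ‖(⨍ z in ball x r, b z) - c‖ₑ * volume (ball x r) ≤ ∫⁻ y in ball x r, ‖b y - c‖ₑ := by
  have hv0 := volume_ball_ne_zero x hr
  have hvt : volume (ball x r) ≠ ∞ := measure_ball_lt_top.ne
  have hreal : volume.real (ball x r) ≠ 0 := by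
    rw [measureReal_def, ENNReal.toReal_ne_zero]; exact ⟨hv0, hvt⟩
  have e : (⨍ z in ball x r, b z) - c =
      (volume.real (ball x r))⁻¹ • ∫ z in ball x r, (b z - c) := by
    have hfin : IsFiniteMeasure (volume.restrict (ball x r)) := ⟨by simpa using hvt.lt_top⟩
    rw [integral_sub hb (integrable_const _), smul_sub, setAverage_eq]
    simp only [integral_const, measureReal_restrict_apply MeasurableSet.univ, univ_inter]
    rw [smul_smul, inv_mul_cancel₀ hreal, one_smul]
  rw [e, enorm_smul]
  have h1 : ‖(volume.real (ball x r))⁻¹‖ₑ = (volume (ball x r))⁻¹ := by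
    rw [Real.enorm_eq_ofReal (by positivity), ENNReal.ofReal_inv_of_pos
      (lt_of_le_of_ne measureReal_nonneg hreal.symm), measureReal_def, ENNReal.ofReal_toReal hvt]
  rw [h1, mul_right_comm, ENNReal.inv_mul_cancel hv0 hvt, one_mul]
  exact enorm_integral_le_lintegral_enorm _

theorem enorm_average_sub_average_le {b : EuclideanSpace ℝ (Fin n) → 𝕜} (hb : LocallyIntegrable b)
    {x x' : EuclideanSpace ℝ (Fin n)} {r c : ℝ} (hr : 0 < r) (hc : 0 < c)
    (hsub : ball x r ⊆ ball x' (c * r)) :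
    ‖(⨍ z in ball x r, b z) - ⨍ z in ball x' (c * r), b z‖ₑ ≤
      ENNReal.ofReal (c ^ n) * bmoSeminorm b := by
  have h := (enorm_sub_mul_measure_le hr (integrableOn_ball hb x r)
    (⨍ z in ball x' (c * r), b z)).trans ((lintegral_mono_set hsub).trans
      (lintegral_ball_sub_average_le b x' (mul_pos hc hr)))
  rw [volume_ball_mul_eq x' x hc hr, ← mul_assoc] at h
  rw [mul_comm (ENNReal.ofReal _)]
  exact (ENNReal.mul_le_mul_iff_left (volume_ball_ne_zero x hr) measure_ball_lt_top.ne).1 h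

/-- Telescoping over `k` doublings, each costing `2^n ‖b‖_*`. This linear growth in `k` is the
source of the logarithm. -/
theorem enorm_average_dyadic_sub_le {b : EuclideanSpace ℝ (Fin n) → 𝕜} (hb : LocallyIntegrable b)
    (x : EuclideanSpace ℝ (Fin n)) {r : ℝ} (hr : 0 < r) (k : ℕ) :
    ‖(⨍ z in ball x r, b z) - ⨍ z in ball x (2 ^ k * r), b z‖ₑ ≤
      k * (2 ^ n * bmoSeminorm b) := by
  induction k with
  | zero => simp
  | succ k ih =>
    have h := enorm_average_sub_average_le hb (x := x) (x' := x) (r := 2 ^ k * r) (c := 2)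
      (by positivity) two_pos (ball_subset_ball (by have : 0 < 2 ^ k * r := by positivity
                                                    linarith))
    rw [← mul_assoc, ← pow_succ'] at h
    have e : ENNReal.ofReal ((2 : ℝ) ^ n) = 2 ^ n := by
      rw [ENNReal.ofReal_pow zero_le_two]; simp
    rw [e] at h
    rw [← sub_add_sub_cancel _ (⨍ z in ball x (2 ^ k * r), b z)]
    refine (enorm_add_le _ _).trans ((add_le_add ih h).trans ?_)
    push_cast
    rw [add_mul, one_mul]

end BMO

/-! ### Half-open cubes and the dyadic grid of a cube. -/

section Cubes

variable {n : ℕ}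

/-- The half-open cube with corner `a` and side length `h`. -/
def halfOpenCube (a : EuclideanSpace ℝ (Fin n)) (h : ℝ) : Set (EuclideanSpace ℝ (Fin n)) :=
  {x | ∀ i, a i ≤ x i ∧ x i < a i + h}

/-- The center of `halfOpenCube a h`. -/
noncomputable def cubeCenter (a : EuclideanSpace ℝ (Fin n)) (h : ℝ) : EuclideanSpace ℝ (Fin n) :=
  WithLp.toLp 2 fun i => a i + h / 2

@[simp] theorem cubeCenter_apply (a : EuclideanSpace ℝ (Fin n)) (h : ℝ) (i : Fin n) :
    cubeCenter a h i = a i + h / 2 := rfl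

theorem abs_apply_le_norm (x : EuclideanSpace ℝ (Fin n)) (i : Fin n) : |x i| ≤ ‖x‖ := by
  simpa using PiLp.norm_apply_le x i

theorem measurableSet_halfOpenCube (a : EuclideanSpace ℝ (Fin n)) (h : ℝ) :
    MeasurableSet (halfOpenCube a h) := by
  have : halfOpenCube a h = ⋂ i, {x | a i ≤ x i ∧ x i < a i + h} := by
    ext x; simp [halfOpenCube]
  rw [this]
  refine MeasurableSet.iInter fun i => ?_
  have hi : Measurable fun x : EuclideanSpace ℝ (Fin n) => x i := by fun_prop
  exact (measurableSet_le measurable_const hi).inter (measurableSet_lt hi measurable_const)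

theorem ball_subset_halfOpenCube (a : EuclideanSpace ℝ (Fin n)) (h : ℝ) :
    ball (cubeCenter a h) (h / 2) ⊆ halfOpenCube a h := by
  intro x hx i
  have h1 : |x i - cubeCenter a h i| < h / 2 := by
    refine lt_of_le_of_lt ?_ (mem_ball_iff_norm.1 hx)
    simpa using abs_apply_le_norm (x - cubeCenter a h) i
  rw [cubeCenter_apply, abs_lt] at h1
  constructor <;> linarith [h1.1, h1.2]

theorem halfOpenCube_subset_ball (hn : 1 ≤ n) (a : EuclideanSpace ℝ (Fin n)) {h : ℝ} (hh : 0 < h) :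
    halfOpenCube a h ⊆ ball (cubeCenter a h) (n * h) := by
  intro x hx
  have hn' : (1 : ℝ) ≤ n := by exact_mod_cast hn
  rw [mem_ball_iff_norm, EuclideanSpace.norm_eq, Real.sqrt_lt' (by positivity)]
  have h1 : ∑ i, ‖(x - cubeCenter a h) i‖ ^ 2 ≤ ∑ _i : Fin n, (h / 2) ^ 2 := by
    refine Finset.sum_le_sum fun i _ => ?_
    rw [Real.norm_eq_abs, sq_abs, PiLp.sub_apply, cubeCenter_apply]
    have := hx i
    refine sq_le_sq' ?_ ?_ <;> linarith [this.1, this.2]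
  refine h1.trans_lt ?_
  rw [Finset.sum_const, Finset.card_univ, Fintype.card_fin, nsmul_eq_mul]
  have : (0 : ℝ) < h ^ 2 := by positivity
  nlinarith [mul_le_mul hn' hn' zero_le_one (by linarith : (0:ℝ) ≤ n)]

/-- The ball of radius `c h` is a translate of the `2c`-dilate of the inscribed ball, whose radius
is `h/2`. -/
theorem volume_ball_le_volume_cube (a y : EuclideanSpace ℝ (Fin n)) {h c : ℝ} (hh : 0 < h)
    (hc : 0 < c) :
    volume (ball y (c * h)) ≤ ENNReal.ofReal ((2 * c) ^ n) * volume (halfOpenCube a h) := by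
  have : c * h = (2 * c) * (h / 2) := by ring
  rw [this, volume_ball_mul_eq y (cubeCenter a h) (by positivity) (by positivity)]
  gcongr
  exact ball_subset_halfOpenCube a h

theorem volume_halfOpenCube_ne_zero (a : EuclideanSpace ℝ (Fin n)) {h : ℝ} (hh : 0 < h) :
    volume (halfOpenCube a h) ≠ 0 := fun h0 =>
  volume_ball_ne_zero (cubeCenter a h) (half_pos hh)
    (measure_mono_null (ball_subset_halfOpenCube a h) h0)

theorem volume_halfOpenCube_ne_top (hn : 1 ≤ n) (a : EuclideanSpace ℝ (Fin n)) {h : ℝ}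
    (hh : 0 < h) : volume (halfOpenCube a h) ≠ ∞ :=
  ((measure_mono (halfOpenCube_subset_ball hn a hh)).trans_lt measure_ball_lt_top).ne

/-- The corner of the dyadic subcube of generation `k` and index `m`. -/
noncomputable def dyadicCorner (a : EuclideanSpace ℝ (Fin n)) (h : ℝ) (k : ℕ) (m : Fin n → ℤ) :
    EuclideanSpace ℝ (Fin n) :=
  WithLp.toLp 2 fun i => a i + m i * (h / 2 ^ k)

/-- The dyadic subcube of generation `k` and index `m`, relative to `halfOpenCube a h`. -/
def dyadicCube (a : EuclideanSpace ℝ (Fin n)) (h : ℝ) (k : ℕ) (m : Fin n → ℤ) :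
    Set (EuclideanSpace ℝ (Fin n)) :=
  halfOpenCube (dyadicCorner a h k m) (h / 2 ^ k)

/-- The index of the dyadic cube of generation `k` that contains `x`. -/
noncomputable def dyadicIndex (a : EuclideanSpace ℝ (Fin n)) (h : ℝ) (k : ℕ)
    (x : EuclideanSpace ℝ (Fin n)) : Fin n → ℤ :=
  fun i => ⌊2 ^ k * ((x i - a i) / h)⌋

theorem mem_dyadicCube {a : EuclideanSpace ℝ (Fin n)} {h : ℝ} (hh : 0 < h) {k : ℕ} {m : Fin n → ℤ}
    {x : EuclideanSpace ℝ (Fin n)} : x ∈ dyadicCube a h k m ↔ dyadicIndex a h k x = m := by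
  have h2 : (0 : ℝ) < 2 ^ k := by positivity
  simp only [dyadicCube, halfOpenCube, dyadicCorner, mem_ofPred_eq, funext_iff, dyadicIndex,
    Int.floor_eq_iff]
  refine forall_congr' fun i => ?_
  have e1 : a i + m i * (h / 2 ^ k) ≤ x i ↔ (m i : ℝ) ≤ 2 ^ k * ((x i - a i) / h) := by
    have : 2 ^ k * ((x i - a i) / h) = (x i - a i) * 2 ^ k / h := by ring
    rw [this, le_div_iff₀ hh, mul_div_assoc', ← le_sub_iff_add_le', div_le_iff₀ h2]
  have e2 : x i < a i + m i * (h / 2 ^ k) + h / 2 ^ k ↔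
      2 ^ k * ((x i - a i) / h) < (m i : ℝ) + 1 := by
    have : a i + m i * (h / 2 ^ k) + h / 2 ^ k = a i + (m i + 1) * h / 2 ^ k := by ring
    have h' : 2 ^ k * ((x i - a i) / h) = (x i - a i) * 2 ^ k / h := by ring
    rw [this, h', div_lt_iff₀ hh, ← sub_lt_iff_lt_add', lt_div_iff₀ h2]
  exact and_congr e1 e2

/-- Integer division of the index by `2^l` gives the index `l` generations earlier. This is the
nestedness of the grid, phrased for indices so that no geometry of cubes is needed later. -/
theorem dyadicIndex_of_le {a : EuclideanSpace ℝ (Fin n)} {h : ℝ} {j k : ℕ} (hjk : j ≤ k)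
    {x y : EuclideanSpace ℝ (Fin n)} (hxy : dyadicIndex a h k x = dyadicIndex a h k y) :
    dyadicIndex a h j x = dyadicIndex a h j y := by
  obtain ⟨l, rfl⟩ := Nat.exists_eq_add_of_le hjk
  have key : ∀ (t : ℝ), ⌊2 ^ (j + l) * t⌋ / ((2 ^ l : ℕ) : ℤ) = ⌊2 ^ j * t⌋ := by
    intro t
    have : (2 : ℝ) ^ (j + l) * t = ((2 ^ l : ℕ) : ℝ) * (2 ^ j * t) := by
      push_cast
      rw [pow_add]; ring
    rw [this, Int.natCast_mul_floor_div_cancel (by positivity)]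
  funext i
  have := congrFun hxy i
  simp only [dyadicIndex] at this ⊢
  rw [← key, ← key, this]

theorem dyadicCube_zero (a : EuclideanSpace ℝ (Fin n)) (h : ℝ) :
    dyadicCube a h 0 0 = halfOpenCube a h := by
  simp only [dyadicCube, dyadicCorner, pow_zero, div_one]
  congr
  ext i
  simp

end Cubes

/-! ### Calderón–Zygmund stopping cubes. -/

section Stopping

variable {𝕜 : Type*} [RCLike 𝕜] {n : ℕ}

/-- Lebesgue differentiation along dyadic cubes, as an upper bound. -/
theorem ae_enorm_le_of_dyadic_average_le (hn : 1 ≤ n) {f : EuclideanSpace ℝ (Fin n) → 𝕜}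
    (hf : LocallyIntegrable f) (a : EuclideanSpace ℝ (Fin n)) {h : ℝ} (hh : 0 < h) (l : ℝ≥0∞) :
    ∀ᵐ x, (∀ k, ∫⁻ y in dyadicCube a h k (dyadicIndex a h k x), ‖f y‖ₑ ≤
      l * volume (dyadicCube a h k (dyadicIndex a h k x))) → ‖f x‖ₑ ≤ l := by
  have hn' : (0 : ℝ) < n := by exact_mod_cast hn
  filter_upwards [IsUnifLocDoublingMeasure.ae_tendsto_average_norm_sub (μ := volume) hf 1]
    with x hx hle
  have hlim : Filter.Tendsto (fun k : ℕ => 2 * n * (h / 2 ^ k)) Filter.atTop (nhdsWithin 0 (Ioi 0)) := by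
    rw [tendsto_nhdsWithin_iff]
    refine ⟨?_, Filter.Eventually.of_forall fun k => mem_Ioi.2 (by positivity)⟩
    have h1 : Filter.Tendsto (fun k : ℕ => 2 * n * h * (1 / 2 : ℝ) ^ k) Filter.atTop (nhds (2 * n * h * 0)) :=
      (tendsto_pow_atTop_nhds_zero_of_lt_one (by norm_num) (by norm_num)).const_mul _
    rw [mul_zero] at h1
    refine h1.congr fun k => ?_
    rw [one_div, inv_pow]
    ring
  have hT := hx (fun _ : ℕ => x) _ hlim (Filter.Eventually.of_forall fun k =>
    mem_closedBall_self (by positivity))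
  set T : ℕ → ℝ := fun k => ⨍ y in closedBall x (2 * n * (h / 2 ^ k)), ‖f y - f x‖
  have hbound : ∀ k, ‖f x‖ₑ ≤ ENNReal.ofReal (T k) * ENNReal.ofReal ((2 * (3 * n)) ^ n) + l := by
    intro k
    set Q := dyadicCube a h k (dyadicIndex a h k x) with hQ
    have hxQ : x ∈ Q := (mem_dyadicCube hh).2 rfl
    have hℓ : 0 < h / 2 ^ k := by positivity
    -- The cube lies within `n h / 2^k` of its center, so it lies within twice that distance of its
    -- own point `x`. The volume ratio is computed with the larger radius `3n h / 2^k` in order to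
    -- pass to an open ball.
    set B := closedBall x (2 * n * (h / 2 ^ k))
    have hQB : Q ⊆ B := by
      intro y hy
      have h1 := halfOpenCube_subset_ball hn _ hℓ hy
      have h2 := halfOpenCube_subset_ball hn _ hℓ hxQ
      rw [mem_ball] at h1 h2
      rw [mem_closedBall]
      have := dist_triangle_right y x (cubeCenter (dyadicCorner a h k (dyadicIndex a h k x))
        (h / 2 ^ k))
      linarith
    have hQ0 : volume Q ≠ 0 := volume_halfOpenCube_ne_zero _ hℓ
    have hQt : volume Q ≠ ∞ := volume_halfOpenCube_ne_top hn _ hℓ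
    have hint : IntegrableOn f B := hf.integrableOn_isCompact (isCompact_closedBall _ _)
    have hBt : volume B ≠ ∞ := measure_closedBall_lt_top.ne
    have hB0 : volume B ≠ 0 := (measure_closedBall_pos _ _ (by positivity)).ne'
    have hfinB : IsFiniteMeasure (volume.restrict B) := ⟨by simpa using hBt.lt_top⟩
    have hVB : volume B ≤ ENNReal.ofReal ((2 * (3 * n)) ^ n) * volume Q := by
      refine le_trans (measure_mono ?_) (volume_ball_le_volume_cube _ x hℓ (by positivity))
      exact closedBall_subset_ball (by nlinarith)
    have hTB : ∫⁻ y in B, ‖f y - f x‖ₑ = ENNReal.ofReal (T k) * volume B := by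
      have hI : Integrable (fun y => f y - f x) (volume.restrict B) := hint.sub (integrable_const _)
      have e1 : ∫⁻ y in B, ‖f y - f x‖ₑ = ENNReal.ofReal (∫ y in B, ‖f y - f x‖) :=
        (ofReal_integral_norm_eq_lintegral_enorm hI).symm
      have e2 : ∫ y in B, ‖f y - f x‖ = T k * volume.real B := by
        simp only [T]
        rw [setAverage_eq, smul_eq_mul]
        have : volume.real B ≠ 0 := (ENNReal.toReal_ne_zero.2 ⟨hB0, hBt⟩)
        change _ = (volume.real B)⁻¹ * (∫ y in B, ‖f y - f x‖) * volume.real B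
        rw [mul_right_comm, inv_mul_cancel₀ this, one_mul]
      rw [e1, e2, ENNReal.ofReal_mul' measureReal_nonneg, measureReal_def,
        ENNReal.ofReal_toReal hBt]
    have hmeas : AEMeasurable (fun y => ‖f y - f x‖ₑ) (volume.restrict Q) :=
      (hf.aestronglyMeasurable.restrict.sub aestronglyMeasurable_const).enorm
    have main : ‖f x‖ₑ * volume Q ≤
        (ENNReal.ofReal (T k) * ENNReal.ofReal ((2 * (3 * n)) ^ n) + l) * volume Q := by
      calc ‖f x‖ₑ * volume Q = ∫⁻ _ in Q, ‖f x‖ₑ := by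
            rw [setLIntegral_const]
        _ ≤ ∫⁻ y in Q, (‖f y - f x‖ₑ + ‖f y‖ₑ) := by
            refine lintegral_mono fun y => ?_
            have := enorm_sub_le (a := f y) (b := f y - f x)
            rwa [sub_sub_cancel, add_comm] at this
        _ = (∫⁻ y in Q, ‖f y - f x‖ₑ) + ∫⁻ y in Q, ‖f y‖ₑ := lintegral_add_left' hmeas _
        _ ≤ (∫⁻ y in B, ‖f y - f x‖ₑ) + l * volume Q := by
            gcongr
            exact hle k
        _ ≤ _ := by
            rw [hTB, add_mul, mul_assoc (ENNReal.ofReal (T k))]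
            gcongr
    exact (ENNReal.mul_le_mul_iff_left hQ0 hQt).1 main
  refine ge_of_tendsto' (x := Filter.atTop) ?_ hbound
  have h0 : Filter.Tendsto (fun k => ENNReal.ofReal (T k)) Filter.atTop (nhds 0) := by
    have := (ENNReal.continuous_ofReal.tendsto 0).comp hT
    simpa [Function.comp_def] using this
  have := (ENNReal.Tendsto.mul_const (b := ENNReal.ofReal ((2 * (3 * (n : ℝ))) ^ n)) h0
    (Or.inr ENNReal.ofReal_ne_top)).add_const l
  simpa using this

/-- The Calderón–Zygmund stopping cubes of `f` at height `l`. -/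
theorem exists_stopping_cubes (hn : 1 ≤ n) {f : EuclideanSpace ℝ (Fin n) → 𝕜}
    (hf : LocallyIntegrable f) (a : EuclideanSpace ℝ (Fin n)) {h : ℝ} (hh : 0 < h) {l : ℝ≥0∞}
    (hQ : ∫⁻ y in halfOpenCube a h, ‖f y‖ₑ ≤ l * volume (halfOpenCube a h)) :
    ∃ J : Set (ℕ × (Fin n → ℤ)),
      J.PairwiseDisjoint (fun j => dyadicCube a h j.1 j.2) ∧
      (∀ j ∈ J, dyadicCube a h j.1 j.2 ⊆ halfOpenCube a h) ∧
      (∀ j ∈ J, l * volume (dyadicCube a h j.1 j.2) ≤ ∫⁻ y in dyadicCube a h j.1 j.2, ‖f y‖ₑ) ∧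
      (∀ j ∈ J, ∫⁻ y in dyadicCube a h j.1 j.2, ‖f y‖ₑ ≤
        ENNReal.ofReal ((4 * n) ^ n) * l * volume (dyadicCube a h j.1 j.2)) ∧
      ∀ᵐ x, x ∈ halfOpenCube a h → (∀ j ∈ J, x ∉ dyadicCube a h j.1 j.2) → ‖f x‖ₑ ≤ l := by
  have hn' : (0 : ℝ) < n := by exact_mod_cast hn
  set D : ℕ → (Fin n → ℤ) → Set (EuclideanSpace ℝ (Fin n)) := dyadicCube a h with hD
  let bad : ℕ → (Fin n → ℤ) → Prop := fun k m => l * volume (D k m) < ∫⁻ y in D k m, ‖f y‖ₑ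
  have hzero : ∀ x, x ∈ halfOpenCube a h ↔ dyadicIndex a h 0 x = 0 := by
    intro x
    rw [← dyadicCube_zero, mem_dyadicCube hh]
  -- A cube is selected when it is bad and all its dyadic ancestors are good; the point `x` serves
  -- only to name the ancestors.
  refine ⟨{j | ∃ x ∈ halfOpenCube a h, dyadicIndex a h j.1 x = j.2 ∧ bad j.1 j.2 ∧
    ∀ i < j.1, ¬ bad i (dyadicIndex a h i x)}, ?_, ?_, ?_, ?_, ?_⟩
  · have key : ∀ (k k' : ℕ) (m m' : Fin n → ℤ) (x' z : EuclideanSpace ℝ (Fin n)),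
        dyadicIndex a h k z = m → dyadicIndex a h k' z = m' → dyadicIndex a h k' x' = m' →
        bad k m → (∀ i < k', ¬ bad i (dyadicIndex a h i x')) → k < k' → False := by
      intro k k' m m' x' z hz hz' hx' hb hnb hlt
      refine hnb k hlt ?_
      rwa [dyadicIndex_of_le hlt.le (hx'.trans hz'.symm), hz]
    rintro ⟨k, m⟩ ⟨x, -, hxm, hb, hnb⟩ ⟨k', m'⟩ ⟨x', -, hxm', hb', hnb'⟩ hne
    rw [Function.onFun, Set.disjoint_left]
    intro z hz hz'
    have hz1 := (mem_dyadicCube hh).1 hz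
    have hz2 := (mem_dyadicCube hh).1 hz'
    dsimp only at *
    rcases lt_trichotomy k k' with hlt | heq | hgt
    · exact key k k' m m' x' z hz1 hz2 hxm' hb hnb' hlt
    · subst heq
      exact hne (by rw [← hz1, ← hz2])
    · exact key k' k m' m x z hz2 hz1 hxm hb' hnb hgt
  · rintro ⟨k, m⟩ ⟨x, hx, hxm, -, -⟩ z hz
    rw [hzero] at hx ⊢
    rw [← hx]
    exact dyadicIndex_of_le (Nat.zero_le k) (((mem_dyadicCube hh).1 hz).trans hxm.symm)
  · rintro ⟨k, m⟩ ⟨x, hx, hxm, hb, -⟩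
    exact hb.le
  · rintro ⟨k, m⟩ ⟨x, hx, hxm, hb, hnb⟩
    dsimp only at *
    cases k with
    | zero =>
      -- The initial cube is good by `hQ`, so each selected cube has a parent, and the parent is
      -- good.
      exfalso
      rw [hzero, hxm] at hx
      simp only [bad, hx, hD, dyadicCube_zero] at hb
      exact absurd hQ hb.not_ge
    | succ k =>
      have hp : ∫⁻ y in D k (dyadicIndex a h k x), ‖f y‖ₑ ≤
          l * volume (D k (dyadicIndex a h k x)) := not_lt.1 (hnb k (Nat.lt_succ_self k))
      have hsub : D (k + 1) m ⊆ D k (dyadicIndex a h k x) := by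
        intro z hz
        rw [hD, mem_dyadicCube hh] at hz ⊢
        exact dyadicIndex_of_le (Nat.le_succ k) (hz.trans hxm.symm)
      have hvol : volume (D k (dyadicIndex a h k x)) ≤
          ENNReal.ofReal ((4 * n) ^ n) * volume (D (k + 1) m) := by
        refine (measure_mono (halfOpenCube_subset_ball hn _ (by positivity))).trans ?_
        have e : (n : ℝ) * (h / 2 ^ k) = (2 * n) * (h / 2 ^ (k + 1)) := by
          rw [pow_succ]; field_simp
        have e' : (4 * n : ℝ) = 2 * (2 * n) := by ring
        rw [e, e']
        exact volume_ball_le_volume_cube _ _ (by positivity) (by positivity)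
      calc ∫⁻ y in D (k + 1) m, ‖f y‖ₑ ≤ ∫⁻ y in D k (dyadicIndex a h k x), ‖f y‖ₑ :=
            lintegral_mono_set hsub
        _ ≤ l * (ENNReal.ofReal ((4 * n) ^ n) * volume (D (k + 1) m)) := hp.trans (by gcongr)
        _ = _ := by ring
  · filter_upwards [ae_enorm_le_of_dyadic_average_le hn hf a hh l] with x hx hxQ hxJ
    -- If some dyadic cube around `x` were bad, the first bad one would be selected. Hence all of
    -- them are good, and differentiation applies.
    refine hx fun k => ?_
    induction k using Nat.strong_induction_on with
    | _ k ih =>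
      by_contra hcon
      exact hxJ (k, dyadicIndex a h k x) ⟨x, hxQ, rfl, not_le.1 hcon, fun i hi => not_lt.2 (ih i hi)⟩
        ((mem_dyadicCube hh).2 rfl)

end Stopping

/-! ### Doubling and an `A_∞`-type property for measures with bounded averages. -/

section AveragingBound

variable {n : ℕ}

/-- The measures `μ ≪ dx` for which averages over balls are bounded from `L_q(μ)`:
`(|B|⁻¹ ∫_B g)^q μ(B) ≤ C ∫_B g^q dμ`. For `μ = w dx` this characterizes `w ∈ A_q`. -/
structure HasAveragingBound (q : ℝ) (C : ℝ≥0) (μ : Measure (EuclideanSpace ℝ (Fin n))) : Prop where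
  pos : 0 < q
  ac : μ ≪ volume
  ball_lt_top : ∀ (x : EuclideanSpace ℝ (Fin n)) (r : ℝ), 0 < r → μ (ball x r) < ∞
  bound : ∀ (x : EuclideanSpace ℝ (Fin n)) (r : ℝ), 0 < r → ∀ g : EuclideanSpace ℝ (Fin n) → ℝ≥0∞,
    AEMeasurable g (volume.restrict (ball x r)) →
    (∫⁻ y in ball x r, g y) ^ q * μ (ball x r) ≤
      C * volume (ball x r) ^ q * ∫⁻ y in ball x r, g y ^ q ∂μ

namespace HasAveragingBound

variable {q : ℝ} {C : ℝ≥0} {μ : Measure (EuclideanSpace ℝ (Fin n))}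

/-- The averaging bound tested on the indicator of `F`. -/
theorem measure_subset (hμ : HasAveragingBound q C μ) {x : EuclideanSpace ℝ (Fin n)} {r : ℝ}
    (hr : 0 < r) {F : Set (EuclideanSpace ℝ (Fin n))} (hF : MeasurableSet F) (hFB : F ⊆ ball x r) :
    volume F ^ q * μ (ball x r) ≤ C * volume (ball x r) ^ q * μ F := by
  have h := hμ.bound x r hr (F.indicator 1) ((measurable_one.indicator hF).aemeasurable)
  have e : ∀ y, F.indicator (1 : EuclideanSpace ℝ (Fin n) → ℝ≥0∞) y ^ q = F.indicator 1 y := by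
    intro y
    by_cases hy : y ∈ F <;> simp [hy, hμ.pos]
  simp only [e] at h
  rwa [lintegral_indicator_one hF, lintegral_indicator_one hF,
    Measure.restrict_apply hF, Measure.restrict_apply hF, inter_eq_left.2 hFB] at h

theorem measure_ball_le (hμ : HasAveragingBound q C μ) {x y : EuclideanSpace ℝ (Fin n)} {r c : ℝ}
    (hr : 0 < r) (hc : 0 < c) (h : ball y r ⊆ ball x (c * r)) :
    μ (ball x (c * r)) ≤ C * ENNReal.ofReal (c ^ n) ^ q * μ (ball y r) := by
  have h1 := hμ.measure_subset (mul_pos hc hr) measurableSet_ball h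
  have hv0 : volume (ball y r) ^ q ≠ 0 := by
    rw [Ne, ENNReal.rpow_eq_zero_iff_of_pos hμ.pos]
    exact volume_ball_ne_zero y hr
  have hvt : volume (ball y r) ^ q ≠ ∞ :=
    ENNReal.rpow_ne_top_of_nonneg hμ.pos.le measure_ball_lt_top.ne
  rw [volume_ball_mul_eq x y hc hr, ENNReal.mul_rpow_of_nonneg _ _ hμ.pos.le] at h1
  rw [← ENNReal.mul_le_mul_iff_right hv0 hvt]
  refine h1.trans (le_of_eq (by ring))

/-- The complement of `F` in the cube has at least half the volume. By `measure_subset` it then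
carries at least a fixed fraction `1/C'` of the mass, which leaves at most `1 - 1/C'` for `F`. This
is the only property of the weight that drives the decay in the John–Nirenberg iteration. -/
theorem exists_measure_le_mul_cube (hn : 1 ≤ n) (hμ : HasAveragingBound q C μ) :
    ∃ β : ℝ≥0, β < 1 ∧ ∀ (a : EuclideanSpace ℝ (Fin n)) (h : ℝ), 0 < h →
      ∀ F : Set (EuclideanSpace ℝ (Fin n)), MeasurableSet F → F ⊆ halfOpenCube a h →
      2 * volume F ≤ volume (halfOpenCube a h) → μ F ≤ β * μ (halfOpenCube a h) := by
  have hn' : (0 : ℝ) < n := by exact_mod_cast hn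
  set K : ℝ≥0 := Real.toNNReal ((2 * n) ^ n) with hK
  set C' : ℝ≥0 := max (C * (2 * K) ^ q) 1 with hC'
  have hC1 : 1 ≤ C' := le_max_right _ _
  refine ⟨1 - C'⁻¹, tsub_lt_self one_pos (by positivity), ?_⟩
  intro a h hh F hF hFQ hvol
  set Q := halfOpenCube a h
  have hQm : MeasurableSet Q := measurableSet_halfOpenCube a h
  set B := ball (cubeCenter a h) (n * h)
  have hQB : Q ⊆ B := halfOpenCube_subset_ball hn a hh
  have hQt : volume Q ≠ ∞ := volume_halfOpenCube_ne_top hn a hh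
  have hQ0 : volume Q ≠ 0 := volume_halfOpenCube_ne_zero a hh
  have hFt : volume F ≠ ∞ := ((measure_mono hFQ).trans_lt hQt.lt_top).ne
  have hμQ : μ Q ≠ ∞ := ((measure_mono hQB).trans_lt (hμ.ball_lt_top _ _ (by positivity))).ne
  have hsplit : volume F + volume (Q \ F) = volume Q := by
    have := measure_inter_add_sdiff (μ := volume) Q hF
    rwa [inter_eq_right.2 hFQ] at this
  have hμsplit : μ F + μ (Q \ F) = μ Q := by
    have := measure_inter_add_sdiff (μ := μ) Q hF
    rwa [inter_eq_right.2 hFQ] at this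
  have hle : volume F ≤ volume (Q \ F) := by
    rw [← hsplit, two_mul] at hvol
    exact (ENNReal.add_le_add_iff_left hFt).1 hvol
  have hQle : volume Q ≤ 2 * volume (Q \ F) := by
    rw [← hsplit, two_mul]; gcongr
  have hG0 : volume (Q \ F) ≠ 0 := fun h0 => hQ0 (by simpa [h0] using hQle)
  have hGt : volume (Q \ F) ≠ ∞ := ((measure_mono sdiff_subset).trans_lt hQt.lt_top).ne
  have hBle : volume B ≤ (2 * K : ℝ≥0) * volume (Q \ F) := by
    refine (volume_ball_le_volume_cube a _ hh hn').trans ?_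
    refine (mul_le_mul_right hQle _).trans (le_of_eq ?_)
    rw [hK, ENNReal.coe_mul, ← ENNReal.ofReal]
    push_cast
    ring
  have h1 := hμ.measure_subset (by positivity) (hQm.diff hF) (sdiff_subset.trans hQB)
  have h2 : volume (Q \ F) ^ q * μ B ≤ volume (Q \ F) ^ q * (C' * μ (Q \ F)) := by
    refine h1.trans ?_
    calc (C : ℝ≥0∞) * volume B ^ q * μ (Q \ F)
        ≤ C * ((2 * K : ℝ≥0) * volume (Q \ F)) ^ q * μ (Q \ F) := by
          gcongr
          exact hμ.pos.le
      _ = volume (Q \ F) ^ q * (((C * (2 * K) ^ q : ℝ≥0) : ℝ≥0∞) * μ (Q \ F)) := by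
          rw [ENNReal.mul_rpow_of_nonneg _ _ hμ.pos.le, ENNReal.coe_mul C,
            ENNReal.coe_rpow_of_nonneg _ hμ.pos.le]
          ring
      _ ≤ _ := by
          gcongr
          exact le_max_left _ _
  have h3 : μ Q ≤ C' * μ (Q \ F) := (measure_mono hQB).trans
    ((ENNReal.mul_le_mul_iff_right
      (by rw [Ne, ENNReal.rpow_eq_zero_iff_of_pos hμ.pos]; exact hG0)
      (ENNReal.rpow_ne_top_of_nonneg hμ.pos.le hGt)).1 h2)
  have hC0 : (C' : ℝ≥0∞) ≠ 0 := by exact_mod_cast (zero_lt_one.trans_le hC1).ne'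
  have h4 : (C' : ℝ≥0∞)⁻¹ * μ Q ≤ μ (Q \ F) := by
    rw [mul_comm, ← div_eq_mul_inv]
    exact ENNReal.div_le_of_le_mul' h3
  have h5 : μ F = μ Q - μ (Q \ F) := by
    rw [← hμsplit, ENNReal.add_sub_cancel_right]
    exact ((measure_mono sdiff_subset).trans_lt hμQ.lt_top).ne
  rw [h5, ENNReal.coe_sub, ENNReal.coe_inv (zero_lt_one.trans_le hC1).ne', ENNReal.sub_mul
    (fun _ _ => hμQ), ENNReal.coe_one, one_mul]
  gcongr

end HasAveragingBound

end AveragingBound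

/-! ### Exponential decay of superlevel sets on cubes, measured by a weight. -/

section JohnNirenberg

variable {𝕜 : Type*} [RCLike 𝕜] {n : ℕ} {q : ℝ} {C : ℝ≥0} {μ : Measure (EuclideanSpace ℝ (Fin n))}

/-- The average of `b` over the ball circumscribed about `halfOpenCube a h`. -/
noncomputable def cubeAverage (b : EuclideanSpace ℝ (Fin n) → 𝕜) (a : EuclideanSpace ℝ (Fin n))
    (h : ℝ) : 𝕜 := ⨍ z in ball (cubeCenter a h) (n * h), b z

/-- The seminorm is defined by balls, so oscillation on a cube is taken about the mean over the
circumscribed ball; the factor is a bound for the ratio of the two volumes. -/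
theorem lintegral_cube_sub_cubeAverage_le (hn : 1 ≤ n) (b : EuclideanSpace ℝ (Fin n) → 𝕜)
    {M : ℝ≥0∞} (hM : bmoSeminorm b ≤ M) (a : EuclideanSpace ℝ (Fin n)) {h : ℝ} (hh : 0 < h) :
    ∫⁻ y in halfOpenCube a h, ‖b y - cubeAverage b a h‖ₑ ≤
      ENNReal.ofReal ((2 * n) ^ n) * M * volume (halfOpenCube a h) := by
  have hn' : (0 : ℝ) < n := by exact_mod_cast hn
  calc _ ≤ ∫⁻ y in ball (cubeCenter a h) (n * h), ‖b y - cubeAverage b a h‖ₑ :=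
        lintegral_mono_set (halfOpenCube_subset_ball hn a hh)
    _ ≤ M * volume (ball (cubeCenter a h) (n * h)) :=
        (lintegral_ball_sub_average_le b _ (by positivity)).trans (by gcongr)
    _ ≤ M * (ENNReal.ofReal ((2 * n) ^ n) * volume (halfOpenCube a h)) := by
        gcongr
        exact volume_ball_le_volume_cube a _ hh hn'
    _ = _ := by ring

/-- The height by which the level grows in one step of the John–Nirenberg iteration. -/
noncomputable def johnNirenbergStep (n : ℕ) (M : ℝ≥0∞) : ℝ≥0∞ :=
  ENNReal.ofReal ((2 * n) ^ n) * M +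
    ENNReal.ofReal ((4 * n) ^ n) * (2 * (ENNReal.ofReal ((2 * n) ^ n) * M))

/-- Induction on `k`, for all cubes at once. Select stopping cubes for the deviation of `b`. Outside
them the deviation is a.e. at most one step. Inside a selected cube, replacing the mean by its own
costs one step, so the induction hypothesis applies there; the selected cubes together carry at most
the fraction `β` of the mass. -/
theorem measure_cube_superlevel_le (hn : 1 ≤ n) (hμ : HasAveragingBound q C μ) :
    ∃ β : ℝ≥0, β < 1 ∧ ∀ (b : EuclideanSpace ℝ (Fin n) → 𝕜) (M : ℝ≥0∞), LocallyIntegrable b →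
      bmoSeminorm b ≤ M → M ≠ 0 → M ≠ ∞ → ∀ (k : ℕ) (a : EuclideanSpace ℝ (Fin n)) (h : ℝ), 0 < h →
      μ {x ∈ halfOpenCube a h | k * johnNirenbergStep n M < ‖b x - cubeAverage b a h‖ₑ} ≤
        β ^ k * μ (halfOpenCube a h) := by
  obtain ⟨β, hβ, hsmall⟩ := hμ.exists_measure_le_mul_cube hn
  refine ⟨β, hβ, fun b M hb hM hM0 hMt k => ?_⟩
  have hn' : (0 : ℝ) < n := by exact_mod_cast hn
  have hn1 : (1 : ℝ) ≤ n := by exact_mod_cast hn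
  induction k with
  | zero =>
    intro a h hh
    rw [pow_zero, one_mul]
    exact measure_mono fun x hx => hx.1
  | succ k ih =>
    intro a h hh
    set K := ENNReal.ofReal ((2 * (n : ℝ)) ^ n) with hK
    set K₂ := ENNReal.ofReal ((4 * (n : ℝ)) ^ n) with hK₂
    have hK0 : K ≠ 0 := by rw [hK, Ne, ENNReal.ofReal_eq_zero, not_le]; positivity
    have hKt : K ≠ ∞ := ENNReal.ofReal_ne_top
    have hK₂1 : 1 ≤ K₂ := by
      rw [hK₂, ← ENNReal.ofReal_one]
      exact ENNReal.ofReal_le_ofReal (one_le_pow₀ (by linarith))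
    -- Twice the bound for the mean deviation over the cube: the selected cubes then fill at most
    -- half of the volume.
    set l := 2 * (K * M) with hl
    have hl0 : l ≠ 0 := by simp [hl, hK0, hM0]
    have hlt : l ≠ ∞ := ENNReal.mul_ne_top (by simp) (ENNReal.mul_ne_top hKt hMt)
    have hL : johnNirenbergStep n M = K * M + K₂ * l := rfl
    set L := johnNirenbergStep n M
    set Q := halfOpenCube a h
    set c := cubeAverage b a h
    have hf : LocallyIntegrable (fun x => b x - c) := hb.sub (locallyIntegrable_const c)
    have hint := lintegral_cube_sub_cubeAverage_le hn b hM a hh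
    have hKl : K * M ≤ l := by
      rw [hl, two_mul (K * M)]
      exact le_self_add
    obtain ⟨J, hJd, hJsub, hJlow, hJup, hJae⟩ := exists_stopping_cubes hn hf a hh (l := l)
      (hint.trans (mul_le_mul_left hKl _))
    set D : ℕ × (Fin n → ℤ) → Set (EuclideanSpace ℝ (Fin n)) := fun j => dyadicCube a h j.1 j.2
    have hDm : ∀ j, MeasurableSet (D j) := fun j => measurableSet_halfOpenCube _ _
    have hJc : J.Countable := J.to_countable
    have hUm : MeasurableSet (⋃ j ∈ J, D j) := MeasurableSet.biUnion hJc fun j _ => hDm j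
    have hUQ : (⋃ j ∈ J, D j) ⊆ Q := iUnion₂_subset hJsub
    have hUvol : 2 * volume (⋃ j ∈ J, D j) ≤ volume Q := by
      have h1 : l * volume (⋃ j ∈ J, D j) ≤ K * M * volume Q := by
        rw [measure_biUnion hJc hJd (fun j _ => hDm j), ← ENNReal.tsum_mul_left]
        calc ∑' j : J, l * volume (D j) ≤ ∑' j : J, ∫⁻ y in D j, ‖b y - c‖ₑ :=
              ENNReal.tsum_le_tsum fun j => hJlow j j.2
          _ = ∫⁻ y in ⋃ j ∈ J, D j, ‖b y - c‖ₑ :=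
              (lintegral_biUnion hJc (fun j _ => hDm j) hJd _).symm
          _ ≤ ∫⁻ y in Q, ‖b y - c‖ₑ := lintegral_mono_set hUQ
          _ ≤ _ := hint
      have hKM0 : K * M ≠ 0 := mul_ne_zero hK0 hM0
      rw [← ENNReal.mul_le_mul_iff_right hKM0 (ENNReal.mul_ne_top hKt hMt)]
      refine le_trans (le_of_eq ?_) h1
      rw [hl]; ring
    -- Compare both constants with `b` on the selected cube. The first deviation is an oscillation,
    -- at most `K M` on average; the second is bounded by the stopping rule, at most `K₂ l`. Their
    -- sum is the step `L`.
    have hc : ∀ j ∈ J, ‖cubeAverage b (dyadicCorner a h j.1 j.2) (h / 2 ^ j.1) - c‖ₑ ≤ L := by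
      intro j hj
      have hh' : 0 < h / 2 ^ j.1 := by positivity
      set c' := cubeAverage b (dyadicCorner a h j.1 j.2) (h / 2 ^ j.1)
      have hD0 : volume (D j) ≠ 0 := volume_halfOpenCube_ne_zero _ hh'
      have hDt : volume (D j) ≠ ∞ := volume_halfOpenCube_ne_top hn _ hh'
      have hmeas : AEMeasurable (fun y => ‖b y - c'‖ₑ) (volume.restrict (D j)) :=
        (hb.aestronglyMeasurable.restrict.sub aestronglyMeasurable_const).enorm
      rw [← ENNReal.mul_le_mul_iff_left hD0 hDt]
      calc ‖c' - c‖ₑ * volume (D j) = ∫⁻ _ in D j, ‖c' - c‖ₑ := by rw [setLIntegral_const]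
        _ ≤ ∫⁻ y in D j, (‖b y - c'‖ₑ + ‖b y - c‖ₑ) := by
            refine lintegral_mono fun y => ?_
            have := enorm_sub_le (a := b y - c) (b := b y - c')
            rwa [sub_sub_sub_cancel_left, add_comm] at this
        _ = (∫⁻ y in D j, ‖b y - c'‖ₑ) + ∫⁻ y in D j, ‖b y - c‖ₑ := lintegral_add_left' hmeas _
        _ ≤ K * M * volume (D j) + K₂ * l * volume (D j) :=
            add_le_add (lintegral_cube_sub_cubeAverage_le hn b hM _ hh') (hJup j hj)
        _ = L * volume (D j) := by rw [hL, add_mul]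
    set N : Set (EuclideanSpace ℝ (Fin n)) :=
      {x | ¬ (x ∈ Q → (∀ j ∈ J, x ∉ D j) → ‖b x - c‖ₑ ≤ l)} with hN
    have hN0 : μ N = 0 := hμ.ac (ae_iff.1 hJae)
    have hlL : l ≤ L := by
      rw [hL]
      exact (le_mul_of_one_le_left' hK₂1).trans le_add_self
    set S : ℕ × (Fin n → ℤ) → Set (EuclideanSpace ℝ (Fin n)) := fun j =>
      {x ∈ D j | k * L < ‖b x - cubeAverage b (dyadicCorner a h j.1 j.2) (h / 2 ^ j.1)‖ₑ} with hS
    have hsub : {x ∈ Q | (k + 1 : ℕ) * L < ‖b x - c‖ₑ} ⊆ N ∪ ⋃ j ∈ J, S j := by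
      rintro x ⟨hxQ, hx⟩
      by_cases hxJ : ∃ j ∈ J, x ∈ D j
      · obtain ⟨j, hj, hxj⟩ := hxJ
        refine Or.inr (mem_biUnion hj ⟨hxj, ?_⟩)
        by_contra hcon
        refine absurd hx (not_lt.2 ?_)
        rw [← sub_add_sub_cancel (b x) (cubeAverage b (dyadicCorner a h j.1 j.2) (h / 2 ^ j.1)) c]
        refine (enorm_add_le _ _).trans ((add_le_add (not_lt.1 hcon) (hc j hj)).trans ?_)
        push_cast
        rw [add_mul, one_mul]
      · push Not at hxJ
        refine Or.inl fun hcon => absurd hx (not_lt.2 ?_)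
        refine (hcon hxQ hxJ).trans (hlL.trans ?_)
        push_cast
        rw [add_mul, one_mul]
        exact le_add_self
    calc μ {x ∈ Q | (k + 1 : ℕ) * L < ‖b x - c‖ₑ} ≤ μ N + μ (⋃ j ∈ J, S j) :=
          (measure_mono hsub).trans (measure_union_le _ _)
      _ ≤ ∑' j : J, μ (S j) := by
          rw [hN0, zero_add]
          exact measure_biUnion_le μ hJc S
      _ ≤ ∑' j : J, β ^ k * μ (D j) :=
          ENNReal.tsum_le_tsum fun j => ih _ _ (by positivity)
      _ = β ^ k * μ (⋃ j ∈ J, D j) := by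
          rw [measure_biUnion hJc hJd (fun j _ => hDm j), ENNReal.tsum_mul_left]
      _ ≤ β ^ k * (β * μ Q) := by
          gcongr
          exact hsmall a h hh _ hUm hUQ hUvol
      _ = β ^ (k + 1) * μ Q := by rw [pow_succ, mul_assoc]

end JohnNirenberg

/-! ### From cubes to balls, and from level sets to weighted `L_σ` norms. -/

section JohnNirenbergBalls

variable {𝕜 : Type*} [RCLike 𝕜] {n : ℕ} {q : ℝ} {C : ℝ≥0} {μ : Measure (EuclideanSpace ℝ (Fin n))}

theorem tsum_rpow_mul_geometric_lt_top (σ : ℝ) {β : ℝ≥0} (hβ : β < 1) :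
    ∑' k : ℕ, ((k : ℝ≥0∞) + 2) ^ σ * (β : ℝ≥0∞) ^ k < ∞ := by
  set N := ⌈σ⌉₊
  have h1 : Summable fun k : ℕ => ((k : ℝ) + 2) ^ N * (β : ℝ) ^ k := by
    have h0 : Summable fun k : ℕ => ((k + 2 : ℕ) : ℝ) ^ N * (β : ℝ) ^ (k + 2) :=
      (summable_nat_add_iff (f := fun k : ℕ => (k : ℝ) ^ N * (β : ℝ) ^ k) 2).2
        (summable_pow_mul_geometric_of_norm_lt_one N (by simpa using hβ))
    by_cases hβ0 : β = 0
    · subst hβ0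
      refine summable_of_ne_finset_zero (s := {0}) fun k hk => ?_
      simp at hk
      simp [hk]
    · have hβ' : (β : ℝ) ≠ 0 := by exact_mod_cast hβ0
      refine (h0.mul_right ((β : ℝ) ^ 2)⁻¹).congr fun k => ?_
      push_cast
      rw [pow_add]
      field_simp
  have h2 : Summable fun k : ℕ => ((k : ℝ≥0) + 2) ^ N * β ^ k := by
    rw [← NNReal.summable_coe]
    exact_mod_cast h1
  refine lt_of_le_of_lt (ENNReal.tsum_le_tsum fun k => ?_)
    (ENNReal.tsum_coe_ne_top_iff_summable.2 h2).lt_top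
  push_cast
  gcongr
  rw [← ENNReal.rpow_natCast]
  refine ENNReal.rpow_le_rpow_of_exponent_le ?_ (Nat.le_ceil σ)
  exact one_le_two.trans le_add_self

/-- A discrete layer-cake bound: when `g > L`, the single term `m` with `(m+1) L < g ≤ (m+2) L`
already dominates. -/
theorem ENNReal.rpow_le_add_tsum_indicator {σ : ℝ} (hσ : 0 < σ) {L g : ℝ≥0∞} (hL0 : L ≠ 0)
    (hLt : L ≠ ∞) (hg : g ≠ ∞) :
    g ^ σ ≤ L ^ σ + ∑' k : ℕ, (((k : ℝ≥0∞) + 2) * L) ^ σ * if (k + 1) * L < g then 1 else 0 := by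
  by_cases hgL : g ≤ L
  · exact (ENNReal.rpow_le_rpow hgL hσ.le).trans le_self_add
  rw [not_le] at hgL
  have hex : ∃ m : ℕ, g ≤ (m + 2 : ℕ) * L := by
    obtain ⟨m, hm⟩ := ENNReal.exists_nat_gt (ENNReal.div_ne_top hg hL0)
    refine ⟨m, ?_⟩
    rw [ENNReal.div_lt_iff (Or.inl hL0) (Or.inl hLt)] at hm
    refine hm.le.trans ?_
    gcongr
    exact_mod_cast Nat.le_add_right m 2
  classical
  set m := Nat.find hex with hm
  have hm1 : g ≤ (m + 2 : ℕ) * L := Nat.find_spec hex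
  have hm2 : ((m : ℝ≥0∞) + 1) * L < g := by
    rcases Nat.eq_zero_or_pos m with h0 | hpos
    · rw [h0]; simpa using hgL
    · have := not_le.1 (Nat.find_min hex (Nat.sub_lt hpos one_pos))
      have e : m - 1 + 2 = m + 1 := by omega
      rw [← hm, e] at this
      exact_mod_cast this
  refine le_trans ?_ le_add_self
  refine le_trans ?_ (ENNReal.le_tsum m)
  rw [if_pos hm2, mul_one]
  refine ENNReal.rpow_le_rpow ?_ hσ.le
  exact_mod_cast hm1

/-- The weighted John–Nirenberg inequality in `L_σ(μ)`. -/
theorem exists_lintegral_rpow_sub_average_le (hn : 1 ≤ n) (hμ : HasAveragingBound q C μ) {σ : ℝ}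
    (hσ : 0 < σ) :
    ∃ C' : ℝ≥0, ∀ b : EuclideanSpace ℝ (Fin n) → 𝕜, IsBMO b →
      ∀ (x : EuclideanSpace ℝ (Fin n)) (r : ℝ), 0 < r →
      ∫⁻ y in ball x r, ‖b y - ⨍ z in ball x r, b z‖ₑ ^ σ ∂μ ≤
        (C' * bmoSeminorm b) ^ σ * μ (ball x r) := by
  obtain ⟨β, hβ, hlevel⟩ := measure_cube_superlevel_le (𝕜 := 𝕜) hn hμ
  have hn' : (0 : ℝ) < n := by exact_mod_cast hn
  have hn1 : (1 : ℝ) ≤ n := by exact_mod_cast hn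
  set S : ℝ≥0∞ := ∑' k : ℕ, ((k : ℝ≥0∞) + 2) ^ σ * (β : ℝ≥0∞) ^ k with hS
  have hSt : S < ∞ := tsum_rpow_mul_geometric_lt_top σ hβ
  set A : ℝ≥0∞ := C * ENNReal.ofReal ((2 * n) ^ n) ^ q with hA
  have hAt : A ≠ ∞ := ENNReal.mul_ne_top ENNReal.coe_ne_top
    (ENNReal.rpow_ne_top_of_nonneg hμ.pos.le ENNReal.ofReal_ne_top)
  set G : ℝ≥0∞ := johnNirenbergStep n 1 * (1 + S * A) ^ (1 / σ) with hG
  have hJt : johnNirenbergStep n 1 ≠ ∞ := by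
    simp only [johnNirenbergStep, mul_one]
    exact ENNReal.add_ne_top.2 ⟨ENNReal.ofReal_ne_top, ENNReal.mul_ne_top ENNReal.ofReal_ne_top
      (ENNReal.mul_ne_top (by simp) ENNReal.ofReal_ne_top)⟩
  have hGt : G ≠ ∞ := ENNReal.mul_ne_top hJt (ENNReal.rpow_ne_top_of_nonneg (by positivity)
      (ENNReal.add_ne_top.2 ⟨by simp, ENNReal.mul_ne_top hSt.ne hAt⟩))
  refine ⟨G.toNNReal, fun b hb x r hr => ?_⟩
  rw [ENNReal.coe_toNNReal hGt]
  set B := ball x r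
  set c := ⨍ z in B, b z
  have hbm : AEMeasurable (fun y => ‖b y - c‖ₑ) volume :=
    (hb.1.aestronglyMeasurable.sub aestronglyMeasurable_const).enorm
  have hbμ : AEMeasurable (fun y => ‖b y - c‖ₑ) (μ.restrict B) :=
    (hbm.mono_ac hμ.ac).restrict
  -- The level step is proportional to the seminorm, so the degenerate case, where `b` is a.e.
  -- constant on the ball, is treated separately.
  by_cases hM0 : bmoSeminorm b = 0
  · have h0 := lintegral_ball_sub_average_le b x hr
    rw [hM0, zero_mul, nonpos_iff_eq_zero, lintegral_eq_zero_iff' hbm.restrict] at h0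
    have h1 := (hμ.ac.restrict B).ae_le h0
    have : ∫⁻ y in B, ‖b y - c‖ₑ ^ σ ∂μ = 0 := by
      rw [lintegral_eq_zero_iff' (hbμ.pow_const σ)]
      filter_upwards [h1] with y hy
      have hy' : ‖b y - c‖ₑ = 0 := hy
      simp [hy', hσ]
    rw [this]
    exact zero_le
  set M := bmoSeminorm b
  have hMt : M ≠ ∞ := hb.2.ne
  set L := johnNirenbergStep n M with hL
  have hLM : L = johnNirenbergStep n 1 * M := by
    simp only [hL, johnNirenbergStep, mul_one]; ring
  have hLt : L ≠ ∞ := hLM ▸ ENNReal.mul_ne_top hJt hMt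
  have hKL : ENNReal.ofReal ((2 * n) ^ n) * M ≤ L := le_self_add
  have hL0 : L ≠ 0 := by
    refine ((pos_iff_ne_zero.2 (mul_ne_zero ?_ hM0)).trans_le hKL).ne'
    rw [Ne, ENNReal.ofReal_eq_zero, not_le]; positivity
  -- The corner of the cube of side `2r` whose inscribed ball is `B`.
  set a : EuclideanSpace ℝ (Fin n) := WithLp.toLp 2 fun i => x i - r with ha
  have hcenter : cubeCenter a (2 * r) = x := by
    ext i
    simp [ha]
  have hBQ : B ⊆ halfOpenCube a (2 * r) := by
    have := ball_subset_halfOpenCube a (2 * r)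
    rwa [hcenter, mul_div_cancel_left₀ r two_ne_zero] at this
  have hr2 : (n : ℝ) * (2 * r) = 2 * n * r := by ring
  have hBB : B ⊆ ball x (2 * n * r) := ball_subset_ball (by nlinarith)
  have hQμ : μ (halfOpenCube a (2 * r)) ≤ A * μ B := by
    refine (measure_mono (halfOpenCube_subset_ball hn a (by positivity))).trans ?_
    rw [hcenter, hr2]
    exact hμ.measure_ball_le hr (by positivity) hBB
  have hcc : ‖c - cubeAverage b a (2 * r)‖ₑ ≤ L := by
    refine le_trans ?_ hKL
    rw [cubeAverage, hcenter, hr2]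
    exact enorm_average_sub_average_le hb.1 hr (by positivity) hBB
  -- One of the `k + 1` levels pays for replacing the mean over `B` by that over the ball
  -- circumscribed about the cube; doubling returns from the cube to `B`.
  have htail : ∀ k : ℕ, μ {y ∈ B | ((k : ℝ≥0∞) + 1) * L < ‖b y - c‖ₑ} ≤ β ^ k * (A * μ B) := by
    intro k
    refine le_trans (measure_mono ?_) ((hlevel b M hb.1 le_rfl hM0 hMt k a (2 * r)
      (by positivity)).trans (by gcongr))
    rintro y ⟨hyB, hy⟩
    refine ⟨hBQ hyB, ?_⟩
    by_contra hcon
    refine absurd hy (not_lt.2 ?_)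
    rw [← sub_add_sub_cancel (b y) (cubeAverage b a (2 * r)) c]
    refine (enorm_add_le _ _).trans ?_
    rw [add_mul, one_mul, enorm_sub_rev _ c]
    exact add_le_add (not_lt.1 hcon) hcc
  have hnull : ∀ k : ℕ, NullMeasurableSet {y | ((k : ℝ≥0∞) + 1) * L < ‖b y - c‖ₑ} (μ.restrict B) :=
    fun k => nullMeasurableSet_lt aemeasurable_const hbμ
  have hind : ∀ k : ℕ, ∫⁻ y in B, (((k : ℝ≥0∞) + 2) * L) ^ σ *
      (if ((k : ℝ≥0∞) + 1) * L < ‖b y - c‖ₑ then 1 else 0) ∂μ =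
      (((k : ℝ≥0∞) + 2) * L) ^ σ * μ {y ∈ B | ((k : ℝ≥0∞) + 1) * L < ‖b y - c‖ₑ} := by
    intro k
    have e : ∀ y, (((k : ℝ≥0∞) + 2) * L) ^ σ * (if ((k : ℝ≥0∞) + 1) * L < ‖b y - c‖ₑ then 1 else 0)
        = {y | ((k : ℝ≥0∞) + 1) * L < ‖b y - c‖ₑ}.indicator
          (fun _ => (((k : ℝ≥0∞) + 2) * L) ^ σ) y := by
      intro y
      by_cases hy : ((k : ℝ≥0∞) + 1) * L < ‖b y - c‖ₑ <;> simp [hy]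
    simp only [e]
    rw [lintegral_indicator_const₀ (hnull k), Measure.restrict_apply₀ (hnull k), inter_comm]
    rfl
  calc ∫⁻ y in B, ‖b y - c‖ₑ ^ σ ∂μ
      ≤ ∫⁻ y in B, (L ^ σ + ∑' k : ℕ, (((k : ℝ≥0∞) + 2) * L) ^ σ *
          if ((k : ℝ≥0∞) + 1) * L < ‖b y - c‖ₑ then 1 else 0) ∂μ :=
        lintegral_mono fun y => ENNReal.rpow_le_add_tsum_indicator hσ hL0 hLt enorm_ne_top
    _ = L ^ σ * μ B + ∑' k : ℕ, (((k : ℝ≥0∞) + 2) * L) ^ σ *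
          μ {y ∈ B | ((k : ℝ≥0∞) + 1) * L < ‖b y - c‖ₑ} := by
        rw [lintegral_add_left measurable_const, setLIntegral_const, lintegral_tsum]
        · simp only [hind]
        · intro k
          refine AEMeasurable.const_mul ?_ _
          refine ((aemeasurable_const (b := (1 : ℝ≥0∞))).indicator₀ (hnull k)).congr ?_
          refine Filter.Eventually.of_forall fun y => ?_
          by_cases hy : ((k : ℝ≥0∞) + 1) * L < ‖b y - c‖ₑ <;> simp [hy]
    _ ≤ L ^ σ * μ B + ∑' k : ℕ, (((k : ℝ≥0∞) + 2) * L) ^ σ * (β ^ k * (A * μ B)) := by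
        gcongr with k
        exact htail k
    _ = L ^ σ * (1 + S * A) * μ B := by
        have : ∀ k : ℕ, (((k : ℝ≥0∞) + 2) * L) ^ σ * ((β : ℝ≥0∞) ^ k * (A * μ B)) =
            (((k : ℝ≥0∞) + 2) ^ σ * (β : ℝ≥0∞) ^ k) * (L ^ σ * (A * μ B)) := by
          intro k
          rw [ENNReal.mul_rpow_of_nonneg _ _ hσ.le]; ring
        simp only [this]
        rw [ENNReal.tsum_mul_right, ← hS]
        ring
    _ = (G * M) ^ σ * μ B := by
        rw [hG, hLM, mul_right_comm (johnNirenbergStep n 1), ENNReal.mul_rpow_of_nonneg _ ((1 + S * A) ^ (1 / σ)) hσ.le,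
          ← ENNReal.rpow_mul, one_div_mul_cancel hσ.ne', ENNReal.rpow_one]

end JohnNirenbergBalls

/-! ### Muckenhoupt weights, their averaging bounds and duality. -/

section Muckenhoupt

variable {n : ℕ}

theorem setLIntegral_withDensity_eq {W g : EuclideanSpace ℝ (Fin n) → ℝ≥0∞} (hW : AEMeasurable W)
    (x : EuclideanSpace ℝ (Fin n)) (r : ℝ) (hg : AEMeasurable g (volume.restrict (ball x r))) :
    ∫⁻ y in ball x r, g y ∂(volume.withDensity W) = ∫⁻ y in ball x r, g y * W y := by
  rw [restrict_withDensity measurableSet_ball,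
    lintegral_withDensity_eq_lintegral_mul₀ hW.restrict hg]
  simp only [Pi.mul_apply, mul_comm]

theorem withDensity_ball {W : EuclideanSpace ℝ (Fin n) → ℝ≥0∞}
    (x : EuclideanSpace ℝ (Fin n)) (r : ℝ) :
    volume.withDensity W (ball x r) = ∫⁻ y in ball x r, W y :=
  withDensity_apply _ measurableSet_ball

/-- `V` is the dual density. Hölder against it bounds `(∫ g)^q`, and the product condition on `W`
and `V` absorbs the factor `(∫ V)^(q-1)`. -/
theorem hasAveragingBound_withDensity {W V : EuclideanSpace ℝ (Fin n) → ℝ≥0∞}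
    (hW : AEMeasurable W) (hV : AEMeasurable V) {q : ℝ} (hq : 1 < q) {C : ℝ≥0}
    (hWV : ∀ᵐ x, W x * V x ^ (q - 1) = 1)
    (hfin : ∀ (x : EuclideanSpace ℝ (Fin n)) (r : ℝ), 0 < r → ∫⁻ y in ball x r, W y < ∞)
    (h : ∀ (x : EuclideanSpace ℝ (Fin n)) (r : ℝ), 0 < r →
      (∫⁻ y in ball x r, W y) * (∫⁻ y in ball x r, V y) ^ (q - 1) ≤ C * volume (ball x r) ^ q) :
    HasAveragingBound q C (volume.withDensity W) where
  pos := by linarith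
  ac := withDensity_absolutelyContinuous _ _
  ball_lt_top x r hr := by rw [withDensity_ball]; exact hfin x r hr
  bound x r hr g hg := by
    rw [withDensity_ball, setLIntegral_withDensity_eq hW x r (hg.pow_const q)]
    calc (∫⁻ y in ball x r, g y) ^ q * ∫⁻ y in ball x r, W y
        ≤ ((∫⁻ y in ball x r, V y) ^ (q - 1) * ∫⁻ y in ball x r, g y ^ q * W y) *
          ∫⁻ y in ball x r, W y := by
          gcongr
          exact lintegral_rpow_le_weight hq hg hV.restrict (ae_restrict_of_ae hWV)
      _ = ((∫⁻ y in ball x r, W y) * (∫⁻ y in ball x r, V y) ^ (q - 1)) *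
          ∫⁻ y in ball x r, g y ^ q * W y := by ring
      _ ≤ _ := mul_le_mul_left (h x r hr) _

variable {w : EuclideanSpace ℝ (Fin n) → ℝ}

theorem IsWeight.aemeasurable (hw : IsWeight w) : AEMeasurable w :=
  hw.1.aestronglyMeasurable.aemeasurable

theorem IsWeight.lintegral_ball_lt_top (hw : IsWeight w) (x : EuclideanSpace ℝ (Fin n)) (r : ℝ) :
    ∫⁻ y in ball x r, ENNReal.ofReal (w y) < ∞ :=
  (lintegral_ofReal_le_lintegral_enorm w).trans_lt
    (hw.1.integrableOn_isCompact (isCompact_closedBall x r) |>.mono_set ball_subset_closedBall).2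

theorem IsWeight.lintegral_ball_ne_zero (hw : IsWeight w) (x : EuclideanSpace ℝ (Fin n)) {r : ℝ}
    (hr : 0 < r) : ∫⁻ y in ball x r, ENNReal.ofReal (w y) ≠ 0 := by
  intro h0
  rw [lintegral_eq_zero_iff' hw.aemeasurable.ennreal_ofReal.restrict] at h0
  have h1 : ∀ᵐ y ∂(volume.restrict (ball x r)), False := by
    filter_upwards [h0, ae_restrict_of_ae hw.2] with y hy hy'
    exact absurd (ENNReal.ofReal_eq_zero.1 hy) (not_le.2 hy')
  rw [Filter.eventually_false_iff_eq_bot, ae_eq_bot, Measure.restrict_eq_zero] at h1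
  exact volume_ball_ne_zero x hr h1

theorem IsWeight.ofReal_mul_rpow_eq_one (hw : IsWeight w) {q : ℝ} (hq : 1 < q) :
    ∀ᵐ x, ENNReal.ofReal (w x) * ENNReal.ofReal (w x ^ (1 - q.conjExponent)) ^ (q - 1) = 1 := by
  filter_upwards [hw.2] with x hx
  have hq' : q - 1 ≠ 0 := by linarith
  rw [ENNReal.ofReal_rpow_of_nonneg (by positivity) (by linarith), ← ENNReal.ofReal_mul hx.le,
    ← Real.rpow_mul hx.le]
  have : (1 - q.conjExponent) * (q - 1) = -1 := by
    rw [Real.conjExponent]; field_simp; ring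
  rw [this, Real.rpow_neg_one, mul_inv_cancel₀ hx.ne', ENNReal.ofReal_one]

theorem IsMuckenhoupt.exists_mul_rpow_le {q : ℝ} (h : IsMuckenhoupt q w) (hq : 1 < q) :
    ∃ C : ℝ≥0, ∀ (x : EuclideanSpace ℝ (Fin n)) (r : ℝ), 0 < r →
      (∫⁻ y in ball x r, ENNReal.ofReal (w y)) *
        (∫⁻ y in ball x r, ENNReal.ofReal (w y ^ (1 - q.conjExponent))) ^ (q - 1) ≤
        C * volume (ball x r) ^ q := by
  obtain ⟨-, ⟨h1, -⟩ | ⟨-, C, hC⟩⟩ := h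
  · exact absurd h1 hq.ne'
  refine ⟨C, fun x r hr => ?_⟩
  have hv0 := volume_ball_ne_zero x hr
  have hvt : volume (ball x r) ≠ ∞ := measure_ball_lt_top.ne
  have h2 := hC x r hr
  rw [setLAverage_eq, setLAverage_eq, ENNReal.div_rpow_of_nonneg _ _ (by linarith)] at h2
  set v := volume (ball x r)
  have e : v ^ q = v * v ^ (q - 1) := by
    conv_rhs => enter [1]; rw [← ENNReal.rpow_one v]
    rw [← ENNReal.rpow_add _ _ hv0 hvt]; congr 1; ring
  have hq0 : v ^ (q - 1) ≠ 0 := by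
    rw [Ne, ENNReal.rpow_eq_zero_iff_of_pos (by linarith)]; exact hv0
  have hqt : v ^ (q - 1) ≠ ∞ := ENNReal.rpow_ne_top_of_nonneg (by linarith) hvt
  rw [e, ← ENNReal.div_le_iff (mul_ne_zero hv0 hq0) (ENNReal.mul_ne_top hvt hqt)]
  refine le_trans (le_of_eq ?_) h2
  simp only [div_eq_mul_inv]
  rw [ENNReal.mul_inv (Or.inl hv0) (Or.inl hvt)]
  ring

/-- Local integrability of the dual weight is not part of the definition. It follows because `∫ w`
over the ball is nonzero, so an infinite dual integral would make the bounded product infinite. -/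
theorem IsMuckenhoupt.lintegral_dual_lt_top {q : ℝ} (h : IsMuckenhoupt q w) (hq : 1 < q)
    (x : EuclideanSpace ℝ (Fin n)) {r : ℝ} (hr : 0 < r) :
    ∫⁻ y in ball x r, ENNReal.ofReal (w y ^ (1 - q.conjExponent)) < ∞ := by
  obtain ⟨C, hC⟩ := h.exists_mul_rpow_le hq
  have h1 := (hC x r hr).trans_lt (ENNReal.mul_lt_top ENNReal.coe_lt_top
    (ENNReal.rpow_lt_top_of_nonneg (by linarith) measure_ball_lt_top.ne))
  by_contra hcon
  rw [not_lt, top_le_iff] at hcon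
  rw [hcon, ENNReal.top_rpow_of_pos (by linarith), ENNReal.mul_top
    (h.1.lintegral_ball_ne_zero x hr)] at h1
  exact lt_irrefl _ h1

/-- Muckenhoupt weights have bounded averages. -/
theorem IsMuckenhoupt.exists_hasAveragingBound {q : ℝ} (h : IsMuckenhoupt q w) :
    ∃ C : ℝ≥0, HasAveragingBound q C (weightMeasure w) := by
  have hw := h.1
  have hW := hw.aemeasurable.ennreal_ofReal
  rcases h.2 with ⟨rfl, C, hC⟩ | ⟨hq, -⟩
  · refine ⟨C, one_pos, withDensity_absolutelyContinuous _ _, fun x r _ => ?_,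
      fun x r hr g hg => ?_⟩
    · rw [weightMeasure, withDensity_ball]
      exact hw.lintegral_ball_lt_top x r
    · simp only [ENNReal.rpow_one]
      rw [weightMeasure, setLIntegral_withDensity_eq hW x r hg, withDensity_ball]
      have hv0 := volume_ball_ne_zero x hr
      have hvt : volume (ball x r) ≠ ∞ := measure_ball_lt_top.ne
      have hWB := (hw.lintegral_ball_lt_top x r).ne
      set WB := ∫⁻ y in ball x r, ENNReal.ofReal (w y)
      rw [← lintegral_mul_const' _ _ hWB, ← lintegral_const_mul'' (f := fun y => g y * ENNReal.ofReal (w y)) _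
        (hg.mul hW.restrict)]
      apply lintegral_mono_ae
      filter_upwards [hC x r hr] with y hy
      rw [setLAverage_eq, ENNReal.div_le_iff hv0 hvt] at hy
      calc g y * WB ≤ g y * (C * ENNReal.ofReal (w y) * volume (ball x r)) := by gcongr
        _ = _ := by ring
  · obtain ⟨C, hC⟩ := h.exists_mul_rpow_le hq
    exact ⟨C, hasAveragingBound_withDensity hW (hw.aemeasurable.pow_const _).ennreal_ofReal hq
      (hw.ofReal_mul_rpow_eq_one hq) (fun x r _ => hw.lintegral_ball_lt_top x r) hC⟩

/-- Raise the `A_q` inequality to the power `q' - 1 = 1/(q-1)`. -/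
theorem IsMuckenhoupt.exists_mul_rpow_le_dual {q : ℝ} (h : IsMuckenhoupt q w) (hq : 1 < q) :
    ∃ C : ℝ≥0, ∀ (x : EuclideanSpace ℝ (Fin n)) (r : ℝ), 0 < r →
      (∫⁻ y in ball x r, ENNReal.ofReal (w y ^ (1 - q.conjExponent))) *
        (∫⁻ y in ball x r, ENNReal.ofReal (w y)) ^ (q.conjExponent - 1) ≤
        C * volume (ball x r) ^ q.conjExponent := by
  obtain ⟨C, hC⟩ := h.exists_mul_rpow_le hq
  have hq0 : q - 1 ≠ 0 := by linarith
  have hq1 : 0 < q - 1 := by linarith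
  have he : q.conjExponent - 1 = 1 / (q - 1) := by rw [Real.conjExponent]; field_simp; ring
  have he0 : 0 ≤ q.conjExponent - 1 := by rw [he]; positivity
  refine ⟨C ^ (q.conjExponent - 1), fun x r hr => ?_⟩
  have h1 := ENNReal.rpow_le_rpow (hC x r hr) he0
  rw [ENNReal.mul_rpow_of_nonneg _ _ he0, ENNReal.mul_rpow_of_nonneg _ _ he0, ← ENNReal.rpow_mul,
    ← ENNReal.rpow_mul, he, mul_one_div_cancel hq0, ENNReal.rpow_one, ← he, mul_comm] at h1
  rw [ENNReal.coe_rpow_of_nonneg _ he0]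
  refine h1.trans (le_of_eq ?_)
  have : q * (q.conjExponent - 1) = q.conjExponent := by rw [Real.conjExponent]; field_simp; ring
  rw [this]

theorem IsMuckenhoupt.exists_hasAveragingBound_dual {q : ℝ} (h : IsMuckenhoupt q w) (hq : 1 < q) :
    ∃ C : ℝ≥0, HasAveragingBound q.conjExponent C
      (weightMeasure fun x => w x ^ (1 - q.conjExponent)) := by
  obtain ⟨C, hC⟩ := h.exists_mul_rpow_le_dual hq
  have hq1 : 0 < q - 1 := by linarith
  have he : q.conjExponent - 1 = 1 / (q - 1) := by rw [Real.conjExponent]; field_simp; ring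
  have he0 : 0 < q.conjExponent - 1 := by rw [he]; positivity
  refine ⟨C, hasAveragingBound_withDensity (h.1.aemeasurable.pow_const _).ennreal_ofReal
    h.1.aemeasurable.ennreal_ofReal (by linarith) ?_
    (fun x r hr => h.lintegral_dual_lt_top hq x hr) hC⟩
  filter_upwards [h.1.2] with x hx
  rw [ENNReal.ofReal_rpow_of_nonneg hx.le he0.le, ← ENNReal.ofReal_mul (by positivity),
    ← Real.rpow_add hx]
  simp

/-- The dual weight of an `A_q` weight is an `A_{q'}` weight. -/
theorem IsMuckenhoupt.dual {q : ℝ} (h : IsMuckenhoupt q w) (hq : 1 < q) :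
    IsMuckenhoupt q.conjExponent (fun x => w x ^ (1 - q.conjExponent)) := by
  have hq1 : 0 < q - 1 := by linarith
  have he : q.conjExponent - 1 = 1 / (q - 1) := by rw [Real.conjExponent]; field_simp; ring
  have he0 : 0 < q.conjExponent - 1 := by rw [he]; positivity
  have hq' : 1 < q.conjExponent := by linarith
  have hconj : q.conjExponent.conjExponent = q := by
    rw [Real.conjExponent, he, Real.conjExponent]; field_simp
  have hmeas : AEStronglyMeasurable (fun x => w x ^ (1 - q.conjExponent)) :=
    (h.1.aemeasurable.pow_const _).aestronglyMeasurable
  refine ⟨⟨?_, ?_⟩, Or.inr ⟨hq', ?_⟩⟩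
  · intro x
    refine ⟨ball x 1, ball_mem_nhds x one_pos, hmeas.restrict, ?_⟩
    have h1 := h.lintegral_dual_lt_top hq x one_pos
    rw [hasFiniteIntegral_iff_enorm]
    refine lt_of_le_of_lt (lintegral_mono_ae ?_) h1
    filter_upwards [ae_restrict_of_ae h.1.2] with y hy
    rw [Real.enorm_eq_ofReal (by positivity)]
  · filter_upwards [h.1.2] with x hx
    positivity
  · obtain ⟨C, hC⟩ := h.exists_mul_rpow_le_dual hq
    refine ⟨C, fun x r hr => ?_⟩
    have hv0 := volume_ball_ne_zero x hr
    have hvt : volume (ball x r) ≠ ∞ := measure_ball_lt_top.ne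
    have e1 : ∫⁻ y in ball x r, ENNReal.ofReal
        ((w y ^ (1 - q.conjExponent)) ^ (1 - q.conjExponent.conjExponent)) =
        ∫⁻ y in ball x r, ENNReal.ofReal (w y) := by
      apply lintegral_congr_ae
      filter_upwards [ae_restrict_of_ae h.1.2] with y hy
      rw [← Real.rpow_mul hy.le, hconj]
      have : (1 - q.conjExponent) * (1 - q) = 1 := by
        rw [Real.conjExponent]; field_simp; ring
      rw [this, Real.rpow_one]
    rw [setLAverage_eq, setLAverage_eq, e1, ENNReal.div_rpow_of_nonneg _ _ he0.le]
    have h2 := hC x r hr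
    set v := volume (ball x r)
    have e : v ^ q.conjExponent = v * v ^ (q.conjExponent - 1) := by
      conv_rhs => enter [1]; rw [← ENNReal.rpow_one v]
      rw [← ENNReal.rpow_add _ _ hv0 hvt]; congr 1; ring
    have hq0 : v ^ (q.conjExponent - 1) ≠ 0 := by
      rw [Ne, ENNReal.rpow_eq_zero_iff_of_pos (by linarith)]; exact hv0
    have hqt : v ^ (q.conjExponent - 1) ≠ ∞ := ENNReal.rpow_ne_top_of_nonneg (by linarith) hvt
    rw [e, ← ENNReal.div_le_iff (mul_ne_zero hv0 hq0) (ENNReal.mul_ne_top hvt hqt)] at h2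
    refine le_trans (le_of_eq ?_) h2
    simp only [div_eq_mul_inv]
    rw [ENNReal.mul_inv (Or.inl hv0) (Or.inl hvt)]
    ring

end Muckenhoupt

/-! ### Integrability, scaling and measurability of the homogeneous kernel. -/

section RoughKernel

variable {𝕜 : Type*} [RCLike 𝕜] {n : ℕ} {s : ℝ≥0∞} {Ω : EuclideanSpace ℝ (Fin n) → 𝕜}

/-- In polar coordinates `Ω` depends on the spherical variable alone, and the radial measure of `(0,
1)` is finite. The origin, where polar coordinates fail, is a null set. -/
theorem IsRoughKernel.memLp_unit_ball (hΩ : IsRoughKernel s Ω) (hn : 1 ≤ n) :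
    MemLp Ω s (volume.restrict (ball 0 1)) := by
  have : Nonempty (Fin n) := ⟨⟨0, hn⟩⟩
  set ν := Measure.volumeIoiPow (Module.finrank ℝ (EuclideanSpace ℝ (Fin n)) - 1)
  set I : Set (Ioi (0 : ℝ)) := Iio ⟨1, mem_Ioi.2 one_pos⟩
  have hfin : IsFiniteMeasure (ν.restrict I) := ⟨by
    rw [Measure.restrict_apply_univ, Measure.volumeIoiPow_apply_Iio]
    exact ENNReal.ofReal_lt_top⟩
  have h1 : MemLp (fun z : sphere (0 : EuclideanSpace ℝ (Fin n)) 1 × Ioi (0 : ℝ) => Ω z.1) s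
      (((volume : Measure (EuclideanSpace ℝ (Fin n))).toSphere.prod ν).restrict (univ ×ˢ I)) := by
    rw [← Measure.prod_restrict, Measure.restrict_univ]
    exact hΩ.2.comp_fst (ν.restrict I)
  have hmp := ((volume : Measure (EuclideanSpace ℝ (Fin n))).measurePreserving_homeomorphUnitSphereProd).restrict_preimage
    (MeasurableSet.univ.prod (measurableSet_Iio (a := (⟨1, mem_Ioi.2 one_pos⟩ : Ioi (0 : ℝ)))))
  have h2 := h1.comp_measurePreserving hmp
  have hcoe : MeasurableEmbedding (Subtype.val : ({0}ᶜ : Set (EuclideanSpace ℝ (Fin n))) → EuclideanSpace ℝ (Fin n)) :=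
    MeasurableEmbedding.subtype_coe (measurableSet_singleton _).compl
  have e1 : (fun z : sphere (0 : EuclideanSpace ℝ (Fin n)) 1 × Ioi (0 : ℝ) => Ω z.1) ∘ homeomorphUnitSphereProd (EuclideanSpace ℝ (Fin n)) =
      Ω ∘ Subtype.val := by
    funext x
    have hx : (0 : ℝ) < ‖(x : EuclideanSpace ℝ (Fin n))‖⁻¹ := inv_pos.2 (norm_pos_iff.2 x.2)
    simp only [Function.comp_apply, homeomorphUnitSphereProd_apply_fst_coe]
    exact hΩ.1 _ _ hx
  have e2 : homeomorphUnitSphereProd (EuclideanSpace ℝ (Fin n)) ⁻¹' (univ ×ˢ I) = Subtype.val ⁻¹' (ball (0 : EuclideanSpace ℝ (Fin n)) 1) := by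
    ext x
    simp only [I, mem_preimage, mem_prod, mem_univ, true_and, mem_Iio, mem_ball_zero_iff]
    rw [← Subtype.coe_lt_coe, homeomorphUnitSphereProd_apply_snd_coe]
  rw [e1] at h2
  simp only [I] at e2
  rw [e2, ← hcoe.memLp_map_measure_iff, ← hcoe.restrict_map, hcoe.map_comap, Subtype.range_coe,
    Measure.restrict_restrict measurableSet_ball] at h2
  change MemLp Ω s (volume.restrict (ball 0 1 \ {0})) at h2
  rwa [Measure.restrict_congr_set (sdiff_null_ae_eq_self (measure_singleton _))] at h2

/-- Dilation by `ρ⁻¹` fixes `Ω` and multiplies volume by `ρ^n` under push-forward. The exponent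
vanishes for `s = ∞`, as it should. -/
theorem IsRoughKernel.eLpNorm_ball (hΩ : IsRoughKernel s Ω) {ρ : ℝ} (hρ : 0 < ρ) :
    eLpNorm Ω s (volume.restrict (ball 0 ρ)) =
      ENNReal.ofReal ρ ^ (n * s⁻¹.toReal) * eLpNorm Ω s (volume.restrict (ball 0 1)) := by
  have hemb : MeasurableEmbedding (fun x : EuclideanSpace ℝ (Fin n) => ρ⁻¹ • x) :=
    (Homeomorph.smulOfNeZero _ (inv_ne_zero hρ.ne')).measurableEmbedding
  have e0 : Ω ∘ (fun x => ρ⁻¹ • x) = Ω := by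
    funext x; exact hΩ.1 _ _ (inv_pos.2 hρ)
  have e1 : Measure.map (fun x : EuclideanSpace ℝ (Fin n) => ρ⁻¹ • x)
      (volume.restrict (ball 0 ρ)) = ENNReal.ofReal (ρ ^ n) • volume.restrict (ball 0 1) := by
    have hpre : (fun x : EuclideanSpace ℝ (Fin n) => ρ⁻¹ • x) ⁻¹' (ball 0 1) = ball 0 ρ := by
      ext x
      simp only [mem_preimage, mem_ball_zero_iff, norm_smul, norm_inv, Real.norm_eq_abs,
        abs_of_pos hρ]
      rw [inv_mul_lt_iff₀ hρ, mul_one]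
    rw [← hpre, ← hemb.restrict_map, Measure.map_addHaar_smul _ (inv_ne_zero hρ.ne'),
      Measure.restrict_smul, finrank_euclideanSpace_fin, inv_pow, inv_inv,
      abs_of_nonneg (by positivity)]
  have hc : ENNReal.ofReal (ρ ^ n) ≠ 0 := by
    rw [Ne, ENNReal.ofReal_eq_zero, not_le]; positivity
  calc eLpNorm Ω s (volume.restrict (ball 0 ρ))
      = eLpNorm (Ω ∘ (fun x => ρ⁻¹ • x)) s (volume.restrict (ball 0 ρ)) := by rw [e0]
    _ = eLpNorm Ω s (ENNReal.ofReal (ρ ^ n) • volume.restrict (ball 0 1)) := by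
        rw [← hemb.eLpNorm_map_measure, e1]
    _ = _ := by
        rw [eLpNorm_smul_measure_of_ne_zero hc, smul_eq_mul]
        congr 1
        rw [ENNReal.ofReal_pow hρ.le, ← ENNReal.rpow_natCast, ← ENNReal.rpow_mul, one_div]

/-- Only measurability on the sphere is given. It holds on the unit ball by polar coordinates, and
homogeneity carries it to all balls of integer radius. -/
theorem IsRoughKernel.aestronglyMeasurable (hΩ : IsRoughKernel s Ω) (hn : 1 ≤ n) :
    AEStronglyMeasurable Ω volume := by
  have h : ∀ k : ℕ, AEStronglyMeasurable Ω (volume.restrict (ball 0 ((k : ℝ) + 1))) := by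
    intro k
    have hk : (0 : ℝ) < k + 1 := by positivity
    have hqmp : Measure.QuasiMeasurePreserving (fun x : EuclideanSpace ℝ (Fin n) =>
        ((k : ℝ) + 1)⁻¹ • x) (volume.restrict (ball 0 ((k : ℝ) + 1)))
        (volume.restrict (ball 0 1)) := by
      have hne : ((k : ℝ) + 1)⁻¹ ≠ 0 := inv_ne_zero hk.ne'
      have h0 : Measure.QuasiMeasurePreserving (fun x : EuclideanSpace ℝ (Fin n) =>
          ((k : ℝ) + 1)⁻¹ • x) volume volume := by
        refine ⟨by fun_prop, ?_⟩
        rw [Measure.map_addHaar_smul _ hne]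
        exact Measure.smul_absolutelyContinuous
      refine h0.restrict fun x hx => ?_
      rw [mem_ball_zero_iff] at hx ⊢
      rw [norm_smul, norm_inv, Real.norm_eq_abs, abs_of_pos hk, inv_mul_lt_iff₀ hk, mul_one]
      exact hx
    have := (hΩ.memLp_unit_ball hn).1.comp_quasiMeasurePreserving hqmp
    refine this.congr (Filter.Eventually.of_forall fun x => ?_)
    exact hΩ.1 _ _ (inv_pos.2 hk)
  have hU : (⋃ k : ℕ, ball (0 : EuclideanSpace ℝ (Fin n)) ((k : ℝ) + 1)) = univ := by
    rw [eq_univ_iff_forall]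
    intro x
    obtain ⟨k, hk⟩ := exists_nat_gt ‖x‖
    exact mem_iUnion.2 ⟨k, by rw [mem_ball_zero_iff]; linarith⟩
  have := (aestronglyMeasurable_iUnion_iff (μ := volume) (f := Ω)
    (s := fun k : ℕ => ball (0 : EuclideanSpace ℝ (Fin n)) ((k : ℝ) + 1))).2 h
  rwa [hU, Measure.restrict_univ] at this

end RoughKernel

/-! ### Exponent arithmetic through `θ = 1/s`, a real number that is `0` when `s = ∞`. -/

section Exponents

theorem ENNReal.toReal_inv_lt_one {s : ℝ≥0∞} (hs : 1 < s) : s⁻¹.toReal < 1 := by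
  have h : s⁻¹ < 1 := ENNReal.inv_lt_one.2 hs
  simpa using (ENNReal.toReal_lt_toReal h.ne_top ENNReal.one_ne_top).2 h

theorem ENNReal.conjExponent_eq_ofReal {s : ℝ≥0∞} (hs : 1 < s) :
    ENNReal.conjExponent s = ENNReal.ofReal (1 / (1 - s⁻¹.toReal)) := by
  have hlt := ENNReal.toReal_inv_lt_one hs
  have h := (ENNReal.HolderConjugate.conjExponent hs.le).inv_add_inv_eq_one
  have hsi : s⁻¹ ≠ ∞ := (ENNReal.inv_lt_one.2 hs).ne_top
  rw [one_div, ENNReal.ofReal_inv_of_pos (by linarith), ENNReal.ofReal_sub _ ENNReal.toReal_nonneg,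
    ENNReal.ofReal_one, ENNReal.ofReal_toReal hsi, ← h, ENNReal.add_sub_cancel_left hsi, inv_inv]

theorem ENNReal.conjExponent_toReal_eq {s : ℝ≥0∞} (hs : 1 < s) :
    (ENNReal.conjExponent s).toReal = 1 / (1 - s⁻¹.toReal) := by
  have hlt := ENNReal.toReal_inv_lt_one hs
  rw [ENNReal.conjExponent_eq_ofReal hs, ENNReal.toReal_ofReal]
  exact div_nonneg zero_le_one (by linarith)

theorem ENNReal.inv_div_ofReal_toReal {s : ℝ≥0∞} {p : ℝ} (hp : 0 < p) :
    (s / ENNReal.ofReal p)⁻¹.toReal = p * s⁻¹.toReal := by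
  rw [ENNReal.inv_div (Or.inl ENNReal.ofReal_ne_top) (Or.inl (by simpa using hp)), div_eq_mul_inv,
    ENNReal.toReal_mul, ENNReal.toReal_ofReal hp.le]

theorem ENNReal.one_lt_div_ofReal {s : ℝ≥0∞} {p : ℝ} (hp : 0 < p) (h : ENNReal.ofReal p < s) :
    1 < s / ENNReal.ofReal p := by
  rw [ENNReal.lt_div_iff_mul_lt (Or.inl (by simpa using hp)) (Or.inl ENNReal.ofReal_ne_top),
    one_mul]
  exact h

theorem ENNReal.mul_toReal_inv_lt_one {s : ℝ≥0∞} {p : ℝ} (hp : 0 < p) (h : ENNReal.ofReal p < s) :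
    p * s⁻¹.toReal < 1 := by
  rw [← ENNReal.inv_div_ofReal_toReal hp]
  exact ENNReal.toReal_inv_lt_one (ENNReal.one_lt_div_ofReal hp h)

end Exponents

/-! ### Hölder's inequality separating the kernel from the weight. -/

section Holder

variable {α : Type*} [MeasurableSpace α]

/-- Hölder's inequality with exponents `s / p` and its conjugate, including `s = ∞`. -/
theorem lintegral_rpow_mul_le_eLpNorm {ν : Measure α} {p κ : ℝ} (hp : 0 < p) {s : ℝ≥0∞}
    (hs : ENNReal.ofReal p < s) (hκ : κ = 1 / (1 - p * s⁻¹.toReal)) {F G : α → ℝ≥0∞}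
    (hF : AEMeasurable F ν) (hG : AEMeasurable G ν) :
    ∫⁻ x, F x ^ p * G x ∂ν ≤ eLpNorm F s ν ^ p * (∫⁻ x, G x ^ κ ∂ν) ^ (1 / κ) := by
  have hs0 : s ≠ 0 := (zero_le.trans_lt hs).ne'
  rcases eq_or_ne s ∞ with rfl | hst
  · have : κ = 1 := by simp [hκ]
    subst this
    simp only [ENNReal.rpow_one, div_one]
    rw [eLpNorm_exponent_top, ← lintegral_const_mul'' _ hG]
    apply lintegral_mono_ae
    filter_upwards [enorm_ae_le_eLpNormEssSup F ν] with x hx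
    gcongr
    exact hx
  · have hs1 : 0 < s.toReal := ENNReal.toReal_pos hs0 hst
    have hps : p < s.toReal := (ENNReal.ofReal_lt_iff_lt_toReal hp.le hst).1 hs
    have hsp1 : 1 < s.toReal / p := (one_lt_div hp).2 hps
    have hκ' : κ = (s.toReal / p).conjExponent := by
      rw [hκ, Real.conjExponent, ENNReal.toReal_inv]
      have : s.toReal - p ≠ 0 := by linarith
      field_simp
    have hc : (s.toReal / p).HolderConjugate κ := hκ' ▸ Real.HolderConjugate.conjExponent hsp1
    have h := ENNReal.lintegral_mul_le_Lp_mul_Lq ν hc (hF.pow_const p) hG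
    refine h.trans (le_of_eq ?_)
    congr 1
    rw [eLpNorm_eq_lintegral_rpow_enorm_toReal hs0 hst, ← ENNReal.rpow_mul]
    simp only [← ENNReal.rpow_mul, enorm_eq_self]
    rw [mul_div_cancel₀ _ hp.ne']
    congr 1
    field_simp

end Holder

/-! ### Duality between `L_p(w)` and `L_{p'}(w^(1-p'))`. -/

section WeightedDuality

variable {n : ℕ} {w : EuclideanSpace ℝ (Fin n) → ℝ}

/-- Hölder after inserting `1 = w^(1/p) (w^(1-p'))^(1/p')`, valid a.e. -/
theorem IsWeight.lintegral_mul_le (hw : IsWeight w) {p : ℝ} (hp : 1 < p)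
    (x : EuclideanSpace ℝ (Fin n)) (r : ℝ) {f g : EuclideanSpace ℝ (Fin n) → ℝ≥0∞}
    (hf : AEMeasurable f) (hg : AEMeasurable g) :
    ∫⁻ y in ball x r, g y * f y ≤
      (∫⁻ y in ball x r, f y ^ p ∂(weightMeasure w)) ^ (1 / p) *
        (∫⁻ y in ball x r, g y ^ p.conjExponent
          ∂(weightMeasure fun x => w x ^ (1 - p.conjExponent))) ^ (1 / p.conjExponent) := by
  have hpq := Real.HolderConjugate.conjExponent hp
  set p' := p.conjExponent
  have hW := hw.aemeasurable.ennreal_ofReal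
  have hV : AEMeasurable fun x => ENNReal.ofReal (w x ^ (1 - p')) :=
    (hw.aemeasurable.pow_const _).ennreal_ofReal
  rw [weightMeasure, weightMeasure, setLIntegral_withDensity_eq hW x r (hf.restrict.pow_const p),
    setLIntegral_withDensity_eq hV x r (hg.restrict.pow_const p')]
  have h := ENNReal.lintegral_mul_le_Lp_mul_Lq (volume.restrict (ball x r)) hpq
    (f := fun y => f y * ENNReal.ofReal (w y) ^ (1 / p))
    (g := fun y => g y * ENNReal.ofReal (w y ^ (1 - p')) ^ (1 / p'))
    (hf.mul (hW.pow_const _)).restrict (hg.mul (hV.pow_const _)).restrict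
  simp only [ENNReal.mul_rpow_of_nonneg _ _ hpq.nonneg, ENNReal.mul_rpow_of_nonneg _ _ hpq.symm.nonneg,
    ← ENNReal.rpow_mul, one_div_mul_cancel hpq.ne_zero, one_div_mul_cancel hpq.symm.ne_zero,
    ENNReal.rpow_one] at h
  refine le_trans (le_of_eq ?_) h
  apply lintegral_congr_ae
  filter_upwards [ae_restrict_of_ae hw.2] with y hy
  have e : ENNReal.ofReal (w y) ^ (1 / p) * ENNReal.ofReal (w y ^ (1 - p')) ^ (1 / p') = 1 := by
    rw [ENNReal.ofReal_rpow_of_nonneg hy.le (one_div_nonneg.2 hpq.nonneg),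
      ENNReal.ofReal_rpow_of_nonneg (by positivity) (one_div_nonneg.2 hpq.symm.nonneg),
      ← ENNReal.ofReal_mul (by positivity), ← Real.rpow_mul hy.le, ← Real.rpow_add hy]
    have h1 := hpq.inv_add_inv_eq_one
    have h2 : 1 / p + (1 - p') * (1 / p') = 0 := by
      have := hpq.symm.ne_zero
      have h3 : (1 - p') * (1 / p') = 1 / p' - 1 := by field_simp
      rw [h3, one_div, one_div]; linarith
    rw [h2, Real.rpow_zero, ENNReal.ofReal_one]
  simp only [Pi.mul_apply]
  calc g y * f y = g y * f y * 1 := (mul_one _).symm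
    _ = _ := by rw [← e]; ring

end WeightedDuality

/-! ### Weighted oscillation on dilated balls about a fixed mean. -/

section Oscillation

variable {𝕜 : Type*} [RCLike 𝕜] {n : ℕ} {q : ℝ} {C : ℝ≥0} {μ : Measure (EuclideanSpace ℝ (Fin n))}

/-- Weighted oscillation over the dilated ball `B(x, 2^j r)` about the mean over `B(x, r)`. -/
theorem exists_lintegral_rpow_sub_average_dyadic_le (hn : 1 ≤ n) (hμ : HasAveragingBound q C μ)
    {σ : ℝ} (hσ : 1 ≤ σ) :
    ∃ C' : ℝ≥0, ∀ b : EuclideanSpace ℝ (Fin n) → 𝕜, IsBMO b →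
      ∀ (x : EuclideanSpace ℝ (Fin n)) (r : ℝ), 0 < r → ∀ j : ℕ,
      (∫⁻ y in ball x (2 ^ j * r), ‖b y - ⨍ z in ball x r, b z‖ₑ ^ σ ∂μ) ^ (1 / σ) ≤
        C' * (j + 1) * bmoSeminorm b * μ (ball x (2 ^ j * r)) ^ (1 / σ) := by
  have hσ0 : 0 < σ := by linarith
  obtain ⟨C', hC'⟩ := exists_lintegral_rpow_sub_average_le (𝕜 := 𝕜) hn hμ hσ0
  refine ⟨C' + 2 ^ n, fun b hb x r hr j => ?_⟩
  set B := ball x (2 ^ j * r)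
  set c := ⨍ z in ball x r, b z
  set c' := ⨍ z in B, b z
  set M := bmoSeminorm b
  have hmeas : AEMeasurable (fun y => ‖b y - c'‖ₑ) (μ.restrict B) :=
    ((hb.1.aestronglyMeasurable.sub aestronglyMeasurable_const).enorm.mono_ac hμ.ac).restrict
  have h1 : (∫⁻ y in B, ‖b y - c'‖ₑ ^ σ ∂μ) ^ (1 / σ) ≤ C' * M * μ B ^ (1 / σ) := by
    refine (ENNReal.rpow_le_rpow (hC' b hb x (2 ^ j * r) (by positivity)) (by positivity)).trans
      (le_of_eq ?_)
    rw [ENNReal.mul_rpow_of_nonneg _ _ (by positivity), ← ENNReal.rpow_mul,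
      mul_one_div_cancel hσ0.ne', ENNReal.rpow_one]
  have h2 : (∫⁻ _ in B, ‖c' - c‖ₑ ^ σ ∂μ) ^ (1 / σ) ≤ j * (2 ^ n * M) * μ B ^ (1 / σ) := by
    rw [setLIntegral_const, ENNReal.mul_rpow_of_nonneg _ _ (by positivity), ← ENNReal.rpow_mul,
      mul_one_div_cancel hσ0.ne', ENNReal.rpow_one, enorm_sub_rev]
    gcongr
    exact enorm_average_dyadic_sub_le hb.1 x hr j
  calc (∫⁻ y in B, ‖b y - c‖ₑ ^ σ ∂μ) ^ (1 / σ)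
      ≤ (∫⁻ y in B, (‖b y - c'‖ₑ + ‖c' - c‖ₑ) ^ σ ∂μ) ^ (1 / σ) := by
        gcongr with y
        rw [← sub_add_sub_cancel (b y) c' c]
        exact enorm_add_le _ _
    _ ≤ (∫⁻ y in B, ‖b y - c'‖ₑ ^ σ ∂μ) ^ (1 / σ) + (∫⁻ _ in B, ‖c' - c‖ₑ ^ σ ∂μ) ^ (1 / σ) :=
        ENNReal.lintegral_Lp_add_le (f := fun y => ‖b y - c'‖ₑ) (g := fun _ => ‖c' - c‖ₑ) hmeas
          aemeasurable_const hσ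
    _ ≤ C' * M * μ B ^ (1 / σ) + j * (2 ^ n * M) * μ B ^ (1 / σ) := add_le_add h1 h2
    _ ≤ (C' + 2 ^ n) * (j + 1) * M * μ B ^ (1 / σ) := by
        rw [← add_mul]
        gcongr
        calc (C' : ℝ≥0∞) * M + j * (2 ^ n * M) = (C' + 2 ^ n * j) * M := by ring
          _ ≤ (C' * (j + 1) + 2 ^ n * (j + 1)) * M := by
              gcongr
              · exact le_mul_of_one_le_right' le_add_self
              · exact le_self_add
          _ = (C' + 2 ^ n) * (j + 1) * M := by ring
    _ = _ := by push_cast; rfl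

end Oscillation

/-! ### Translates of the kernel. -/

section KernelTranslate

variable {𝕜 : Type*} [RCLike 𝕜] {n : ℕ} {s : ℝ≥0∞} {Ω : EuclideanSpace ℝ (Fin n) → 𝕜}

theorem sub_mem_ball_zero {x₀ x y : EuclideanSpace ℝ (Fin n)} {r R : ℝ} (hrR : r ≤ R)
    (hx : x ∈ ball x₀ r) (hy : y ∈ ball x₀ R) : x - y ∈ ball 0 (2 * R) := by
  rw [mem_ball_zero_iff, ← dist_eq_norm]
  rw [mem_ball] at hx hy
  have := dist_triangle_right x y x₀
  linarith

theorem eLpNorm_sub_right_le (hΩm : AEStronglyMeasurable Ω volume) {x₀ y : EuclideanSpace ℝ (Fin n)}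
    {r R : ℝ} (hrR : r ≤ R) (hy : y ∈ ball x₀ R) :
    eLpNorm (fun x => ‖Ω (x - y)‖ₑ) s (volume.restrict (ball x₀ r)) ≤
      eLpNorm Ω s (volume.restrict (ball 0 (2 * R))) := by
  have hmp := (measurePreserving_sub_right (volume : Measure (EuclideanSpace ℝ (Fin n)))
    y).restrict_preimage (measurableSet_ball (x := (0 : EuclideanSpace ℝ (Fin n))) (ε := 2 * R))
  rw [← eLpNorm_comp_measurePreserving hΩm.restrict hmp]
  rw [← eLpNorm_enorm (f := Ω ∘ fun x => x - y)]
  refine eLpNorm_mono_measure _ (Measure.restrict_mono_set _ fun x hx => ?_)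
  exact sub_mem_ball_zero hrR hx hy

end KernelTranslate

/-! ### The kernel bound when `w^(1-p')` is a Muckenhoupt weight and `p < s`. -/

section KernelBound

variable {𝕜 : Type*} [RCLike 𝕜] {n : ℕ}

/-- The `L_{p,w}(B(x₀,r))` bound, with a logarithmic factor, for the commutator kernel acting on
functions supported in `B(x₀, 2^k r)`; `N x₀ t` plays the role of the weight of `B(x₀, t)`. -/
def HasCommutatorKernelBound (p : ℝ) (w : EuclideanSpace ℝ (Fin n) → ℝ)
    (Ω : EuclideanSpace ℝ (Fin n) → 𝕜) (N : EuclideanSpace ℝ (Fin n) → ℝ → ℝ≥0∞) : Prop :=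
  ∃ C : ℝ≥0, ∀ b : EuclideanSpace ℝ (Fin n) → 𝕜, IsBMO b →
    ∀ (x₀ : EuclideanSpace ℝ (Fin n)) (r : ℝ), 0 < r → ∀ (k : ℕ)
      (f : EuclideanSpace ℝ (Fin n) → ℝ≥0∞), AEMeasurable f →
    (∫⁻ x in ball x₀ r, (∫⁻ y in ball x₀ (2 ^ k * r), ‖b x - b y‖ₑ * ‖Ω (x - y)‖ₑ * f y) ^ p
      ∂(weightMeasure w)) ^ (1 / p) ≤
      C * bmoSeminorm b * (k + 1) * ENNReal.ofReal (2 ^ k * r) ^ n * N x₀ r ^ (1 / p) *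
        N x₀ (2 ^ k * r) ^ (-(1 / p)) *
        (∫⁻ y in ball x₀ (2 ^ k * r), f y ^ p ∂(weightMeasure w)) ^ (1 / p)

instance {w : EuclideanSpace ℝ (Fin n) → ℝ} : SFinite (weightMeasure w) := by
  unfold weightMeasure; infer_instance

theorem weightMeasure_ac (w : EuclideanSpace ℝ (Fin n) → ℝ) : weightMeasure w ≪ volume :=
  withDensity_absolutelyContinuous _ _

theorem aemeasurable_enorm_sub_prod {Ω : EuclideanSpace ℝ (Fin n) → 𝕜}
    (hΩ : AEStronglyMeasurable Ω volume) :
    AEMeasurable (fun z : EuclideanSpace ℝ (Fin n) × EuclideanSpace ℝ (Fin n) => ‖Ω (z.1 - z.2)‖ₑ)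
      (volume.prod volume) :=
  (hΩ.comp_quasiMeasurePreserving (quasiMeasurePreserving_sub volume volume)).enorm

theorem ac_prod_restrict {μ : Measure (EuclideanSpace ℝ (Fin n))} [SFinite μ] (hμ : μ ≪ volume)
    (s t : Set (EuclideanSpace ℝ (Fin n))) :
    (μ.restrict s).prod (volume.restrict t) ≪
      (volume : Measure (EuclideanSpace ℝ (Fin n))).prod volume :=
  (Measure.restrict_le_self.absolutelyContinuous.trans hμ).prod
    Measure.restrict_le_self.absolutelyContinuous

/-- The kernel bound obtained from the Schur test, when the kernel is integrated in `x` first. -/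
theorem lintegral_commutatorKernel_rpow_le {μ : Measure (EuclideanSpace ℝ (Fin n))} [SFinite μ]
    (hμ : μ ≪ volume) {p : ℝ} (hp : 1 < p) {Ω b : EuclideanSpace ℝ (Fin n) → 𝕜} (hΩ : AEStronglyMeasurable Ω volume)
    (hb : AEStronglyMeasurable b volume) (β : 𝕜) (S T : Set (EuclideanSpace ℝ (Fin n)))
    {f : EuclideanSpace ℝ (Fin n) → ℝ≥0∞} (hf : AEMeasurable f) {M₁ M₂ : ℝ≥0∞}
    (hT : MeasurableSet T)
    (h₁ : ∀ y ∈ T, ∫⁻ x in S, (‖b x - β‖ₑ * ‖Ω (x - y)‖ₑ) ^ p ∂μ ≤ M₁ ^ p)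
    (h₂ : ∀ y ∈ T, ∫⁻ x in S, ‖Ω (x - y)‖ₑ ^ p ∂μ ≤ M₂ ^ p) :
    (∫⁻ x in S, (∫⁻ y in T, ‖b x - b y‖ₑ * ‖Ω (x - y)‖ₑ * f y) ^ p ∂μ) ^ (1 / p) ≤
      M₁ * (∫⁻ y in T, f y) + M₂ * ∫⁻ y in T, ‖b y - β‖ₑ * f y := by
  have hp0 : 0 < p := by linarith
  have hac := ac_prod_restrict hμ S T
  have hΩ2 := (aemeasurable_enorm_sub_prod hΩ).mono_ac hac
  have hbβ : AEMeasurable (fun x => ‖b x - β‖ₑ) := (hb.sub aestronglyMeasurable_const).enorm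
  have hb1 : AEMeasurable (fun z : EuclideanSpace ℝ (Fin n) × EuclideanSpace ℝ (Fin n) =>
      ‖b z.1 - β‖ₑ) ((μ.restrict S).prod (volume.restrict T)) :=
    (hbβ.comp_fst (ν := volume)).mono_ac hac
  have hb2 : AEMeasurable (fun z : EuclideanSpace ℝ (Fin n) × EuclideanSpace ℝ (Fin n) =>
      ‖b z.2 - β‖ₑ) ((μ.restrict S).prod (volume.restrict T)) :=
    (hbβ.comp_snd (μ := volume)).mono_ac hac
  have hf2 : AEMeasurable (fun z : EuclideanSpace ℝ (Fin n) × EuclideanSpace ℝ (Fin n) =>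
      f z.2) ((μ.restrict S).prod (volume.restrict T)) := (hf.comp_snd (μ := volume)).mono_ac hac
  -- Splitting at the constant `β`: in `F₁` the factor in `b(x)` belongs to the kernel, in `F₂` the
  -- factor in `b(y)` belongs to the function. The Schur bound then applies to each.
  set F₁ : EuclideanSpace ℝ (Fin n) → ℝ≥0∞ := fun x =>
    ∫⁻ y in T, ‖b x - β‖ₑ * ‖Ω (x - y)‖ₑ * f y
  set F₂ : EuclideanSpace ℝ (Fin n) → ℝ≥0∞ := fun x =>
    ∫⁻ y in T, ‖Ω (x - y)‖ₑ * (‖b y - β‖ₑ * f y)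
  have hF₁ : AEMeasurable F₁ (μ.restrict S) := ((hb1.mul hΩ2).mul hf2).lintegral_prod_right'
  have hF₂ : AEMeasurable F₂ (μ.restrict S) := (hΩ2.mul (hb2.mul hf2)).lintegral_prod_right'
  have hle : ∀ᵐ x ∂(μ.restrict S), ∫⁻ y in T, ‖b x - b y‖ₑ * ‖Ω (x - y)‖ₑ * f y ≤ F₁ x + F₂ x := by
    filter_upwards [((hb1.mul hΩ2).mul hf2).aestronglyMeasurable.prodMk_left] with x hx
    simp only [F₁, F₂]
    have hx' : AEMeasurable (fun y => ‖b x - β‖ₑ * ‖Ω (x - y)‖ₑ * f y) (volume.restrict T) :=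
      hx.aemeasurable
    rw [← lintegral_add_left' hx']
    refine lintegral_mono fun y => ?_
    have : ‖b x - b y‖ₑ ≤ ‖b x - β‖ₑ + ‖b y - β‖ₑ := by
      rw [← sub_sub_sub_cancel_right (b x) (b y) β]
      exact enorm_sub_le
    calc ‖b x - b y‖ₑ * ‖Ω (x - y)‖ₑ * f y ≤ (‖b x - β‖ₑ + ‖b y - β‖ₑ) * ‖Ω (x - y)‖ₑ * f y := by
          gcongr
      _ = _ := by ring
  have hS₁ : (∫⁻ x in S, F₁ x ^ p ∂μ) ^ (1 / p) ≤ M₁ * ∫⁻ y in T, f y := by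
    rw [one_div, ENNReal.rpow_inv_le_iff hp0, ENNReal.mul_rpow_of_nonneg _ _ hp0.le, mul_comm]
    refine lintegral_lintegral_mul_rpow_le (K := fun x y => ‖b x - β‖ₑ * ‖Ω (x - y)‖ₑ) hp
      (hb1.mul hΩ2) hf.restrict ?_
    exact (ae_restrict_iff' hT).2 (Filter.Eventually.of_forall h₁)
  have hS₂ : (∫⁻ x in S, F₂ x ^ p ∂μ) ^ (1 / p) ≤ M₂ * ∫⁻ y in T, ‖b y - β‖ₑ * f y := by
    rw [one_div, ENNReal.rpow_inv_le_iff hp0, ENNReal.mul_rpow_of_nonneg _ _ hp0.le, mul_comm]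
    refine lintegral_lintegral_mul_rpow_le (K := fun x y => ‖Ω (x - y)‖ₑ) hp
      hΩ2 (hbβ.mul hf).restrict ?_
    exact (ae_restrict_iff' hT).2 (Filter.Eventually.of_forall h₂)
  calc (∫⁻ x in S, (∫⁻ y in T, ‖b x - b y‖ₑ * ‖Ω (x - y)‖ₑ * f y) ^ p ∂μ) ^ (1 / p)
      ≤ (∫⁻ x in S, (F₁ x + F₂ x) ^ p ∂μ) ^ (1 / p) := by
        refine ENNReal.rpow_le_rpow (lintegral_mono_ae ?_) (by positivity)
        filter_upwards [hle] with x hx using ENNReal.rpow_le_rpow hx hp0.le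
    _ ≤ (∫⁻ x in S, F₁ x ^ p ∂μ) ^ (1 / p) + (∫⁻ x in S, F₂ x ^ p ∂μ) ^ (1 / p) :=
        ENNReal.lintegral_Lp_add_le hF₁ hF₂ hp.le
    _ ≤ _ := add_le_add hS₁ hS₂

/-- With `v = w^(1-p')` in `A_q`, `q = p'/s'`, the dual weight of `v` is `u = w^κ`. Thus
`‖w‖_{L_κ(B)}` is `u(B)^(1/κ)`, and its doubling, positivity and finiteness come from the theory for
`u`. John–Nirenberg is needed with respect to `u` for the variable `x`, and with respect to `v` for
the variable `y`. -/
theorem hasCommutatorKernelBound_of_dual (hn : 1 ≤ n) {p : ℝ} (hp : 1 < p) {s : ℝ≥0∞} (hs : 1 < s)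
    {Ω : EuclideanSpace ℝ (Fin n) → 𝕜} (hΩ : IsRoughKernel s Ω)
    {w : EuclideanSpace ℝ (Fin n) → ℝ} (hw : IsWeight w) (hps : ENNReal.ofReal p < s)
    (hA : IsMuckenhoupt (Real.conjExponent p / (ENNReal.conjExponent s).toReal)
      (fun x => w x ^ (1 - Real.conjExponent p))) :
    (∃ C : ℝ≥0, ∀ (x : EuclideanSpace ℝ (Fin n)) (r : ℝ), 0 < r →
      eLpNorm w (ENNReal.conjExponent (s / ENNReal.ofReal p)) (volume.restrict (ball x (2 * r))) ≤
        C * eLpNorm w (ENNReal.conjExponent (s / ENNReal.ofReal p)) (volume.restrict (ball x r))) ∧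
    (∀ (x : EuclideanSpace ℝ (Fin n)) (r : ℝ), 0 < r →
      eLpNorm w (ENNReal.conjExponent (s / ENNReal.ofReal p)) (volume.restrict (ball x r)) ≠ 0 ∧
      eLpNorm w (ENNReal.conjExponent (s / ENNReal.ofReal p)) (volume.restrict (ball x r)) ≠ ∞) ∧
    HasCommutatorKernelBound p w Ω fun x t =>
      eLpNorm w (ENNReal.conjExponent (s / ENNReal.ofReal p)) (volume.restrict (ball x t)) := by
  have hp0 : 0 < p := by linarith
  have hpq := Real.HolderConjugate.conjExponent hp
  have hpp : p.conjExponent = p / (p - 1) := rfl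
  have hsp := ENNReal.one_lt_div_ofReal hp0 hps
  have hθ1 := ENNReal.toReal_inv_lt_one hs
  have hpθ := ENNReal.mul_toReal_inv_lt_one hp0 hps
  rw [ENNReal.conjExponent_toReal_eq hs, div_div_eq_mul_div, div_one] at hA
  rw [ENNReal.conjExponent_eq_ofReal hsp, ENNReal.inv_div_ofReal_toReal hp0]
  have hθ0 : 0 ≤ s⁻¹.toReal := ENNReal.toReal_nonneg
  set p' := p.conjExponent
  set θ := s⁻¹.toReal with hθ
  set κ := 1 / (1 - p * θ) with hκ
  have h1θ : 0 < 1 - θ := by linarith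
  have h1pθ : 0 < 1 - p * θ := by linarith
  have hp1 : 0 < p - 1 := by linarith
  have hκ1 : 1 ≤ κ := by
    rw [hκ, le_div_iff₀ h1pθ]; nlinarith
  have hκ0 : 0 < κ := by linarith
  set q := p' * (1 - θ) with hqdef
  have hq1 : q - 1 = (1 - p * θ) / (p - 1) := by rw [hqdef, hpp]; field_simp; ring
  have hq : 1 < q := by
    have : 0 < q - 1 := by rw [hq1]; positivity
    linarith
  -- This identity makes `w^κ` the dual weight of `w^(1-p')`.
  have hexp : (1 - p') * (1 - q.conjExponent) = κ := by
    have e : 1 - q.conjExponent = -1 / (q - 1) := by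
      have : q - 1 ≠ 0 := by linarith
      rw [Real.conjExponent]; field_simp; ring
    rw [e, hq1, hκ, hpp]; field_simp; ring
  obtain ⟨CU, hU⟩ := hA.exists_hasAveragingBound_dual hq
  obtain ⟨CV, hV⟩ := hA.exists_hasAveragingBound
  obtain ⟨CA, hCA⟩ := hA.exists_mul_rpow_le hq
  have hUweight := (hA.dual hq).1
  set u : EuclideanSpace ℝ (Fin n) → ℝ := fun x => (w x ^ (1 - p')) ^ (1 - q.conjExponent) with hu
  set v : EuclideanSpace ℝ (Fin n) → ℝ := fun x => w x ^ (1 - p') with hv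
  have huw : ∀ᵐ x, ENNReal.ofReal (u x) = ENNReal.ofReal (w x) ^ κ := by
    filter_upwards [hw.2] with x hx
    rw [hu, ENNReal.ofReal_rpow_of_nonneg hx.le hκ0.le]
    simp only
    rw [← Real.rpow_mul hx.le, hexp]
  set N : EuclideanSpace ℝ (Fin n) → ℝ → ℝ≥0∞ := fun x t =>
    eLpNorm w (ENNReal.ofReal κ) (volume.restrict (ball x t)) with hN
  have hNU : ∀ x t, N x t = weightMeasure u (ball x t) ^ (1 / κ) := by
    intro x t
    rw [hN, weightMeasure, withDensity_ball]
    simp only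
    rw [eLpNorm_eq_lintegral_rpow_enorm_toReal (by simpa using hκ0) ENNReal.ofReal_ne_top,
      ENNReal.toReal_ofReal hκ0.le]
    congr 1
    apply lintegral_congr_ae
    filter_upwards [ae_restrict_of_ae huw, ae_restrict_of_ae hw.2] with y hy hy'
    rw [hy, Real.enorm_eq_ofReal hy'.le]
  have hUfin : ∀ x t, 0 < t → weightMeasure u (ball x t) ≠ ∞ := fun x t ht =>
    (hU.ball_lt_top x t ht).ne
  have hU0 : ∀ x t, 0 < t → weightMeasure u (ball x t) ≠ 0 := by
    intro x t ht
    rw [weightMeasure, withDensity_ball]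
    exact hUweight.lintegral_ball_ne_zero x ht
  have hNpos : ∀ x t, 0 < t → N x t ≠ 0 ∧ N x t ≠ ∞ := by
    intro x t ht
    rw [hNU]
    exact ⟨by rw [Ne, ENNReal.rpow_eq_zero_iff_of_pos (by positivity)]; exact hU0 x t ht,
      ENNReal.rpow_ne_top_of_nonneg (by positivity) (hUfin x t ht)⟩
  refine ⟨?_, fun x r hr => hNpos x r hr, ?_⟩
  · refine ⟨(CU * ENNReal.ofReal (2 ^ n) ^ q.conjExponent).toNNReal ^ (1 / κ), fun x r hr => ?_⟩
    have h := hU.measure_ball_le (x := x) (y := x) hr two_pos (ball_subset_ball (by linarith))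
    have ht : (CU * ENNReal.ofReal (2 ^ n) ^ q.conjExponent) ≠ ∞ :=
      ENNReal.mul_ne_top ENNReal.coe_ne_top
        (ENNReal.rpow_ne_top_of_nonneg hU.pos.le ENNReal.ofReal_ne_top)
    change N x (2 * r) ≤ _ * N x r
    rw [hNU, hNU, ENNReal.coe_rpow_of_nonneg _ (by positivity), ENNReal.coe_toNNReal ht,
      ← ENNReal.mul_rpow_of_nonneg _ _ (by positivity)]
    exact ENNReal.rpow_le_rpow h (by positivity)
  -- The order `p κ` arises because Hölder raises `|b - β|^p w` to the power `κ`.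
  · obtain ⟨J₁, hJ₁⟩ := exists_lintegral_rpow_sub_average_le (𝕜 := 𝕜) hn hU
      (σ := p * κ) (by positivity)
    obtain ⟨J₂, hJ₂⟩ := exists_lintegral_rpow_sub_average_dyadic_le (𝕜 := 𝕜) hn hV
      (σ := p') hpq.symm.lt.le
    have hΩm := hΩ.aestronglyMeasurable hn
    set ω := eLpNorm Ω s (volume.restrict (ball 0 1)) with hω
    have hωt : ω ≠ ∞ := (hΩ.memLp_unit_ball hn).2.ne
    set v₁ := volume (ball (0 : EuclideanSpace ℝ (Fin n)) 1) with hv₁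
    have hv₁t : v₁ ≠ ∞ := measure_ball_lt_top.ne
    set G : ℝ≥0∞ := (J₁ + J₂) * (2 ^ (n * θ) * ω) * ((CA : ℝ≥0∞) ^ (1 / p') * v₁ ^ (1 - θ)) with hG
    have hGt : G ≠ ∞ := by
      refine ENNReal.mul_ne_top (ENNReal.mul_ne_top (by simp) (ENNReal.mul_ne_top ?_ hωt))
        (ENNReal.mul_ne_top ?_ ?_)
      · exact ENNReal.rpow_ne_top_of_nonneg (by positivity) (by simp)
      · exact ENNReal.rpow_ne_top_of_nonneg (one_div_nonneg.2 hpq.symm.nonneg) (by simp)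
      · exact ENNReal.rpow_ne_top_of_nonneg h1θ.le hv₁t
    refine ⟨G.toNNReal, fun b hb x₀ r hr k f hf => ?_⟩
    rw [ENNReal.coe_toNNReal hGt]
    set R := 2 ^ k * r with hR
    have hR0 : 0 < R := by positivity
    have hrR : r ≤ R := le_mul_of_one_le_left hr.le (one_le_pow₀ one_le_two)
    set β := ⨍ z in ball x₀ r, b z
    set m := bmoSeminorm b
    set ωR := eLpNorm Ω s (volume.restrict (ball 0 (2 * R))) with hωR
    have hWm := hw.aemeasurable.ennreal_ofReal
    have hbβ : AEMeasurable (fun x => ‖b x - β‖ₑ) :=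
      (hb.1.aestronglyMeasurable.sub aestronglyMeasurable_const).enorm
    have hΩy : ∀ y, AEMeasurable (fun x => ‖Ω (x - y)‖ₑ) := fun y =>
      (hΩm.comp_measurePreserving (measurePreserving_sub_right volume y)).enorm
    have hhold : ∀ φ : EuclideanSpace ℝ (Fin n) → ℝ≥0∞, AEMeasurable φ → ∀ y ∈ ball x₀ R,
        ∫⁻ x in ball x₀ r, (φ x * ‖Ω (x - y)‖ₑ) ^ p ∂(weightMeasure w) ≤
          ωR ^ p * (∫⁻ x in ball x₀ r, φ x ^ (p * κ) ∂(weightMeasure u)) ^ (1 / κ) := by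
      intro φ hφ y hy
      rw [weightMeasure, setLIntegral_withDensity_eq (g := fun x => (φ x * ‖Ω (x - y)‖ₑ) ^ p) hWm _ _
          ((hφ.mul (hΩy y)).restrict.pow_const p), weightMeasure, setLIntegral_withDensity_eq hUweight.aemeasurable.ennreal_ofReal _ _
          (hφ.restrict.pow_const _)]
      have h := lintegral_rpow_mul_le_eLpNorm (ν := volume.restrict (ball x₀ r)) hp0 hps
        (κ := κ) rfl (F := fun x => ‖Ω (x - y)‖ₑ) (G := fun x => φ x ^ p * ENNReal.ofReal (w x))
        (hΩy y).restrict ((hφ.pow_const p).mul hWm).restrict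
      calc _ = ∫⁻ x in ball x₀ r, ‖Ω (x - y)‖ₑ ^ p * (φ x ^ p * ENNReal.ofReal (w x)) := by
            refine lintegral_congr fun x => ?_
            rw [ENNReal.mul_rpow_of_nonneg _ _ hp0.le]; ring
        _ ≤ _ := h
        _ ≤ ωR ^ p * (∫⁻ x in ball x₀ r, (φ x ^ p * ENNReal.ofReal (w x)) ^ κ) ^ (1 / κ) := by
            gcongr
            exact eLpNorm_sub_right_le hΩm hrR hy
        _ = _ := by
            congr 2
            apply lintegral_congr_ae
            filter_upwards [ae_restrict_of_ae huw] with x hx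
            rw [hx, ENNReal.mul_rpow_of_nonneg _ _ hκ0.le, ← ENNReal.rpow_mul]
    have hM₁ : ∀ y ∈ ball x₀ R, ∫⁻ x in ball x₀ r, (‖b x - β‖ₑ * ‖Ω (x - y)‖ₑ) ^ p
        ∂(weightMeasure w) ≤ (ωR * (J₁ * m) * N x₀ r ^ (1 / p)) ^ p := by
      intro y hy
      refine (hhold _ hbβ y hy).trans ?_
      have h1 : (∫⁻ x in ball x₀ r, ‖b x - β‖ₑ ^ (p * κ) ∂(weightMeasure u)) ^ (1 / κ) ≤
          (J₁ * m) ^ p * N x₀ r := by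
        refine (ENNReal.rpow_le_rpow (hJ₁ b hb x₀ r hr) (by positivity)).trans (le_of_eq ?_)
        rw [ENNReal.mul_rpow_of_nonneg _ _ (by positivity), ← ENNReal.rpow_mul, hNU]
        congr 2
        field_simp
      calc _ ≤ ωR ^ p * ((J₁ * m) ^ p * N x₀ r) := by gcongr
        _ = _ := by
          rw [ENNReal.mul_rpow_of_nonneg (ωR * _) _ hp0.le, ENNReal.mul_rpow_of_nonneg ωR _ hp0.le,
            ← ENNReal.rpow_mul, one_div_mul_cancel hp0.ne', ENNReal.rpow_one, mul_assoc]
    have hM₂ : ∀ y ∈ ball x₀ R, ∫⁻ x in ball x₀ r, ‖Ω (x - y)‖ₑ ^ p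
        ∂(weightMeasure w) ≤ (ωR * N x₀ r ^ (1 / p)) ^ p := by
      intro y hy
      have h1 := hhold (fun _ => 1) aemeasurable_const y hy
      simp only [one_mul, ENNReal.one_rpow, setLIntegral_const] at h1
      refine h1.trans (le_of_eq ?_)
      rw [ENNReal.mul_rpow_of_nonneg _ _ hp0.le,
        ← ENNReal.rpow_mul, one_div_mul_cancel hp0.ne', ENNReal.rpow_one, hNU]
    have hmain := lintegral_commutatorKernel_rpow_le (weightMeasure_ac w) hp hΩm
      hb.1.aestronglyMeasurable β (ball x₀ r) (ball x₀ R) hf measurableSet_ball hM₁ hM₂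
    set F := (∫⁻ y in ball x₀ R, f y ^ p ∂(weightMeasure w)) ^ (1 / p)
    set VR := weightMeasure v (ball x₀ R)
    have hf1 : ∫⁻ y in ball x₀ R, f y ≤ F * VR ^ (1 / p') := by
      have := hw.lintegral_mul_le hp x₀ R hf (g := fun _ => 1) aemeasurable_const
      simpa only [one_mul, ENNReal.one_rpow, setLIntegral_const] using this
    have hf2 : ∫⁻ y in ball x₀ R, ‖b y - β‖ₑ * f y ≤ F * (J₂ * (k + 1) * m * VR ^ (1 / p')) :=
      (hw.lintegral_mul_le hp x₀ R hf hbβ).trans (by gcongr; exact hJ₂ b hb x₀ r hr k)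
    -- The `A_q` inequality raised to `1/p'`: since `(q-1)/p' = 1/(κ p)`, the mass of `u` becomes
    -- `N^(1/p)`, and since `q/p' = 1 - θ`, the volume appears to the power `1 - θ`.
    have hVR : VR ^ (1 / p') ≤
        (CA : ℝ≥0∞) ^ (1 / p') * (ENNReal.ofReal R ^ n * v₁) ^ (1 - θ) * N x₀ R ^ (-(1 / p)) := by
      have h1 := hCA x₀ R hR0
      have e0 : ∀ z : EuclideanSpace ℝ (Fin n) → ℝ, (∫⁻ y in ball x₀ R, ENNReal.ofReal (z y)) =
          weightMeasure z (ball x₀ R) := fun z => by rw [weightMeasure, withDensity_ball]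
      have h2 : VR * weightMeasure u (ball x₀ R) ^ (q - 1) ≤ CA * volume (ball x₀ R) ^ q := by
        rw [← e0 u]; simpa only [VR, ← e0 v] using h1
      have hp'0 : 0 < 1 / p' := one_div_pos.2 hpq.symm.pos
      have h3 := ENNReal.rpow_le_rpow h2 hp'0.le
      rw [ENNReal.mul_rpow_of_nonneg _ _ hp'0.le, ENNReal.mul_rpow_of_nonneg _ _ hp'0.le,
        ← ENNReal.rpow_mul, ← ENNReal.rpow_mul] at h3
      have hvol : volume (ball x₀ R) = ENNReal.ofReal R ^ n * v₁ := by
        rw [Measure.addHaar_ball_of_pos volume x₀ hR0, finrank_euclideanSpace_fin,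
          ENNReal.ofReal_pow hR0.le]
      have e1 : (q - 1) * (1 / p') = (1 / κ) * (1 / p) := by
        rw [hq1, hκ, hpp]; field_simp
      have e2 : q * (1 / p') = 1 - θ := by
        have := hpq.symm.ne_zero
        rw [hqdef]; field_simp
      rw [e1, e2, ENNReal.rpow_mul, ← hNU, hvol] at h3
      have hN0 : N x₀ R ^ (1 / p) ≠ 0 := by
        rw [Ne, ENNReal.rpow_eq_zero_iff_of_pos (by positivity)]
        exact (hNpos x₀ R hR0).1
      have hNt : N x₀ R ^ (1 / p) ≠ ∞ :=
        ENNReal.rpow_ne_top_of_nonneg (by positivity) (hNpos x₀ R hR0).2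
      rw [ENNReal.rpow_neg, ← div_eq_mul_inv]
      exact (ENNReal.le_div_iff_mul_le (Or.inl hN0) (Or.inl hNt)).2 h3
    have hRR0 : ENNReal.ofReal R ≠ 0 := by simpa using hR0
    -- The scaling of `Ω` in `L_s` and that of the volume combine to exactly `R^n`, which later
    -- cancels `|x - y|⁻ⁿ`.
    have hRpow : ENNReal.ofReal R ^ (n * θ) * (ENNReal.ofReal R ^ n) ^ (1 - θ) =
        ENNReal.ofReal R ^ n := by
      rw [← ENNReal.rpow_natCast, ← ENNReal.rpow_mul,
        ← ENNReal.rpow_add _ _ hRR0 ENNReal.ofReal_ne_top]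
      congr 1; ring
    have hωR' : ωR = 2 ^ (n * θ) * ENNReal.ofReal R ^ (n * θ) * ω := by
      rw [hωR, hΩ.eLpNorm_ball (by positivity), ENNReal.ofReal_mul zero_le_two,
        ENNReal.mul_rpow_of_nonneg _ _ (by positivity), ENNReal.ofReal_ofNat]
    calc _ ≤ _ := hmain
      _ ≤ ωR * (J₁ * m) * N x₀ r ^ (1 / p) * (F * VR ^ (1 / p')) +
          ωR * N x₀ r ^ (1 / p) * (F * (J₂ * (k + 1) * m * VR ^ (1 / p'))) := by gcongr
      _ = (J₁ + J₂ * (k + 1)) * ωR * m * N x₀ r ^ (1 / p) * F * VR ^ (1 / p') := by ring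
      _ ≤ (J₁ * (k + 1) + J₂ * (k + 1)) * ωR * m * N x₀ r ^ (1 / p) * F *
          ((CA : ℝ≥0∞) ^ (1 / p') * (ENNReal.ofReal R ^ n * v₁) ^ (1 - θ) *
            N x₀ R ^ (-(1 / p))) := by
          gcongr
          exact le_mul_of_one_le_right' le_add_self
      _ = G * m * (k + 1) * (ENNReal.ofReal R ^ (n * θ) * (ENNReal.ofReal R ^ n) ^ (1 - θ)) *
          N x₀ r ^ (1 / p) * N x₀ R ^ (-(1 / p)) * F := by
          rw [hωR', hG, ENNReal.mul_rpow_of_nonneg _ _ h1θ.le]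
          ring
      _ = _ := by rw [hRpow]

end KernelBound

/-! ### Translation of BMO functions and differences `b(x) - b(x-z)`. -/

section Translation

variable {𝕜 : Type*} [RCLike 𝕜] {n : ℕ}

theorem preimage_sub_right_ball (x z : EuclideanSpace ℝ (Fin n)) (r : ℝ) :
    (fun y => y - z) ⁻¹' ball (x - z) r = ball x r := by
  ext y
  simp [dist_eq_norm]

theorem lintegral_ball_sub_right (g : EuclideanSpace ℝ (Fin n) → ℝ≥0∞)
    (x z : EuclideanSpace ℝ (Fin n)) (r : ℝ) :
    ∫⁻ y in ball x r, g (y - z) = ∫⁻ y in ball (x - z) r, g y := by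
  rw [← preimage_sub_right_ball x z r]
  exact (measurePreserving_sub_right volume z).setLIntegral_comp_preimage_emb
    (MeasurableEquiv.subRight z).measurableEmbedding g _

theorem average_ball_sub_right (b : EuclideanSpace ℝ (Fin n) → 𝕜)
    (x z : EuclideanSpace ℝ (Fin n)) (r : ℝ) :
    ⨍ y in ball x r, b (y - z) = ⨍ y in ball (x - z) r, b y := by
  have hmp := measurePreserving_sub_right (volume : Measure (EuclideanSpace ℝ (Fin n))) z
  have hemb := (MeasurableEquiv.subRight z).measurableEmbedding
  rw [setAverage_eq, setAverage_eq, ← preimage_sub_right_ball x z r]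
  congr 1
  · rw [measureReal_def, measureReal_def, hmp.measure_preimage measurableSet_ball.nullMeasurableSet]
  · exact hmp.setIntegral_preimage_emb hemb b _

theorem bmoSeminorm_sub_right_le (b : EuclideanSpace ℝ (Fin n) → 𝕜)
    (z : EuclideanSpace ℝ (Fin n)) : bmoSeminorm (fun y => b (y - z)) ≤ bmoSeminorm b := by
  refine iSup₂_le fun x r => iSup_le fun hr => ?_
  refine le_trans (le_of_eq ?_) (le_iSup₂_of_le (x - z) r (le_iSup_of_le hr le_rfl))
  rw [setLAverage_eq, setLAverage_eq, average_ball_sub_right,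
    lintegral_ball_sub_right (fun y => ‖b y - ⨍ u in ball (x - z) r, b u‖ₑ)]
  congr 1
  rw [← preimage_sub_right_ball x z r]
  exact (measurePreserving_sub_right volume z).measure_preimage
    measurableSet_ball.nullMeasurableSet

theorem IsBMO.sub_right {b : EuclideanSpace ℝ (Fin n) → 𝕜} (hb : IsBMO b)
    (z : EuclideanSpace ℝ (Fin n)) : IsBMO fun y => b (y - z) := by
  refine ⟨fun x => ?_, (bmoSeminorm_sub_right_le b z).trans_lt hb.2⟩
  refine ⟨ball x 1, ball_mem_nhds x one_pos, ?_⟩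
  rw [← preimage_sub_right_ball x z 1]
  exact ((measurePreserving_sub_right volume z).integrableOn_comp_preimage
    (MeasurableEquiv.subRight z).measurableEmbedding).2 (integrableOn_ball hb.1 _ _)

variable {q : ℝ} {C : ℝ≥0} {μ : Measure (EuclideanSpace ℝ (Fin n))}

/-- The weighted `L_σ` modulus of continuity of a function of bounded mean oscillation. -/
theorem exists_lintegral_rpow_sub_translate_le (hn : 1 ≤ n) (hμ : HasAveragingBound q C μ)
    {σ : ℝ} (hσ : 1 ≤ σ) :
    ∃ C' : ℝ≥0, ∀ b : EuclideanSpace ℝ (Fin n) → 𝕜, IsBMO b →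
      ∀ (x₀ : EuclideanSpace ℝ (Fin n)) (r : ℝ), 0 < r → ∀ k : ℕ,
      ∀ z ∈ ball (0 : EuclideanSpace ℝ (Fin n)) (2 * (2 ^ k * r)),
      ∫⁻ x in ball x₀ r, ‖b x - b (x - z)‖ₑ ^ σ ∂μ ≤
        (C' * (k + 1) * bmoSeminorm b) ^ σ * μ (ball x₀ r) := by
  have hσ0 : 0 < σ := by linarith
  obtain ⟨C', hC'⟩ := exists_lintegral_rpow_sub_average_le (𝕜 := 𝕜) hn hμ hσ0
  refine ⟨2 * C' + 4 * 2 ^ n, fun b hb x₀ r hr k z hz => ?_⟩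
  set B := ball x₀ r
  set b' : EuclideanSpace ℝ (Fin n) → 𝕜 := fun y => b (y - z)
  have hb' : IsBMO b' := hb.sub_right z
  set β := ⨍ y in B, b y
  set β' := ⨍ y in B, b' y
  set m := bmoSeminorm b
  have hm : bmoSeminorm b' ≤ m := bmoSeminorm_sub_right_le b z
  have hmeas : ∀ {c : EuclideanSpace ℝ (Fin n) → 𝕜} (d : 𝕜), IsBMO c →
      AEMeasurable (fun y => ‖c y - d‖ₑ) (μ.restrict B) := fun d hc =>
    ((hc.1.aestronglyMeasurable.sub aestronglyMeasurable_const).enorm.mono_ac hμ.ac).restrict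
  -- John–Nirenberg is used for `b` and for its translate over the same ball `B`, so the weight is
  -- never translated.
  have hnorm : ∀ {c : EuclideanSpace ℝ (Fin n) → 𝕜}, IsBMO c → bmoSeminorm c ≤ m →
      (∫⁻ y in B, ‖c y - ⨍ u in B, c u‖ₑ ^ σ ∂μ) ^ (1 / σ) ≤ C' * m * μ B ^ (1 / σ) := by
    intro c hc hcm
    have h : ∫⁻ y in B, ‖c y - ⨍ u in B, c u‖ₑ ^ σ ∂μ ≤ (C' * m) ^ σ * μ B :=
      (hC' c hc x₀ r hr).trans (by gcongr)
    refine (ENNReal.rpow_le_rpow h (by positivity)).trans (le_of_eq ?_)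
    rw [ENNReal.mul_rpow_of_nonneg _ _ (by positivity), ← ENNReal.rpow_mul,
      mul_one_div_cancel hσ0.ne', ENNReal.rpow_one]
  -- `β'` is the mean of `b` over `B(x₀ - z, r)`. Enlarge this ball `k + 1` times by doubling and
  -- `B(x₀, r)` itself `k + 2` times. As `|z| < 2^(k+1) r`, the first enlarged ball lies in the
  -- second, so one more comparison suffices: `2k + 4 ≤ 4(k + 1)` steps.
  have hββ : ‖β - β'‖ₑ ≤ 4 * 2 ^ n * (k + 1) * m := by
    have e : β' = ⨍ y in ball (x₀ - z) r, b y := average_ball_sub_right b x₀ z r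
    set γ := ⨍ y in ball x₀ (2 ^ (k + 2) * r), b y
    set γ' := ⨍ y in ball (x₀ - z) (2 ^ (k + 1) * r), b y
    have h1 : ‖β - γ‖ₑ ≤ (k + 2 : ℕ) * (2 ^ n * m) := enorm_average_dyadic_sub_le hb.1 x₀ hr (k + 2)
    have h2 : ‖β' - γ'‖ₑ ≤ (k + 1 : ℕ) * (2 ^ n * m) := by
      rw [e]; exact enorm_average_dyadic_sub_le hb.1 (x₀ - z) hr (k + 1)
    have h3 : ‖γ' - γ‖ₑ ≤ 2 ^ n * m := by
      have e2 : (2 : ℝ) ^ (k + 2) * r = 2 * (2 ^ (k + 1) * r) := by ring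
      have := enorm_average_sub_average_le hb.1 (x := x₀ - z) (x' := x₀) (r := 2 ^ (k + 1) * r)
        (c := 2) (by positivity) two_pos (by
          refine ball_subset_ball' ?_
          rw [dist_eq_norm, sub_sub_cancel_left, norm_neg]
          rw [mem_ball_zero_iff] at hz
          have : (2 : ℝ) ^ (k + 1) * r = 2 * (2 ^ k * r) := by ring
          linarith)
      rw [← e2] at this
      refine this.trans (le_of_eq ?_)
      rw [ENNReal.ofReal_pow zero_le_two, ENNReal.ofReal_ofNat]
    have e3 : β - β' = (β - γ) + ((γ - γ') + (γ' - β')) := by ring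
    rw [e3]
    refine (enorm_add_le _ _).trans ((add_le_add h1 ((enorm_add_le _ _).trans
      (add_le_add ((enorm_sub_rev _ _).trans_le h3) ((enorm_sub_rev _ _).trans_le h2)))).trans ?_)
    calc ((k + 2 : ℕ) : ℝ≥0∞) * (2 ^ n * m) + (2 ^ n * m + (k + 1 : ℕ) * (2 ^ n * m))
        = ((2 * k + 4 : ℕ) : ℝ≥0∞) * (2 ^ n * m) := by push_cast; ring
      _ ≤ ((4 * (k + 1) : ℕ) : ℝ≥0∞) * (2 ^ n * m) := by
          gcongr
          omega
      _ = _ := by push_cast; ring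
  have htri : ∀ x, ‖b x - b (x - z)‖ₑ ≤ ‖b x - β‖ₑ + (‖b' x - β'‖ₑ + ‖β - β'‖ₑ) := by
    intro x
    have e : b x - b (x - z) = (b x - β) + (-(b' x - β') + (β - β')) := by
      simp only [b']; ring
    rw [e]
    refine (enorm_add_le _ _).trans ?_
    gcongr
    refine (enorm_add_le _ _).trans ?_
    rw [enorm_neg]
  have hfinal : (∫⁻ x in B, ‖b x - b (x - z)‖ₑ ^ σ ∂μ) ^ (1 / σ) ≤
      ((2 * C' + 4 * 2 ^ n : ℝ≥0) * (k + 1) * m) * μ B ^ (1 / σ) := by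
    calc (∫⁻ x in B, ‖b x - b (x - z)‖ₑ ^ σ ∂μ) ^ (1 / σ)
        ≤ (∫⁻ x in B, (‖b x - β‖ₑ + (‖b' x - β'‖ₑ + ‖β - β'‖ₑ)) ^ σ ∂μ) ^ (1 / σ) := by
          gcongr with x
          exact htri x
      _ ≤ (∫⁻ x in B, ‖b x - β‖ₑ ^ σ ∂μ) ^ (1 / σ) +
          (∫⁻ x in B, (‖b' x - β'‖ₑ + ‖β - β'‖ₑ) ^ σ ∂μ) ^ (1 / σ) :=
          ENNReal.lintegral_Lp_add_le (f := fun x => ‖b x - β‖ₑ)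
            (g := fun x => ‖b' x - β'‖ₑ + ‖β - β'‖ₑ) (hmeas β hb)
            ((hmeas β' hb').add aemeasurable_const) hσ
      _ ≤ (∫⁻ x in B, ‖b x - β‖ₑ ^ σ ∂μ) ^ (1 / σ) + ((∫⁻ x in B, ‖b' x - β'‖ₑ ^ σ ∂μ) ^ (1 / σ) +
          (∫⁻ _ in B, ‖β - β'‖ₑ ^ σ ∂μ) ^ (1 / σ)) := by
          gcongr
          exact ENNReal.lintegral_Lp_add_le (f := fun x => ‖b' x - β'‖ₑ)
            (g := fun _ => ‖β - β'‖ₑ) (hmeas β' hb') aemeasurable_const hσ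
      _ ≤ C' * m * μ B ^ (1 / σ) + (C' * m * μ B ^ (1 / σ) +
          4 * 2 ^ n * (k + 1) * m * μ B ^ (1 / σ)) := by
          refine add_le_add (hnorm hb le_rfl) (add_le_add (hnorm hb' hm) ?_)
          rw [setLIntegral_const, ENNReal.mul_rpow_of_nonneg _ _ (by positivity),
            ← ENNReal.rpow_mul, mul_one_div_cancel hσ0.ne', ENNReal.rpow_one]
          gcongr
      _ = (2 * C' * m + 4 * 2 ^ n * (k + 1) * m) * μ B ^ (1 / σ) := by ring
      _ ≤ (2 * C' * (k + 1) * m + 4 * 2 ^ n * (k + 1) * m) * μ B ^ (1 / σ) := by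
          refine mul_le_mul_left (add_le_add (mul_le_mul_left ?_ _) le_rfl) _
          exact le_mul_of_one_le_right' le_add_self
      _ = _ := by push_cast; ring
  rw [one_div, ENNReal.rpow_inv_le_iff hσ0, ENNReal.mul_rpow_of_nonneg _ _ hσ0.le,
    ← ENNReal.rpow_mul, inv_mul_cancel₀ hσ0.ne', ENNReal.rpow_one] at hfinal
  exact hfinal

end Translation

/-! ### The kernel bound for `w ∈ A_{p/s'}` and finite `s`. -/

section DirectKernelBound

variable {𝕜 : Type*} [RCLike 𝕜] {n : ℕ}

theorem lintegral_ball_le_lintegral_sub_left {x₀ x : EuclideanSpace ℝ (Fin n)} {r R : ℝ}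
    (hrR : r ≤ R) (hx : x ∈ ball x₀ r) (g : EuclideanSpace ℝ (Fin n) → ℝ≥0∞) :
    ∫⁻ y in ball x₀ R, g y ≤ ∫⁻ z in ball 0 (2 * R), g (x - z) := by
  rw [← lintegral_indicator measurableSet_ball, ← lintegral_indicator measurableSet_ball]
  rw [← lintegral_sub_left_eq_self ((ball 0 (2 * R)).indicator fun z => g (x - z)) x]
  refine lintegral_mono fun y => ?_
  by_cases hy : y ∈ ball x₀ R
  · rw [indicator_of_mem hy, indicator_of_mem (sub_mem_ball_zero hrR hx hy), sub_sub_cancel]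
  · rw [indicator_of_notMem hy]; exact zero_le

/-- Hölder in `y` puts `f` in `L_{s'}`, where the averaging bound of order `p/s'` applies to
`f^(s')`. The other factor is `H^(1/s)`; its `L_p(w)` norm is estimated by averaging the differences
`b(x) - b(x-z)` against `|Ω(z)|^s dz`. -/
theorem hasCommutatorKernelBound_of_muckenhoupt (hn : 1 ≤ n) {p : ℝ} (hp : 1 < p) {s : ℝ≥0∞}
    (hs : 1 < s) (hst : s ≠ ∞) {Ω : EuclideanSpace ℝ (Fin n) → 𝕜} (hΩ : IsRoughKernel s Ω)
    {w : EuclideanSpace ℝ (Fin n) → ℝ}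
    (hA : IsMuckenhoupt (p / (ENNReal.conjExponent s).toReal) w) :
    HasCommutatorKernelBound p w Ω fun x t => weightMeasure w (ball x t) := by
  have hp0 : 0 < p := by linarith
  have hθ1 := ENNReal.toReal_inv_lt_one hs
  set S := s.toReal with hS
  have hS1 : 1 < S := by
    have := (ENNReal.toReal_lt_toReal ENNReal.one_ne_top hst).2 hs
    simpa using this
  have hS0 : 0 < S := by linarith
  have hSS := Real.HolderConjugate.conjExponent hS1
  have hθ : s⁻¹.toReal = 1 / S := by rw [ENNReal.toReal_inv, one_div]
  have hS' : 1 / (1 - s⁻¹.toReal) = S.conjExponent := by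
    have : S - 1 ≠ 0 := by linarith
    rw [hθ, Real.conjExponent]; field_simp
  have h1θ : 1 / S.conjExponent = 1 - s⁻¹.toReal := by rw [← hS', one_div_one_div]
  rw [ENNReal.conjExponent_toReal_eq hs, hS'] at hA
  set S' := S.conjExponent
  set θ := s⁻¹.toReal
  have hθp : 0 < 1 - θ := by linarith
  set q := p / S' with hq
  have hqp : S' * q = p := by
    have := hSS.symm.ne_zero
    rw [hq]; field_simp
  have hqp' : q * (1 / p) = 1 - θ := by rw [← h1θ, hq]; field_simp
  obtain ⟨CA, hCA⟩ := hA.exists_hasAveragingBound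
  have hw := hA.1
  obtain ⟨J, hJ⟩ := exists_lintegral_rpow_sub_translate_le (𝕜 := 𝕜) hn hCA (σ := S * p)
    (by nlinarith)
  have hΩm := hΩ.aestronglyMeasurable hn
  set ω := eLpNorm Ω s (volume.restrict (ball 0 1)) with hω
  have hωt : ω ≠ ∞ := (hΩ.memLp_unit_ball hn).2.ne
  set v₁ := volume (ball (0 : EuclideanSpace ℝ (Fin n)) 1) with hv₁
  have hv₁t : v₁ ≠ ∞ := measure_ball_lt_top.ne
  set G : ℝ≥0∞ := J * (2 ^ (n * θ) * ω) * ((CA : ℝ≥0∞) ^ (1 / p) * v₁ ^ (1 - θ)) with hG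
  have hθ0 : 0 ≤ θ := ENNReal.toReal_nonneg
  have hGt : G ≠ ∞ := by
    refine ENNReal.mul_ne_top (ENNReal.mul_ne_top (by simp) (ENNReal.mul_ne_top ?_ hωt))
      (ENNReal.mul_ne_top ?_ ?_)
    · exact ENNReal.rpow_ne_top_of_nonneg (by positivity) (by simp)
    · exact ENNReal.rpow_ne_top_of_nonneg (by positivity) (by simp)
    · exact ENNReal.rpow_ne_top_of_nonneg hθp.le hv₁t
  refine ⟨G.toNNReal, fun b hb x₀ r hr k f hf => ?_⟩
  rw [ENNReal.coe_toNNReal hGt]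
  set R := 2 ^ k * r with hR
  have hR0 : 0 < R := by positivity
  have hrR : r ≤ R := le_mul_of_one_le_left hr.le (one_le_pow₀ one_le_two)
  set m := bmoSeminorm b
  set μ := weightMeasure w
  set ωR := eLpNorm Ω s (volume.restrict (ball 0 (2 * R))) with hωR
  have hbm := hb.1.aestronglyMeasurable
  have hac := ac_prod_restrict (weightMeasure_ac w) (ball x₀ r) (ball 0 (2 * R))
  set H : EuclideanSpace ℝ (Fin n) → ℝ≥0∞ := fun x =>
    ∫⁻ z in ball 0 (2 * R), ‖b x - b (x - z)‖ₑ ^ S * ‖Ω z‖ₑ ^ S with hH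
  have hK : AEMeasurable (fun z : EuclideanSpace ℝ (Fin n) × EuclideanSpace ℝ (Fin n) =>
      ‖b z.1 - b (z.1 - z.2)‖ₑ ^ S) ((μ.restrict (ball x₀ r)).prod
        (volume.restrict (ball 0 (2 * R)))) := by
    refine AEMeasurable.mono_ac ?_ hac
    refine AEMeasurable.pow_const ?_ S
    exact ((hbm.comp_fst (ν := volume)).sub (hbm.comp_quasiMeasurePreserving
      (quasiMeasurePreserving_sub volume volume))).enorm
  have hΩS : AEMeasurable (fun z => ‖Ω z‖ₑ ^ S) (volume.restrict (ball 0 (2 * R))) :=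
    (hΩm.enorm.pow_const S).restrict
  have hΩint : ∫⁻ z in ball 0 (2 * R), ‖Ω z‖ₑ ^ S = ωR ^ S := by
    rw [hωR, eLpNorm_eq_lintegral_rpow_enorm_toReal (by positivity) hst, ← ENNReal.rpow_mul,
      one_div_mul_cancel hS0.ne', ENNReal.rpow_one]
  have hHm : AEMeasurable H (μ.restrict (ball x₀ r)) :=
    (hK.mul ((hΩS.comp_snd (μ := μ.restrict (ball x₀ r))))).lintegral_prod_right'
  -- The Schur bound with `|Ω|^s` as the function and `|b(x) - b(x-z)|^s` as the kernel: only a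
  -- bound in `x`, uniform in `z`, is required, so no integrability of `Ω` beyond `L_s` enters.
  have hHp : ∫⁻ x in ball x₀ r, H x ^ p ∂μ ≤
      (ωR ^ S) ^ p * ((J * (k + 1) * m) ^ (S * p) * μ (ball x₀ r)) := by
    rw [← hΩint]
    refine lintegral_lintegral_mul_rpow_le (K := fun x z => ‖b x - b (x - z)‖ₑ ^ S) hp hK hΩS ?_
    refine (ae_restrict_iff' measurableSet_ball).2 (Filter.Eventually.of_forall fun z hz => ?_)
    simp only [← ENNReal.rpow_mul]
    exact hJ b hb x₀ r hr k z hz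
  set Φ := (∫⁻ y in ball x₀ R, f y ^ S') ^ (1 / S')
  set F := (∫⁻ y in ball x₀ R, f y ^ p ∂μ) ^ (1 / p)
  have hpoint : ∀ x ∈ ball x₀ r, ∫⁻ y in ball x₀ R, ‖b x - b y‖ₑ * ‖Ω (x - y)‖ₑ * f y ≤
      Φ * H x ^ (1 / S) := by
    intro x hx
    have hΩx : AEMeasurable (fun y => ‖Ω (x - y)‖ₑ) :=
      (hΩm.comp_measurePreserving (Measure.measurePreserving_sub_left volume x)).enorm
    have hbx : AEMeasurable (fun y => ‖b x - b y‖ₑ) :=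
      (aestronglyMeasurable_const.sub hbm).enorm
    have h := ENNReal.lintegral_mul_le_Lp_mul_Lq (volume.restrict (ball x₀ R)) hSS
      (f := fun y => ‖b x - b y‖ₑ * ‖Ω (x - y)‖ₑ) (g := f) (hbx.mul hΩx).restrict hf.restrict
    refine h.trans ?_
    rw [mul_comm]
    gcongr
    refine (lintegral_ball_le_lintegral_sub_left hrR hx _).trans (le_of_eq ?_)
    rw [hH]
    refine lintegral_congr fun z => ?_
    rw [sub_sub_cancel, ENNReal.mul_rpow_of_nonneg _ _ hS0.le]
  have hHn : (∫⁻ x in ball x₀ r, (H x ^ (1 / S)) ^ p ∂μ) ^ (1 / p) ≤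
      ωR * (J * (k + 1) * m) * μ (ball x₀ r) ^ (1 / p) := by
    -- The bound at hand is for `∫ H^p`; Jensen on the ball, with density `1`, lowers the exponent
    -- from `p` to `p/s`.
    have h := lintegral_mul_rpow_le (ν := μ.restrict (ball x₀ r)) hS1
      (K := fun x => (H x ^ (1 / S)) ^ p) (g := fun _ => 1)
      ((hHm.pow_const _).pow_const _) aemeasurable_const
    simp only [mul_one, setLIntegral_const, one_mul] at h
    have e : ∀ x, ((H x ^ (1 / S)) ^ p) ^ S = H x ^ p := by
      intro x
      rw [← ENNReal.rpow_mul, ← ENNReal.rpow_mul]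
      congr 1
      field_simp
    simp only [e] at h
    have h2 : (∫⁻ x in ball x₀ r, (H x ^ (1 / S)) ^ p ∂μ) ^ S ≤
        (ωR ^ p * (J * (k + 1) * m) ^ p * μ (ball x₀ r)) ^ S := by
      refine h.trans ((mul_le_mul_right hHp _).trans (le_of_eq ?_))
      rw [ENNReal.mul_rpow_of_nonneg (ωR ^ p * _) _ hS0.le,
        ENNReal.mul_rpow_of_nonneg (ωR ^ p) _ hS0.le]
      simp only [← ENNReal.rpow_mul]
      rw [mul_comm p S]
      have e2 : μ (ball x₀ r) ^ S = μ (ball x₀ r) ^ (S - 1) * μ (ball x₀ r) := by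
        conv_lhs => rw [show S = (S - 1) + 1 by ring]
        rw [ENNReal.rpow_add_of_nonneg _ _ (by linarith) zero_le_one, ENNReal.rpow_one]
      rw [e2]
      ring
    have h3 := (ENNReal.rpow_le_rpow_iff hS0).1 h2
    refine (ENNReal.rpow_le_rpow h3 (by positivity)).trans (le_of_eq ?_)
    rw [ENNReal.mul_rpow_of_nonneg _ _ (by positivity), ENNReal.mul_rpow_of_nonneg _ _
      (by positivity), ← ENNReal.rpow_mul, ← ENNReal.rpow_mul, mul_one_div_cancel hp0.ne',
      ENNReal.rpow_one, ENNReal.rpow_one]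
  have hΦ : Φ ≤ (CA : ℝ≥0∞) ^ (1 / p) * (ENNReal.ofReal R ^ n * v₁) ^ (1 - θ) *
      μ (ball x₀ R) ^ (-(1 / p)) * F := by
    have hp0' : 0 ≤ 1 / p := by positivity
    have h1 := ENNReal.rpow_le_rpow
      (hCA.bound x₀ R hR0 (fun y => f y ^ S') (hf.pow_const _).restrict) hp0'
    simp only [← ENNReal.rpow_mul, hqp] at h1
    rw [ENNReal.mul_rpow_of_nonneg _ _ hp0', ENNReal.mul_rpow_of_nonneg _ _ hp0',
      ENNReal.mul_rpow_of_nonneg _ _ hp0', ← ENNReal.rpow_mul, ← ENNReal.rpow_mul, hqp', ← h1θ] at h1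
    have hvol : volume (ball x₀ R) = ENNReal.ofReal R ^ n * v₁ := by
      rw [Measure.addHaar_ball_of_pos volume x₀ hR0, finrank_euclideanSpace_fin,
        ENNReal.ofReal_pow hR0.le]
    rw [hvol, h1θ] at h1
    have hm0 : μ (ball x₀ R) ≠ 0 := by
      simp only [μ, weightMeasure, withDensity_ball]
      exact hw.lintegral_ball_ne_zero x₀ hR0
    have hN0 : μ (ball x₀ R) ^ (1 / p) ≠ 0 := by
      rw [Ne, ENNReal.rpow_eq_zero_iff_of_pos (by positivity)]
      exact hm0
    have hNt : μ (ball x₀ R) ^ (1 / p) ≠ ∞ :=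
      ENNReal.rpow_ne_top_of_nonneg (by positivity) (hCA.ball_lt_top x₀ R hR0).ne
    rw [ENNReal.rpow_neg, mul_right_comm, ← div_eq_mul_inv]
    simp only [Φ, h1θ]
    exact (ENNReal.le_div_iff_mul_le (Or.inl hN0) (Or.inl hNt)).2 h1
  have hRR0 : ENNReal.ofReal R ≠ 0 := by simpa using hR0
  have hRpow : ENNReal.ofReal R ^ (n * θ) * (ENNReal.ofReal R ^ n) ^ (1 - θ) =
      ENNReal.ofReal R ^ n := by
    rw [← ENNReal.rpow_natCast, ← ENNReal.rpow_mul,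
      ← ENNReal.rpow_add _ _ hRR0 ENNReal.ofReal_ne_top]
    congr 1; ring
  have hωR' : ωR = 2 ^ (n * θ) * ENNReal.ofReal R ^ (n * θ) * ω := by
    rw [hωR, hΩ.eLpNorm_ball (by positivity), ENNReal.ofReal_mul zero_le_two,
      ENNReal.mul_rpow_of_nonneg _ _ (by positivity), ENNReal.ofReal_ofNat]
  calc (∫⁻ x in ball x₀ r, (∫⁻ y in ball x₀ R, ‖b x - b y‖ₑ * ‖Ω (x - y)‖ₑ * f y) ^ p ∂μ) ^ (1 / p)
      ≤ (∫⁻ x in ball x₀ r, (Φ * H x ^ (1 / S)) ^ p ∂μ) ^ (1 / p) := by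
        refine ENNReal.rpow_le_rpow (lintegral_mono_ae ?_) (by positivity)
        refine (ae_restrict_iff' measurableSet_ball).2 (Filter.Eventually.of_forall fun x hx => ?_)
        exact ENNReal.rpow_le_rpow (hpoint x hx) hp0.le
    _ = Φ * (∫⁻ x in ball x₀ r, (H x ^ (1 / S)) ^ p ∂μ) ^ (1 / p) := by
        simp only [ENNReal.mul_rpow_of_nonneg _ _ hp0.le]
        rw [lintegral_const_mul'' _ ((hHm.pow_const _).pow_const _),
          ENNReal.mul_rpow_of_nonneg _ _ (by positivity), ← ENNReal.rpow_mul,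
          mul_one_div_cancel hp0.ne', ENNReal.rpow_one]
    _ ≤ ((CA : ℝ≥0∞) ^ (1 / p) * (ENNReal.ofReal R ^ n * v₁) ^ (1 - θ) *
        μ (ball x₀ R) ^ (-(1 / p)) * F) * (ωR * (J * (k + 1) * m) * μ (ball x₀ r) ^ (1 / p)) := by
        gcongr
    _ = G * m * (k + 1) * (ENNReal.ofReal R ^ (n * θ) * (ENNReal.ofReal R ^ n) ^ (1 - θ)) *
        μ (ball x₀ r) ^ (1 / p) * μ (ball x₀ R) ^ (-(1 / p)) * F := by
        rw [hωR', hG, ENNReal.mul_rpow_of_nonneg _ _ hθp.le]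
        ring
    _ = _ := by rw [hRpow]

end DirectKernelBound

/-! ### From dyadic sums to the logarithmic integral. -/

section Dyadic

variable {n : ℕ}

/-- Comparison of a dyadic sum with the logarithmic integral `∫_{2r}^∞ (1 + ln (t/r)) F N^{-1/p} dt/t`. -/
theorem tsum_dyadic_le_lintegral {p : ℝ} (hp : 0 < p) {N F : ℝ → ℝ≥0∞} {Cd : ℝ≥0} {r : ℝ}
    (hr : 0 < r) (hN : ∀ t, 0 < t → N t ≠ 0 ∧ N t ≠ ∞) (hdbl : ∀ t, 0 < t → N (2 * t) ≤ Cd * N t)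
    (hmono : Monotone N) (hF : Monotone F) :
    ∑' k : ℕ, ((k : ℝ≥0∞) + 2) * (N (2 ^ (k + 1) * r) ^ (-(1 / p)) * F (2 ^ (k + 1) * r)) ≤
      4 * (Cd : ℝ≥0∞) ^ (1 / p) * ∫⁻ t in Ioi (2 * r), ENNReal.ofReal (1 + Real.log (t / r)) *
        F t * N t ^ (-(1 / p)) * ENNReal.ofReal (1 / t) := by
  set Ψ : ℝ → ℝ≥0∞ := fun t => ENNReal.ofReal (1 + Real.log (t / r)) *
        F t * N t ^ (-(1 / p)) * ENNReal.ofReal (1 / t) with hΨ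
  set R : ℕ → ℝ := fun k => 2 ^ (k + 1) * r with hR
  have hR0 : ∀ k, 0 < R k := fun k => by positivity
  have hRs : ∀ k, R (k + 1) = 2 * R k := fun k => by simp only [hR]; ring
  have hRmono : Monotone R := monotone_nat_of_le_succ fun k => by
    rw [hRs]; linarith [hR0 k]
  have hdisj : Pairwise (Function.onFun Disjoint fun k => Ioc (R k) (R (k + 1))) :=
    hRmono.pairwise_disjoint_on_Ioc_succ
  have hterm : ∀ k : ℕ, ((k : ℝ≥0∞) + 2) * (N (R k) ^ (-(1 / p)) * F (R k)) ≤
      4 * (Cd : ℝ≥0∞) ^ (1 / p) * ∫⁻ t in Ioc (R k) (R (k + 1)), Ψ t := by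
    intro k
    have hRk := hR0 k
    -- A negative power of `N` is smallest at the right end of the interval, so doubling is used to
    -- move there before bounding the integrand from below.
    have hinv : N (R k) ^ (-(1 / p)) ≤ (Cd : ℝ≥0∞) ^ (1 / p) * N (R (k + 1)) ^ (-(1 / p)) := by
      have h1 := ENNReal.rpow_le_rpow (hdbl _ hRk) (one_div_pos.2 hp).le
      rw [← hRs, ENNReal.mul_rpow_of_nonneg _ _ (one_div_pos.2 hp).le] at h1
      rw [ENNReal.rpow_neg, ENNReal.rpow_neg]
      have hne : ∀ k, N (R k) ^ (1 / p) ≠ 0 ∧ N (R k) ^ (1 / p) ≠ ∞ := fun k =>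
        ⟨by rw [Ne, ENNReal.rpow_eq_zero_iff_of_pos (by positivity)]; exact (hN _ (hR0 k)).1,
          ENNReal.rpow_ne_top_of_nonneg (by positivity) (hN _ (hR0 k)).2⟩
      set a := N (R (k + 1)) ^ (1 / p)
      set c := N (R k) ^ (1 / p)
      have ha : a ≠ 0 ∧ a ≠ ∞ := hne (k + 1)
      have hc : c ≠ 0 ∧ c ≠ ∞ := hne k
      rw [← div_eq_mul_inv, ENNReal.le_div_iff_mul_le (Or.inl ha.1) (Or.inl ha.2)]
      calc c⁻¹ * a ≤ c⁻¹ * (Cd ^ (1 / p) * c) := by gcongr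
        _ = Cd ^ (1 / p) * (c⁻¹ * c) := by ring
        _ = _ := by rw [ENNReal.inv_mul_cancel hc.1 hc.2, mul_one]
    have hlow : ∀ t ∈ Ioc (R k) (R (k + 1)),
        ENNReal.ofReal ((k + 2) / 2) * F (R k) * N (R (k + 1)) ^ (-(1 / p)) *
          ENNReal.ofReal (1 / (2 * R k)) ≤ Ψ t := by
      intro t ht
      have ht0 : 0 < t := hRk.trans ht.1
      -- Here `t/r > 2^(k+1)` and `ln 2 > 1/2`.
      have hlog : ((k : ℝ) + 2) / 2 ≤ 1 + Real.log (t / r) := by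
        have h1 : Real.log (2 ^ (k + 1)) ≤ Real.log (t / r) := by
          refine Real.log_le_log (by positivity) ?_
          rw [le_div_iff₀ hr]
          exact ht.1.le
        rw [Real.log_pow] at h1
        have := Real.log_two_gt_d9
        push_cast at h1
        nlinarith
      simp only [hΨ]
      have h2 : N (R (k + 1)) ^ (-(1 / p)) ≤ N t ^ (-(1 / p)) := by
        rw [ENNReal.rpow_neg, ENNReal.rpow_neg, ENNReal.inv_le_inv]
        exact ENNReal.rpow_le_rpow (hmono ht.2) (by positivity)
      have h3 : (1 : ℝ) / (2 * R k) ≤ 1 / t := by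
        rw [← hRs]
        exact one_div_le_one_div_of_le ht0 ht.2
      gcongr
      exact hF ht.1.le
    have hint : ENNReal.ofReal ((k + 2) / 2) * F (R k) * N (R (k + 1)) ^ (-(1 / p)) *
          ENNReal.ofReal (1 / (2 * R k)) * ENNReal.ofReal (R k) ≤
        ∫⁻ t in Ioc (R k) (R (k + 1)), Ψ t := by
      have hvol : volume (Ioc (R k) (R (k + 1))) = ENNReal.ofReal (R k) := by
        rw [Real.volume_Ioc, hRs]; congr 1; ring
      rw [← hvol, ← setLIntegral_const]
      exact setLIntegral_mono' measurableSet_Ioc hlow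
    -- The factor `4` collects one `2` from the logarithm and one from `1/t ≥ 1/(2 R_k)` on an
    -- interval of length `R_k`.
    have e : ((k : ℝ≥0∞) + 2) = 4 * (ENNReal.ofReal ((k + 2) / 2) *
        (ENNReal.ofReal (1 / (2 * R k)) * ENNReal.ofReal (R k))) := by
      rw [← ENNReal.ofReal_mul (by positivity), ← ENNReal.ofReal_mul (by positivity)]
      have h4 : (4 : ℝ≥0∞) = ENNReal.ofReal 4 := by simp
      rw [h4, ← ENNReal.ofReal_mul (by positivity)]
      have h5 : (4 : ℝ) * ((k + 2) / 2 * (1 / (2 * R k) * R k)) = ((k + 2 : ℕ) : ℝ) := by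
        have := hRk.ne'
        push_cast
        field_simp
        ring
      rw [h5, ENNReal.ofReal_natCast]
      push_cast
      rfl
    calc ((k : ℝ≥0∞) + 2) * (N (R k) ^ (-(1 / p)) * F (R k))
        ≤ ((k : ℝ≥0∞) + 2) * ((Cd ^ (1 / p) * N (R (k + 1)) ^ (-(1 / p))) * F (R k)) := by gcongr
      _ = 4 * (Cd : ℝ≥0∞) ^ (1 / p) * (ENNReal.ofReal ((k + 2) / 2) * F (R k) *
          N (R (k + 1)) ^ (-(1 / p)) * ENNReal.ofReal (1 / (2 * R k)) * ENNReal.ofReal (R k)) := by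
          rw [e]; ring
      _ ≤ _ := by gcongr
  calc _ ≤ ∑' k, 4 * (Cd : ℝ≥0∞) ^ (1 / p) * ∫⁻ t in Ioc (R k) (R (k + 1)), Ψ t :=
        ENNReal.tsum_le_tsum hterm
    _ = 4 * (Cd : ℝ≥0∞) ^ (1 / p) * ∫⁻ t in ⋃ k, Ioc (R k) (R (k + 1)), Ψ t := by
        rw [ENNReal.tsum_mul_left, lintegral_iUnion (fun _ => measurableSet_Ioc) hdisj]
    _ ≤ _ := by
        gcongr
        refine iUnion_subset fun k t ht => ?_
        have : R 0 ≤ R k := hRmono (Nat.zero_le k)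
        have h0 : R 0 = 2 * r := by simp [hR]
        exact mem_Ioi.2 (by linarith [ht.1])

end Dyadic

/-! ### The far part through the size condition. -/

section FarPart

variable {𝕜 : Type*} [RCLike 𝕜] {n : ℕ}

/-- Dyadic decomposition of the size condition away from `B(x₀, 2r)`. -/
theorem lintegral_size_le_tsum (Ω b g : EuclideanSpace ℝ (Fin n) → 𝕜)
    {x₀ x : EuclideanSpace ℝ (Fin n)} {r : ℝ} (hr : 0 < r) (hx : x ∈ ball x₀ r)
    (hg : ∀ y ∈ ball x₀ (2 * r), g y = 0) :
    ∫⁻ y, ‖b x - b y‖ₑ * (‖Ω (x - y)‖ₑ / ‖x - y‖ₑ ^ n) * ‖g y‖ₑ ≤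
      ∑' k : ℕ, 4 ^ n * (ENNReal.ofReal (2 ^ (k + 1) * r) ^ n)⁻¹ *
        ∫⁻ y in ball x₀ (2 ^ (k + 1) * r), ‖b x - b y‖ₑ * ‖Ω (x - y)‖ₑ * ‖g y‖ₑ := by
  set J : EuclideanSpace ℝ (Fin n) → ℝ≥0∞ := fun y =>
    ‖b x - b y‖ₑ * (‖Ω (x - y)‖ₑ / ‖x - y‖ₑ ^ n) * ‖g y‖ₑ
  -- Removing `B(x₀, 2r)` as well gives `|y - x₀| ≥ 2r`, whence `|x - y| ≥ |y - x₀|/2 ≥ R/4` on the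
  -- `k`-th annulus.
  set U : ℕ → Set (EuclideanSpace ℝ (Fin n)) := fun k =>
    (ball x₀ (2 ^ (k + 1) * r) \ ball x₀ (2 ^ k * r)) \ ball x₀ (2 * r)
  have hUm : ∀ k, MeasurableSet (U k) := fun k =>
    (measurableSet_ball.diff measurableSet_ball).diff measurableSet_ball
  have hcover : (ball x₀ (2 * r))ᶜ ⊆ ⋃ k, U k := by
    intro y hy
    rw [mem_compl_iff, mem_ball, not_lt] at hy
    have hex : ∃ k : ℕ, dist y x₀ < 2 ^ k * r := by
      obtain ⟨k, hk⟩ := pow_unbounded_of_one_lt (dist y x₀ / r) one_lt_two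
      exact ⟨k, by rwa [div_lt_iff₀ hr] at hk⟩
    classical
    obtain ⟨j, hj⟩ : ∃ j, Nat.find hex = j + 1 := by
      refine Nat.exists_eq_succ_of_ne_zero fun h0 => ?_
      have := Nat.find_spec hex
      rw [h0, pow_zero, one_mul] at this
      linarith
    refine mem_iUnion.2 ⟨j, ⟨⟨?_, ?_⟩, ?_⟩⟩
    · have := Nat.find_spec hex
      rw [hj] at this
      exact this
    · exact Nat.find_min hex (by omega)
    · rw [mem_ball, not_lt]; exact hy
  have h1 : ∫⁻ y, J y = ∫⁻ y in (ball x₀ (2 * r))ᶜ, J y := by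
    rw [← lintegral_indicator measurableSet_ball.compl]
    refine lintegral_congr fun y => ?_
    by_cases hy : y ∈ ball x₀ (2 * r)
    · rw [indicator_of_notMem (by simpa using hy)]
      simp [J, hg y hy]
    · rw [indicator_of_mem hy]
  calc ∫⁻ y, J y ≤ ∫⁻ y in ⋃ k, U k, J y := h1.trans_le (lintegral_mono_set hcover)
    _ ≤ ∑' k, ∫⁻ y in U k, J y := lintegral_iUnion_le _ _
    _ ≤ _ := by
        refine ENNReal.tsum_le_tsum fun k => ?_
        set R := 2 ^ (k + 1) * r with hR
        have hR0 : 0 < R := by positivity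
        have hRn0 : ENNReal.ofReal R ^ n ≠ 0 := pow_ne_zero _ (by simpa using hR0)
        have hRnt : ENNReal.ofReal R ^ n ≠ ∞ := ENNReal.pow_ne_top ENNReal.ofReal_ne_top
        have hct : 4 ^ n * (ENNReal.ofReal R ^ n)⁻¹ ≠ ∞ :=
          ENNReal.mul_ne_top (by simp) (ENNReal.inv_ne_top.2 hRn0)
        rw [← lintegral_const_mul' _ _ hct]
        calc ∫⁻ y in U k, J y ≤ ∫⁻ y in U k, 4 ^ n * (ENNReal.ofReal R ^ n)⁻¹ *
              (‖b x - b y‖ₑ * ‖Ω (x - y)‖ₑ * ‖g y‖ₑ) := by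
              refine setLIntegral_mono' (hUm k) fun y hy => ?_
              obtain ⟨⟨-, hy1⟩, hy2⟩ := hy
              rw [mem_ball, not_lt] at hy1 hy2
              have hd : R / 4 ≤ ‖x - y‖ := by
                rw [← dist_eq_norm]
                rw [mem_ball] at hx
                have h3 := dist_triangle_left y x₀ x
                have h4 : R = 2 * (2 ^ k * r) := by rw [hR]; ring
                linarith
              have hd' : ENNReal.ofReal R ≤ 4 * ‖x - y‖ₑ := by
                rw [← ofReal_norm, ← ENNReal.ofReal_ofNat 4,
                  ← ENNReal.ofReal_mul (by norm_num)]
                exact ENNReal.ofReal_le_ofReal (by linarith)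
              have hxy0 : ‖x - y‖ₑ ^ n ≠ 0 := by
                refine pow_ne_zero _ fun h0 => ?_
                rw [h0, mul_zero, nonpos_iff_eq_zero, ENNReal.ofReal_eq_zero] at hd'
                linarith
              have hxyt : ‖x - y‖ₑ ^ n ≠ ∞ := ENNReal.pow_ne_top enorm_ne_top
              have hinv : (‖x - y‖ₑ ^ n)⁻¹ ≤ 4 ^ n * (ENNReal.ofReal R ^ n)⁻¹ := by
                rw [← div_eq_mul_inv, ENNReal.le_div_iff_mul_le (Or.inl hRn0) (Or.inl hRnt)]
                calc (‖x - y‖ₑ ^ n)⁻¹ * ENNReal.ofReal R ^ n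
                    ≤ (‖x - y‖ₑ ^ n)⁻¹ * (4 * ‖x - y‖ₑ) ^ n := by gcongr
                  _ = 4 ^ n * ((‖x - y‖ₑ ^ n)⁻¹ * ‖x - y‖ₑ ^ n) := by rw [mul_pow]; ring
                  _ = _ := by rw [ENNReal.inv_mul_cancel hxy0 hxyt, mul_one]
              simp only [J, div_eq_mul_inv]
              calc ‖b x - b y‖ₑ * (‖Ω (x - y)‖ₑ * (‖x - y‖ₑ ^ n)⁻¹) * ‖g y‖ₑ
                  = (‖x - y‖ₑ ^ n)⁻¹ * (‖b x - b y‖ₑ * ‖Ω (x - y)‖ₑ * ‖g y‖ₑ) := by ring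
                _ ≤ _ := by gcongr
          _ ≤ _ := lintegral_mono_set fun y hy => hy.1.1

theorem eLpNorm_ofReal_eq {α E : Type*} [MeasurableSpace α] [ENorm E] {p : ℝ} (hp : 0 < p)
    (f : α → E) (μ : Measure α) :
    eLpNorm f (ENNReal.ofReal p) μ = (∫⁻ x, ‖f x‖ₑ ^ p ∂μ) ^ (1 / p) := by
  rw [eLpNorm_eq_lintegral_rpow_enorm_toReal (by simpa using hp) ENNReal.ofReal_ne_top,
    ENNReal.toReal_ofReal hp.le]

/-- The estimate for functions vanishing on `B(x₀, 2r)` that satisfy the size condition. -/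
theorem eLpNorm_le_of_sizeCondition {p : ℝ} (hp : 1 < p)
    {w : EuclideanSpace ℝ (Fin n) → ℝ} {Ω : EuclideanSpace ℝ (Fin n) → 𝕜}
    (hΩ : AEStronglyMeasurable Ω volume) {N : EuclideanSpace ℝ (Fin n) → ℝ → ℝ≥0∞} {CK : ℝ≥0} {c₀ : ℝ≥0}
    {b : EuclideanSpace ℝ (Fin n) → 𝕜} (hb : IsBMO b)
    {T : (EuclideanSpace ℝ (Fin n) → 𝕜) → (EuclideanSpace ℝ (Fin n) → 𝕜)}
    {x₀ : EuclideanSpace ℝ (Fin n)} {r : ℝ} (hr : 0 < r)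
    (hK : ∀ (k : ℕ) (f : EuclideanSpace ℝ (Fin n) → ℝ≥0∞), AEMeasurable f →
      (∫⁻ x in ball x₀ r, (∫⁻ y in ball x₀ (2 ^ k * r), ‖b x - b y‖ₑ * ‖Ω (x - y)‖ₑ * f y) ^ p
        ∂(weightMeasure w)) ^ (1 / p) ≤
      CK * bmoSeminorm b * (k + 1) * ENNReal.ofReal (2 ^ k * r) ^ n * N x₀ r ^ (1 / p) *
        N x₀ (2 ^ k * r) ^ (-(1 / p)) *
        (∫⁻ y in ball x₀ (2 ^ k * r), f y ^ p ∂(weightMeasure w)) ^ (1 / p))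
    {f g : EuclideanSpace ℝ (Fin n) → 𝕜} (hf : AEStronglyMeasurable f volume)
    (hgf : ∀ y, ‖g y‖ₑ ≤ ‖f y‖ₑ) (hg : ∀ y ∈ ball x₀ (2 * r), g y = 0)
    (hsize : SizeConditionAt c₀ Ω b T g) :
    eLpNorm (T g) (ENNReal.ofReal p) ((weightMeasure w).restrict (ball x₀ r)) ≤
      c₀ * 4 ^ n * CK * bmoSeminorm b * N x₀ r ^ (1 / p) *
        ∑' k : ℕ, ((k : ℝ≥0∞) + 2) * (N x₀ (2 ^ (k + 1) * r) ^ (-(1 / p)) *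
          eLpNorm f (ENNReal.ofReal p)
            ((weightMeasure w).restrict (ball x₀ (2 ^ (k + 1) * r)))) := by
  have hp0 : 0 < p := by linarith
  set μ := weightMeasure w
  set I : ℕ → EuclideanSpace ℝ (Fin n) → ℝ≥0∞ := fun k x =>
    ∫⁻ y in ball x₀ (2 ^ (k + 1) * r), ‖b x - b y‖ₑ * ‖Ω (x - y)‖ₑ * ‖f y‖ₑ
  set a : ℕ → ℝ≥0∞ := fun k => c₀ * 4 ^ n * (ENNReal.ofReal (2 ^ (k + 1) * r) ^ n)⁻¹ with ha
  have hIm : ∀ k, AEMeasurable (I k) (μ.restrict (ball x₀ r)) := by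
    intro k
    have hac := ac_prod_restrict (weightMeasure_ac w) (ball x₀ r) (ball x₀ (2 ^ (k + 1) * r))
    have h : AEMeasurable (fun z : EuclideanSpace ℝ (Fin n) × EuclideanSpace ℝ (Fin n) =>
        ‖b z.1 - b z.2‖ₑ * ‖Ω (z.1 - z.2)‖ₑ * ‖f z.2‖ₑ) (volume.prod volume) :=
      (((hb.1.aestronglyMeasurable.comp_fst (ν := volume)).sub
        (hb.1.aestronglyMeasurable.comp_snd (μ := volume))).enorm.mul
        (aemeasurable_enorm_sub_prod hΩ)).mul (hf.enorm.comp_snd (μ := volume))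
    exact (h.mono_ac hac).lintegral_prod_right'
  have hsupp : tsupport g ⊆ (ball x₀ (2 * r))ᶜ := by
    refine closure_minimal (fun y hy hyB => hy (hg y hyB)) isOpen_ball.isClosed_compl
  have hpoint : ∀ᵐ x ∂(μ.restrict (ball x₀ r)), ‖T g x‖ₑ ≤ ∑' k, a k * I k x := by
    have h1 : ∀ᵐ x ∂(μ.restrict (ball x₀ r)), x ∉ tsupport g → ‖T g x‖ₑ ≤
        c₀ * ∫⁻ y, ‖b x - b y‖ₑ * (‖Ω (x - y)‖ₑ / ‖x - y‖ₑ ^ n) * ‖g y‖ₑ :=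
      ae_restrict_of_ae ((weightMeasure_ac w).ae_le hsize)
    filter_upwards [h1, ae_restrict_mem measurableSet_ball] with x hx hxB
    have hxs : x ∉ tsupport g := fun h =>
      hsupp h (ball_subset_ball (by linarith) hxB)
    refine (hx hxs).trans ?_
    refine (mul_le_mul_right (lintegral_size_le_tsum Ω b g hr hxB hg) _).trans ?_
    rw [← ENNReal.tsum_mul_left]
    refine ENNReal.tsum_le_tsum fun k => ?_
    simp only [ha, ← mul_assoc]
    simp only [I, mul_assoc]
    gcongr with y
    exact hgf y
  rw [eLpNorm_ofReal_eq hp0]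
  calc (∫⁻ x in ball x₀ r, ‖T g x‖ₑ ^ p ∂μ) ^ (1 / p)
      ≤ (∫⁻ x in ball x₀ r, (∑' k, a k * I k x) ^ p ∂μ) ^ (1 / p) := by
        refine ENNReal.rpow_le_rpow (lintegral_mono_ae ?_) (by positivity)
        filter_upwards [hpoint] with x hx using ENNReal.rpow_le_rpow hx hp0.le
    _ ≤ ∑' k, (∫⁻ x in ball x₀ r, (a k * I k x) ^ p ∂μ) ^ (1 / p) :=
        lintegral_tsum_rpow_le (f := fun k x => a k * I k x) hp.le fun k => (hIm k).const_mul _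
    _ ≤ ∑' k : ℕ, c₀ * 4 ^ n * CK * bmoSeminorm b * N x₀ r ^ (1 / p) *
          (((k : ℝ≥0∞) + 2) * (N x₀ (2 ^ (k + 1) * r) ^ (-(1 / p)) *
          eLpNorm f (ENNReal.ofReal p) (μ.restrict (ball x₀ (2 ^ (k + 1) * r))))) := by
        refine ENNReal.tsum_le_tsum fun k => ?_
        have e : (∫⁻ x in ball x₀ r, (a k * I k x) ^ p ∂μ) ^ (1 / p) =
            a k * (∫⁻ x in ball x₀ r, I k x ^ p ∂μ) ^ (1 / p) := by
          simp only [ENNReal.mul_rpow_of_nonneg _ _ hp0.le]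
          rw [lintegral_const_mul'' _ ((hIm k).pow_const p),
            ENNReal.mul_rpow_of_nonneg _ _ (by positivity), ← ENNReal.rpow_mul,
            mul_one_div_cancel hp0.ne', ENNReal.rpow_one]
        rw [e, eLpNorm_ofReal_eq hp0]
        refine (mul_le_mul_right (hK (k + 1) _ hf.enorm) _).trans (le_of_eq ?_)
        have hR0 : (0 : ℝ) < 2 ^ (k + 1) * r := by positivity
        have hRn0 : ENNReal.ofReal (2 ^ (k + 1) * r) ^ n ≠ 0 := pow_ne_zero _ (by simpa using hR0)
        have hRnt : ENNReal.ofReal (2 ^ (k + 1) * r) ^ n ≠ ∞ :=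
          ENNReal.pow_ne_top ENNReal.ofReal_ne_top
        simp only [ha]
        set ρ := ENNReal.ofReal (2 ^ (k + 1) * r) ^ n
        set P := N x₀ (2 ^ (k + 1) * r) ^ (-(1 / p))
        set F := (∫⁻ y in ball x₀ (2 ^ (k + 1) * r), ‖f y‖ₑ ^ p ∂μ) ^ (1 / p)
        have e2 : (((k + 1 : ℕ) : ℝ≥0∞) + 1) = k + 2 := by push_cast; ring
        rw [e2]
        calc c₀ * 4 ^ n * ρ⁻¹ * (CK * bmoSeminorm b * (k + 2) * ρ * N x₀ r ^ (1 / p) * P * F)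
            = c₀ * 4 ^ n * CK * bmoSeminorm b * N x₀ r ^ (1 / p) * ((k + 2) * (P * F)) *
              (ρ⁻¹ * ρ) := by ring
          _ = _ := by rw [ENNReal.inv_mul_cancel hRn0 hRnt, mul_one]
    _ = _ := by rw [ENNReal.tsum_mul_left]

end FarPart

/-! ### Near and far parts combined for a general operator. -/

section Reduction

variable {𝕜 : Type*} [RCLike 𝕜] {n : ℕ} {p : ℝ} {w : EuclideanSpace ℝ (Fin n) → ℝ}

theorem IsWeight.volume_ac (hw : IsWeight w) : volume ≪ weightMeasure w :=
  withDensity_absolutelyContinuous' hw.aemeasurable.ennreal_ofReal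
    (hw.2.mono fun x hx => by simpa using hx)

theorem MemLpWeightLoc.aestronglyMeasurable (hw : IsWeight w)
    {f : EuclideanSpace ℝ (Fin n) → 𝕜} (hf : MemLpWeightLoc p w f) :
    AEStronglyMeasurable f volume := by
  have h : AEStronglyMeasurable f ((weightMeasure w).restrict (⋃ k : ℕ, ball 0 ((k : ℝ) + 1))) :=
    (aestronglyMeasurable_iUnion_iff).2 fun k => (hf 0 (k + 1) (by positivity)).1
  rw [iUnion_ball_nat_succ, Measure.restrict_univ] at h
  exact h.mono_ac hw.volume_ac

theorem MemLpWeightLoc.memLpWeight_indicator_ball {f : EuclideanSpace ℝ (Fin n) → 𝕜}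
    (hf : MemLpWeightLoc p w f) (x : EuclideanSpace ℝ (Fin n)) {r : ℝ} (hr : 0 < r) :
    MemLpWeight p w ((ball x r).indicator f) :=
  (memLp_indicator_iff_restrict measurableSet_ball).2 (hf x r hr)

/-- Hölder against `w^(1-p')`. It makes truncations to balls integrable, so that the size condition
for integrable functions of compact support covers them. -/
theorem MemLpWeightLoc.integrableOn_ball (hw : IsWeight w) (hp : 1 < p)
    (hV : ∀ (x : EuclideanSpace ℝ (Fin n)) (r : ℝ), 0 < r →
      ∫⁻ y in ball x r, ENNReal.ofReal (w y ^ (1 - p.conjExponent)) < ∞)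
    {f : EuclideanSpace ℝ (Fin n) → 𝕜} (hf : MemLpWeightLoc p w f)
    (x : EuclideanSpace ℝ (Fin n)) {r : ℝ} (hr : 0 < r) : IntegrableOn f (ball x r) := by
  have hfm := hf.aestronglyMeasurable hw
  have hpq := Real.HolderConjugate.conjExponent hp
  refine ⟨hfm.restrict, ?_⟩
  rw [hasFiniteIntegral_iff_enorm]
  have h := hw.lintegral_mul_le hp x r hfm.enorm (aemeasurable_const (b := (1 : ℝ≥0∞)))
  simp only [one_mul, ENNReal.one_rpow] at h
  refine h.trans_lt (ENNReal.mul_lt_top ?_ ?_)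
  · rw [← eLpNorm_ofReal_eq (by linarith)]
    exact (hf x r hr).2
  · refine ENNReal.rpow_lt_top_of_nonneg (one_div_nonneg.2 hpq.symm.nonneg) ?_
    rw [setLIntegral_one, weightMeasure, withDensity_ball]
    exact (hV x r hr).ne

/-- Dominated convergence; with boundedness on `L_p(w)` it removes the truncation. -/
theorem MemLpWeight.tendsto_eLpNorm_sub_indicator_ball (hp : 0 < p)
    {f : EuclideanSpace ℝ (Fin n) → 𝕜} (hf : MemLpWeight p w f) (x : EuclideanSpace ℝ (Fin n)) :
    Filter.Tendsto (fun m : ℕ => eLpNorm (f - (ball x m).indicator f) (ENNReal.ofReal p)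
      (weightMeasure w)) Filter.atTop (nhds 0) := by
  simp only [eLpNorm_ofReal_eq hp]
  have h0 : (0 : ℝ≥0∞) = 0 ^ (1 / p) := by
    rw [ENNReal.zero_rpow_of_pos (by positivity)]
  rw [h0]
  refine Filter.Tendsto.ennrpow_const _ ?_
  have hz : (0 : ℝ≥0∞) = ∫⁻ _, 0 ∂(weightMeasure w) := by simp
  rw [hz]
  refine tendsto_lintegral_of_dominated_convergence' (fun y => ‖f y‖ₑ ^ p) (fun m => ?_)
    (fun m => ?_) ?_ ?_
  · exact ((hf.1.sub (hf.1.indicator measurableSet_ball)).enorm).pow_const p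
  · refine Filter.Eventually.of_forall fun y => ?_
    refine ENNReal.rpow_le_rpow ?_ hp.le
    by_cases hy : y ∈ ball x (m : ℝ) <;> simp [hy]
  · have := hf.2
    rw [eLpNorm_ofReal_eq hp] at this
    exact ((ENNReal.rpow_lt_top_iff_of_pos (by positivity)).1 this).ne
  · refine Filter.Eventually.of_forall fun y => ?_
    obtain ⟨M, hM⟩ := exists_nat_gt (dist y x)
    refine tendsto_const_nhds.congr' ?_
    filter_upwards [Filter.eventually_ge_atTop M] with m hm
    have hy : y ∈ ball x (m : ℝ) := hM.trans_le (Nat.cast_le.2 hm)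
    simp [hy, hp]

theorem IsSublinearOn.eLpNorm_le_add {D : Submodule 𝕜 (EuclideanSpace ℝ (Fin n) → 𝕜)}
    {T : (EuclideanSpace ℝ (Fin n) → 𝕜) → (EuclideanSpace ℝ (Fin n) → 𝕜)}
    (hT : IsSublinearOn D T) (hp : 1 ≤ p) {f g : EuclideanSpace ℝ (Fin n) → 𝕜}
    (hf : f ∈ D) (hg : g ∈ D) (x : EuclideanSpace ℝ (Fin n)) (r : ℝ) :
    eLpNorm (T (f + g)) (ENNReal.ofReal p) ((weightMeasure w).restrict (ball x r)) ≤
      eLpNorm (T f) (ENNReal.ofReal p) ((weightMeasure w).restrict (ball x r)) +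
        eLpNorm (T g) (ENNReal.ofReal p) ((weightMeasure w).restrict (ball x r)) := by
  have hac : (weightMeasure w).restrict (ball x r) ≪ volume :=
    Measure.restrict_le_self.absolutelyContinuous.trans (weightMeasure_ac w)
  have h := eLpNorm_add_le (p := ENNReal.ofReal p)
    ((hT.aestronglyMeasurable f hf).mono_ac hac).norm
    ((hT.aestronglyMeasurable g hg).mono_ac hac).norm (by simpa using hp)
  rw [eLpNorm_norm, eLpNorm_norm] at h
  refine le_trans (eLpNorm_mono_ae ?_) h
  filter_upwards [hac.ae_le (hT.add_le f hf g hg)] with y hy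
  exact hy.trans (le_abs_self _)

/-- The local estimate for a commutator-type operator, derived from the kernel bound. -/
theorem exists_eLpNorm_commutator_le (hp : 1 < p) (hw : IsWeight w)
    {Ω : EuclideanSpace ℝ (Fin n) → 𝕜} (hΩ : AEStronglyMeasurable Ω volume)
    {N : EuclideanSpace ℝ (Fin n) → ℝ → ℝ≥0∞}
    (hdbl : ∃ C : ℝ≥0, ∀ (x : EuclideanSpace ℝ (Fin n)) (r : ℝ), 0 < r → N x (2 * r) ≤ C * N x r)
    (hN : ∀ (x : EuclideanSpace ℝ (Fin n)) (r : ℝ), 0 < r → N x r ≠ 0 ∧ N x r ≠ ∞)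
    (hmono : ∀ x, Monotone (N x)) (hK : HasCommutatorKernelBound p w Ω N)
    (hV : ∀ (x : EuclideanSpace ℝ (Fin n)) (r : ℝ), 0 < r →
      ∫⁻ y in ball x r, ENNReal.ofReal (w y ^ (1 - p.conjExponent)) < ∞) (c₀ A : ℝ≥0) :
    ∃ C : ℝ≥0, ∀ (b : EuclideanSpace ℝ (Fin n) → 𝕜)
      (D : Submodule 𝕜 (EuclideanSpace ℝ (Fin n) → 𝕜))
      (T : (EuclideanSpace ℝ (Fin n) → 𝕜) → (EuclideanSpace ℝ (Fin n) → 𝕜)),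
      IsBMO b → IsRoughCommutator p w c₀ A Ω b D T →
      ∀ (x₀ : EuclideanSpace ℝ (Fin n)) (r : ℝ), 0 < r →
      ∀ f ∈ D, MemLpWeightLoc p w f →
        eLpNorm (T f) (ENNReal.ofReal p) ((weightMeasure w).restrict (ball x₀ r)) ≤
          C * bmoSeminorm b * N x₀ r ^ (1 / p) *
            ∫⁻ t in Ioi (2 * r), ENNReal.ofReal (1 + Real.log (t / r)) *
              eLpNorm f (ENNReal.ofReal p) ((weightMeasure w).restrict (ball x₀ t)) *
              N x₀ t ^ (-(1 / p)) * ENNReal.ofReal (1 / t) := by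
  obtain ⟨Cd, hCd⟩ := hdbl
  obtain ⟨CK, hCK⟩ := hK
  have hp0 : 0 < p := by linarith
  have hip : (0 : ℝ) ≤ 1 / p := by positivity
  refine ⟨(A * Cd ^ (1 / p) + c₀ * 4 ^ n * CK) * (4 * Cd ^ (1 / p)), ?_⟩
  intro b D T hb hT x₀ r hr f hfD hf
  set μ := weightMeasure w with hμ
  set F : ℝ → ℝ≥0∞ := fun t => eLpNorm f (ENNReal.ofReal p) (μ.restrict (ball x₀ t)) with hF
  set S : ℝ≥0∞ := ∑' k : ℕ, ((k : ℝ≥0∞) + 2) *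
    (N x₀ (2 ^ (k + 1) * r) ^ (-(1 / p)) * F (2 ^ (k + 1) * r)) with hS
  set β := bmoSeminorm b
  have hFmono : Monotone F := fun s t hst =>
    eLpNorm_mono_measure _ (Measure.restrict_mono (ball_subset_ball hst) le_rfl)
  have hSI := tsum_dyadic_le_lintegral hp0 hr (hN x₀) (hCd x₀) (hmono x₀) hFmono
  have hfm := hf.aestronglyMeasurable hw
  have h2r : 0 < 2 * r := by positivity
  set f₁ := (ball x₀ (2 * r)).indicator f with hf₁
  set f₂ := f - f₁ with hf₂
  have hf₁p : MemLpWeight p w f₁ := hf.memLpWeight_indicator_ball x₀ h2r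
  have hf₁D := hT.mem_domain _ hf₁p
  have hf₂D : f₂ ∈ D := D.sub_mem hfD hf₁D
  have hf₂le : ∀ y, ‖f₂ y‖ₑ ≤ ‖f y‖ₑ := fun y => by
    by_cases hy : y ∈ ball x₀ (2 * r) <;> simp [hf₂, hf₁, hy]
  have hf₂0 : ∀ y ∈ ball x₀ (2 * r), f₂ y = 0 := fun y hy => by simp [hf₂, hf₁, hy]
  have hf₂m : AEStronglyMeasurable f₂ volume := hfm.sub (hfm.indicator measurableSet_ball)
  have hf₂loc : MemLpWeightLoc p w f₂ := fun x t ht =>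
    (hf x t ht).sub (hf₁p.mono_measure Measure.restrict_le_self)
  have hnear : eLpNorm (T f₁) (ENNReal.ofReal p) (μ.restrict (ball x₀ r)) ≤
      A * Cd ^ (1 / p) * β * N x₀ r ^ (1 / p) * S := by
    have hF2 : F (2 * r) ≤ Cd ^ (1 / p) * N x₀ r ^ (1 / p) * S := by
      have h0 : N x₀ (2 * r) ^ (1 / p) ≠ 0 := by
        rw [Ne, ENNReal.rpow_eq_zero_iff_of_pos (by positivity)]; exact (hN x₀ _ h2r).1
      have ht : N x₀ (2 * r) ^ (1 / p) ≠ ∞ := ENNReal.rpow_ne_top_of_nonneg hip (hN x₀ _ h2r).2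
      -- Already the term `k = 0` suffices.
      have hterm : N x₀ (2 * r) ^ (-(1 / p)) * F (2 * r) ≤ S := by
        have h1 := ENNReal.le_tsum (f := fun k : ℕ => ((k : ℝ≥0∞) + 2) *
          (N x₀ (2 ^ (k + 1) * r) ^ (-(1 / p)) * F (2 ^ (k + 1) * r))) 0
        simp only [zero_add, pow_one, Nat.cast_zero] at h1
        refine le_trans ?_ h1
        exact le_mul_of_one_le_left zero_le (by norm_num)
      calc F (2 * r) = N x₀ (2 * r) ^ (1 / p) * (N x₀ (2 * r) ^ (-(1 / p)) * F (2 * r)) := by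
            rw [← mul_assoc, ENNReal.rpow_neg, ENNReal.mul_inv_cancel h0 ht, one_mul]
        _ ≤ (Cd * N x₀ r) ^ (1 / p) * S := by
            gcongr
            exact hCd x₀ r hr
        _ = _ := by rw [ENNReal.mul_rpow_of_nonneg _ _ hip]
    have he : eLpNorm f₁ (ENNReal.ofReal p) μ = F (2 * r) :=
      eLpNorm_indicator_eq_eLpNorm_restrict measurableSet_ball
    calc _ ≤ eLpNorm (T f₁) (ENNReal.ofReal p) μ := eLpNorm_mono_measure _ Measure.restrict_le_self
      _ ≤ A * β * F (2 * r) := he ▸ hT.bounded _ hf₁p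
      _ ≤ A * β * (Cd ^ (1 / p) * N x₀ r ^ (1 / p) * S) := by gcongr
      _ = _ := by ring
  -- Stated for every `g` dominated by `f₂`, so that it serves the truncations with the same
  -- constant.
  have hfar : ∀ g : EuclideanSpace ℝ (Fin n) → 𝕜, (∀ y, ‖g y‖ₑ ≤ ‖f₂ y‖ₑ) →
      SizeConditionAt c₀ Ω b T g →
      eLpNorm (T g) (ENNReal.ofReal p) (μ.restrict (ball x₀ r)) ≤
        c₀ * 4 ^ n * CK * β * N x₀ r ^ (1 / p) * S := fun g hg hsize =>
    eLpNorm_le_of_sizeCondition hp hΩ hb hr (hCK b hb x₀ r hr) hfm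
      (fun y => (hg y).trans (hf₂le y))
      (fun y hy => by simpa [hf₂0 y hy] using hg y) hsize
  have hf₂T : eLpNorm (T f₂) (ENNReal.ofReal p) (μ.restrict (ball x₀ r)) ≤
        c₀ * 4 ^ n * CK * β * N x₀ r ^ (1 / p) * S := by
    -- If `f₂ ∈ L_p(w)`, the size condition is available only for its truncations; the remainder
    -- tends to zero in `L_p(w)` and boundedness absorbs it. Otherwise the size condition is assumed
    -- for `f₂` itself.
    by_cases hmem : MemLpWeight p w f₂
    · set h : ℕ → EuclideanSpace ℝ (Fin n) → 𝕜 := fun m => (ball x₀ (m : ℝ)).indicator f₂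
      have hlim := MemLpWeight.tendsto_eLpNorm_sub_indicator_ball hp0 hmem x₀
      have hlim2 : Filter.Tendsto (fun m : ℕ => c₀ * 4 ^ n * CK * β * N x₀ r ^ (1 / p) * S +
          A * β * eLpNorm (f₂ - h m) (ENNReal.ofReal p) μ) Filter.atTop
          (nhds (c₀ * 4 ^ n * CK * β * N x₀ r ^ (1 / p) * S + A * β * 0)) :=
        tendsto_const_nhds.add (ENNReal.Tendsto.const_mul hlim
          (Or.inr (ENNReal.mul_ne_top ENNReal.coe_ne_top hb.2.ne)))
      rw [mul_zero, add_zero] at hlim2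
      refine ge_of_tendsto hlim2 ?_
      filter_upwards [Filter.eventually_gt_atTop 0] with m hm
      have hm' : (0 : ℝ) < m := Nat.cast_pos.2 hm
      have hhp : MemLpWeight p w (h m) := hf₂loc.memLpWeight_indicator_ball x₀ hm'
      have hhD := hT.mem_domain _ hhp
      have hdp : MemLpWeight p w (f₂ - h m) := hmem.sub hhp
      have hint : Integrable (h m) :=
        (integrable_indicator_iff measurableSet_ball).2 (hf₂loc.integrableOn_ball hw hp hV x₀ hm')
      have hcs : HasCompactSupport (h m) :=
        HasCompactSupport.intro (isCompact_closedBall x₀ (m : ℝ)) fun y hy =>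
          indicator_of_notMem (fun hy' => hy (ball_subset_closedBall hy')) _
      have h1 := hT.sublinear.eLpNorm_le_add (w := w) hp.le hhD (hT.mem_domain _ hdp) x₀ r
      rw [add_sub_cancel] at h1
      refine h1.trans (add_le_add (hfar _ (fun y => ?_) (hT.size _ hhD hint hcs)) ?_)
      · exact enorm_indicator_le_enorm_self _ _
      · exact (eLpNorm_mono_measure _ Measure.restrict_le_self).trans (hT.bounded _ hdp)
    · exact hfar _ (fun _ => le_rfl) (hT.size_loc _ hf₂D hf₂loc hmem)
  have hsum := hT.sublinear.eLpNorm_le_add (w := w) hp.le hf₁D hf₂D x₀ r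
  rw [hf₂, add_sub_cancel] at hsum
  calc _ ≤ _ := hsum
    _ ≤ A * Cd ^ (1 / p) * β * N x₀ r ^ (1 / p) * S +
        c₀ * 4 ^ n * CK * β * N x₀ r ^ (1 / p) * S := add_le_add hnear hf₂T
    _ = (A * Cd ^ (1 / p) + c₀ * 4 ^ n * CK) * β * N x₀ r ^ (1 / p) * S := by ring
    _ ≤ (A * Cd ^ (1 / p) + c₀ * 4 ^ n * CK) * β * N x₀ r ^ (1 / p) * _ :=
        mul_le_mul_right hSI _
    _ = _ := by
        rw [ENNReal.coe_mul, ENNReal.coe_add, ENNReal.coe_mul, ENNReal.coe_mul, ENNReal.coe_mul,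
          ENNReal.coe_mul, ENNReal.coe_rpow_of_nonneg _ hip]
        push_cast
        simp only [hF]
        ring

end Reduction

/-! ### Local facts for part (i), and the case `s = ∞`. -/

section MuckenhouptLocal

variable {n : ℕ} {w : EuclideanSpace ℝ (Fin n) → ℝ}

/-- If `w ∈ A_q` with `q ≤ p`, then `w^{1-p'}` is integrable over balls. -/
theorem IsMuckenhoupt.lintegral_rpow_conjExponent_lt_top {q p : ℝ} (h : IsMuckenhoupt q w)
    (hp : 1 < p) (hqp : q ≤ p) (x : EuclideanSpace ℝ (Fin n)) {r : ℝ} (hr : 0 < r) :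
    ∫⁻ y in ball x r, ENNReal.ofReal (w y ^ (1 - p.conjExponent)) < ∞ := by
  have hp1 : p.conjExponent - 1 = 1 / (p - 1) := by
    have : p - 1 ≠ 0 := by linarith
    rw [Real.conjExponent]; field_simp; ring
  have hneg : 1 - p.conjExponent ≤ 0 := by
    have : 0 < 1 / (p - 1) := one_div_pos.2 (by linarith)
    linarith
  have hv : volume (ball x r) < ∞ := measure_ball_lt_top
  rcases h.2 with ⟨-, C, hC⟩ | ⟨hq, -⟩
  · set a := ⨍⁻ y in ball x r, ENNReal.ofReal (w y) ∂volume with ha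
    have ha0 : a ≠ 0 := by
      rw [ha, setLAverage_eq]
      exact ENNReal.div_ne_zero.2 ⟨h.1.lintegral_ball_ne_zero x hr, hv.ne⟩
    have hat : a ≠ ∞ := by
      rw [ha, setLAverage_eq]
      exact ENNReal.div_ne_top (h.1.lintegral_ball_lt_top x r).ne (volume_ball_ne_zero x hr)
    have hapos : 0 < a.toReal := ENNReal.toReal_pos ha0 hat
    have hCpos : (0 : ℝ) < C + 1 := by positivity
    -- An `A_1` weight is bounded below on the ball by its mean over `C + 1`, where the `1` guards
    -- against `C = 0`; a nonpositive power of it is then bounded above.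
    refine lt_of_le_of_lt (lintegral_mono_ae (g := fun _ =>
      ENNReal.ofReal ((a.toReal / (C + 1)) ^ (1 - p.conjExponent))) ?_) ?_
    · filter_upwards [hC x r hr, ae_restrict_of_ae h.1.2] with y hy hy0
      refine ENNReal.ofReal_le_ofReal (Real.rpow_le_rpow_of_nonpos (by positivity) ?_ hneg)
      rw [div_le_iff₀ hCpos]
      have h1 := ENNReal.toReal_mono (ENNReal.mul_ne_top ENNReal.coe_ne_top ENNReal.ofReal_ne_top) hy
      rw [ENNReal.toReal_mul, ENNReal.coe_toReal, ENNReal.toReal_ofReal hy0.le] at h1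
      nlinarith
    · rw [setLIntegral_const]
      exact ENNReal.mul_lt_top ENNReal.ofReal_lt_top hv
  · have hexp : 1 - q.conjExponent ≤ 1 - p.conjExponent := by
      have hq1 : q.conjExponent - 1 = 1 / (q - 1) := by
        have : q - 1 ≠ 0 := by linarith
        rw [Real.conjExponent]; field_simp; ring
      have := one_div_le_one_div_of_le (by linarith : 0 < q - 1) (by linarith : q - 1 ≤ p - 1)
      linarith
    -- Where `w ≥ 1` the power is at most `1`; where `w ≤ 1` it is at most `w^(1-q')`, since `1 - q'
    -- ≤ 1 - p'`.
    refine lt_of_le_of_lt (lintegral_mono_ae (g := fun y =>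
      1 + ENNReal.ofReal (w y ^ (1 - q.conjExponent))) ?_) ?_
    · filter_upwards [ae_restrict_of_ae h.1.2] with y hy
      rw [← ENNReal.ofReal_one, ← ENNReal.ofReal_add zero_le_one (by positivity)]
      refine ENNReal.ofReal_le_ofReal ?_
      rcases le_total 1 (w y) with h1 | h1
      · have := Real.rpow_le_one_of_one_le_of_nonpos h1 hneg
        have : 0 ≤ w y ^ (1 - q.conjExponent) := by positivity
        linarith
      · have := Real.rpow_le_rpow_of_exponent_ge hy h1 hexp
        linarith
    · rw [lintegral_add_left measurable_const, setLIntegral_one]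
      exact ENNReal.add_lt_top.2 ⟨hv, h.lintegral_dual_lt_top hq x hr⟩

theorem eLpNorm_one_ball (hw : IsWeight w) (x : EuclideanSpace ℝ (Fin n)) (r : ℝ) :
    eLpNorm w 1 (volume.restrict (ball x r)) = weightMeasure w (ball x r) := by
  rw [eLpNorm_one_eq_lintegral_enorm, weightMeasure, withDensity_ball]
  apply lintegral_congr_ae
  filter_upwards [ae_restrict_of_ae hw.2] with y hy
  exact Real.enorm_eq_ofReal hy.le

theorem IsWeight.weightMeasure_ball_ne (hw : IsWeight w) (x : EuclideanSpace ℝ (Fin n)) {r : ℝ}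
    (hr : 0 < r) : weightMeasure w (ball x r) ≠ 0 ∧ weightMeasure w (ball x r) ≠ ∞ := by
  rw [weightMeasure, withDensity_ball]
  exact ⟨hw.lintegral_ball_ne_zero x hr, (hw.lintegral_ball_lt_top x r).ne⟩

theorem IsMuckenhoupt.exists_doubling {q : ℝ} (h : IsMuckenhoupt q w) :
    ∃ C : ℝ≥0, ∀ (x : EuclideanSpace ℝ (Fin n)) (r : ℝ), 0 < r →
      weightMeasure w (ball x (2 * r)) ≤ C * weightMeasure w (ball x r) := by
  obtain ⟨C, hC⟩ := h.exists_hasAveragingBound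
  have ht : C * ENNReal.ofReal (2 ^ n) ^ q ≠ ∞ := ENNReal.mul_ne_top ENNReal.coe_ne_top
    (ENNReal.rpow_ne_top_of_nonneg hC.pos.le ENNReal.ofReal_ne_top)
  refine ⟨(C * ENNReal.ofReal (2 ^ n) ^ q).toNNReal, fun x r hr => ?_⟩
  rw [ENNReal.coe_toNNReal ht]
  exact hC.measure_ball_le hr two_pos (ball_subset_ball (by linarith))

theorem ENNReal.conjExponent_top : ENNReal.conjExponent ∞ = 1 := by
  simp [ENNReal.conjExponent]

/-- The kernel bound for `w ∈ A_{p/s'}`, with `s = ∞` allowed. -/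
theorem IsMuckenhoupt.hasCommutatorKernelBound {𝕜 : Type*} [RCLike 𝕜] (hn : 1 ≤ n) {p : ℝ}
    (hp : 1 < p) {s : ℝ≥0∞} (hs : 1 < s) {Ω : EuclideanSpace ℝ (Fin n) → 𝕜}
    (hΩ : IsRoughKernel s Ω) (hA : IsMuckenhoupt (p / (ENNReal.conjExponent s).toReal) w) :
    HasCommutatorKernelBound p w Ω fun x t => weightMeasure w (ball x t) := by
  rcases eq_or_ne s ∞ with rfl | hst
  -- For `s = ∞` the hypothesis is `w ∈ A_p`, which dualizes to `w^(1-p') ∈ A_{p'}`; the exponent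
  -- `(s/p)'` is `1`, so the norm of `w` there is `w(B)`.
  · have hdual := hA
    rw [ENNReal.conjExponent_top, ENNReal.toReal_one, div_one] at hdual
    have h := (hasCommutatorKernelBound_of_dual hn hp hs hΩ hA.1 ENNReal.ofReal_lt_top
      (by rw [ENNReal.conjExponent_top, ENNReal.toReal_one, div_one]; exact hdual.dual hp)).2.2
    rw [ENNReal.top_div_of_ne_top ENNReal.ofReal_ne_top, ENNReal.conjExponent_top] at h
    simpa only [eLpNorm_one_ball hA.1] using h
  · exact hasCommutatorKernelBound_of_muckenhoupt hn hp hs hst hΩ hA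

end MuckenhouptLocal

/-! ### The two weighted estimates. -/

theorem lemma4 {𝕜 : Type*} [RCLike 𝕜] (n : ℕ) (hn : 2 ≤ n) (p : ℝ) (hp : 1 < p)
    (s : ℝ≥0∞) (hs : 1 < s)
    (Ω : EuclideanSpace ℝ (Fin n) → 𝕜) (hΩ : IsRoughKernel s Ω)
    (w : EuclideanSpace ℝ (Fin n) → ℝ) (hw : IsWeight w) (c₀ A : ℝ≥0) :
    (ENNReal.conjExponent s ≤ ENNReal.ofReal p →
      IsMuckenhoupt (p / (ENNReal.conjExponent s).toReal) w →
      ∃ C : ℝ≥0, ∀ (b : EuclideanSpace ℝ (Fin n) → 𝕜)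
        (D : Submodule 𝕜 (EuclideanSpace ℝ (Fin n) → 𝕜))
        (T : (EuclideanSpace ℝ (Fin n) → 𝕜) → (EuclideanSpace ℝ (Fin n) → 𝕜)),
        IsBMO b → IsRoughCommutator p w c₀ A Ω b D T →
        ∀ (x₀ : EuclideanSpace ℝ (Fin n)) (r : ℝ), 0 < r →
        ∀ f ∈ D, MemLpWeightLoc p w f →
          eLpNorm (T f) (ENNReal.ofReal p) ((weightMeasure w).restrict (ball x₀ r)) ≤
            C * bmoSeminorm b * weightMeasure w (ball x₀ r) ^ (1 / p) *
              ∫⁻ t in Ioi (2 * r), ENNReal.ofReal (1 + Real.log (t / r)) *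
                eLpNorm f (ENNReal.ofReal p) ((weightMeasure w).restrict (ball x₀ t)) *
                weightMeasure w (ball x₀ t) ^ (-(1 / p)) * ENNReal.ofReal (1 / t)) ∧
    (ENNReal.ofReal p < s →
      IsMuckenhoupt (Real.conjExponent p / (ENNReal.conjExponent s).toReal)
        (fun x => w x ^ (1 - Real.conjExponent p)) →
      ∃ C : ℝ≥0, ∀ (b : EuclideanSpace ℝ (Fin n) → 𝕜)
        (D : Submodule 𝕜 (EuclideanSpace ℝ (Fin n) → 𝕜))
        (T : (EuclideanSpace ℝ (Fin n) → 𝕜) → (EuclideanSpace ℝ (Fin n) → 𝕜)),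
        IsBMO b → IsRoughCommutator p w c₀ A Ω b D T →
        ∀ (x₀ : EuclideanSpace ℝ (Fin n)) (r : ℝ), 0 < r →
        ∀ f ∈ D, MemLpWeightLoc p w f →
          eLpNorm (T f) (ENNReal.ofReal p) ((weightMeasure w).restrict (ball x₀ r)) ≤
            C * bmoSeminorm b *
              eLpNorm w (ENNReal.conjExponent (s / ENNReal.ofReal p)) (volume.restrict (ball x₀ r)) ^ (1 / p) *
              ∫⁻ t in Ioi (2 * r), ENNReal.ofReal (1 + Real.log (t / r)) *
                eLpNorm f (ENNReal.ofReal p) ((weightMeasure w).restrict (ball x₀ t)) *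
                eLpNorm w (ENNReal.conjExponent (s / ENNReal.ofReal p)) (volume.restrict (ball x₀ t)) ^ (-(1 / p)) *
                ENNReal.ofReal (1 / t)) := by
  have hn1 : 1 ≤ n := by omega
  have hΩm := hΩ.aestronglyMeasurable hn1
  refine ⟨fun hsp hA => ?_, fun hps hA => ?_⟩
  · refine exists_eLpNorm_commutator_le hp hw hΩm hA.exists_doubling
      (fun x r hr => hw.weightMeasure_ball_ne x hr)
      (fun x s t hst => measure_mono (ball_subset_ball hst))
      (hA.hasCommutatorKernelBound hn1 hp hs hΩ) (fun x r hr => ?_) c₀ A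
    -- Here the order of the weight is `p/s' ≤ p`, because `s' ≥ 1`.
    refine hA.lintegral_rpow_conjExponent_lt_top hp ?_ x hr
    refine div_le_self (by linarith) ?_
    have h1 : 1 ≤ ENNReal.conjExponent s := by simp [ENNReal.conjExponent]
    simpa using ENNReal.toReal_mono (ne_top_of_le_ne_top ENNReal.ofReal_ne_top hsp) h1
  · obtain ⟨hdbl, hN, hK⟩ := hasCommutatorKernelBound_of_dual hn1 hp hs hΩ hw hps hA
    exact exists_eLpNorm_commutator_le hp hw hΩm hdbl hN
      (fun x s t hst => eLpNorm_mono_measure _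
        (Measure.restrict_mono (ball_subset_ball hst) le_rfl))
      hK (fun x r hr => hA.1.lintegral_ball_lt_top x r) c₀ A
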